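/- Let $\sigma(v)=1/(1+e^{-v})$ and $\sigma_\tau(v)=\sigma(\tau v)$. Data: $x_1,\dots,x_n\sim\mathcal N(0,I_d)$ i.i.d., the normalized covariates are $z_i=x_i/\sqrt d$, the gold model satisfies $\|w_*\|_2\le 1$, and $y_i=\sigma(\langle z_i,w_*\rangle)+\epsilon_i$ where the $\epsilon_i$ are i.i.d., independent of the covariates, with $\mathbb E\,\epsilon_i=0$ and $|\epsilon_i|\le\varsigma$ almost surely ($\varsigma>0$). Assume that $\varsigma$ is so small that $$\tau_{\max}:=\frac{e^{-3/\sqrt d}}{26}\sqrt{\frac2\pi}\cdot\frac1\varsigma\ \ge\ 1 .$$ For $\tau\in(0,1]$ put $y_i^\tau=\sigma_\tau(\sigma^{-1}(y_i))$ for $\tau<1$ and $y_i^1=y_i$ (if $y_i\notin(0,1)$, the value of $\sigma^{-1}(y_i)$ is chosen by an arbitrary fixed real function), and $\mathcal L_\tau(w)=\frac1n\sum_{i=1}^n(y_i^\tau-\sigma_\tau(\langle z_i,w\rangle))^2$. AGGLIO starts at some $\|w_0\|_2\le1$ with temperature $\tau_0$ and performs, with no cap on the temperature other than $1$, $$w_{t+1}=w_t-\eta_t\nabla\mathcal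 L_{\tau_t}(w_t),\qquad \tau_{t+1}=\min\{\beta_t\tau_t,1\}.$$ For constants $t_0>0$, $b>1$, $\kappa>0$, call the hyperparameters *admissible* if $t_0\le\tau_0\le1$, and for all $t$: $\beta_t\ge b$ and $\kappa\, d/\tau_t^2\le\eta_t\le 2d/\tau_t^2$. **Theorem.** 1. (Dimension-explicit bound.) There are universal constants $c,C>0$ such that for all $t_0>0$, $b>1$, $\kappa>0$ there is $A=A(t_0,b,\kappa)>0$ with the following property. Whenever $d\ge1$ and $n\ge C\,d\log(d+1)$, for all data models and admissible hyperparameters as above, with probability at least $1-Ce^{-cd}-2ne^{-d}$ the following holds for every $\epsilon>0$ and every number of steps $T\ge A\max\{1,\ln\frac1\epsilon\}$: $$\|w_T-w_*\|_2\ \le\ C\Big(\sqrt d\cdot\varsigma\sqrt{\tfrac dn}+\epsilon\Big).$$ 2. (Fixed dimension.) For every $d\ge1$, $\delta>0$, $t_0>0$, $b>1$, $\kappa>0$ there are $A,C>0$ and $n_0$, depending only on these, such that for all $n\ge n_0$ and all data models and admissible hyperparameters as above, with probability at least $1-\delta$, for every $\epsilon>0$ and every $T\ge A\max\{1,\ln\frac1\epsilon\}$,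 $$\|w_T-w_*\|_2\ \le\ C\Big(\varsigma\sqrt{\tfrac dn}+\epsilon\Big).$$ 3. (Consistency.) For fixed $d\ge1$, a fixed data model and fixed admissible hyperparameters, and for any numbers of steps $T_n\to\infty$, one has $\|w_{T_n}-w_*\|_2\to0$ in probability as $n\to\infty$. -/

import Mathlib

open MeasureTheory ProbabilityTheory Filter Topology
open scoped BigOperators

/-- The graduated activation `σ_τ(v) = σ(τ v)` (no `1/τ` normalization for the sigmoid). -/
noncomputable def gradSigmoid (τ v : ℝ) : ℝ := Real.sigmoid (τ * v)

/-- The graduated label `y^τ = σ_τ(σ⁻¹(y))`, with `y¹ = y`. Here `inv` is any left inverse of the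
sigmoid on the whole line, so it is `σ⁻¹` on the range `(0, 1)` of `σ` and arbitrary elsewhere. -/
noncomputable def gradLabel (inv : ℝ → ℝ) (τ y : ℝ) : ℝ :=
  if τ = 1 then y else gradSigmoid τ (inv y)

/-- On labels in the range of `σ` the convention `y¹ = y` agrees with `σ_1(σ⁻¹(y))`. -/
theorem gradLabel_sigmoid {inv : ℝ → ℝ} (hinv : Function.LeftInverse inv Real.sigmoid) (τ v : ℝ) :
    gradLabel inv τ (Real.sigmoid v) = gradSigmoid τ v := by
  unfold gradLabel
  split_ifs with h
  · rw [h, gradSigmoid, one_mul]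
  · rw [hinv v]

/-- The graduated objective `𝓛_τ(w) = (1/n) ∑ᵢ (yᵢ^τ - σ_τ(⟨zᵢ, w⟩))²` of the data `(zᵢ, yᵢ)`. -/
noncomputable def gradObjective {d n : ℕ} (inv : ℝ → ℝ)
    (z : Fin n → EuclideanSpace ℝ (Fin d)) (y : Fin n → ℝ) (τ : ℝ)
    (w : EuclideanSpace ℝ (Fin d)) : ℝ :=
  (1 / (n : ℝ)) * ∑ i, (gradLabel inv τ (y i) - gradSigmoid τ (inner ℝ (z i) w)) ^ 2

/-- The temperatures: `τ_{t+1} = min (β_t τ_t) 1`. -/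
noncomputable def temperature (τ₀ : ℝ) (β : ℕ → ℝ) : ℕ → ℝ
  | 0 => τ₀
  | t + 1 => min (β t * temperature τ₀ β t) 1

/-- The AGGLIO iterates with full gradient steps:
`w_{t+1} = w_t - η_t ∇𝓛_{τ_t}(w_t)`. -/
noncomputable def agglio {d n : ℕ} (inv : ℝ → ℝ) (z : Fin n → EuclideanSpace ℝ (Fin d))
    (y : Fin n → ℝ) (τ₀ : ℝ) (β η : ℕ → ℝ)
    (w₀ : EuclideanSpace ℝ (Fin d)) : ℕ → EuclideanSpace ℝ (Fin d)
  | 0 => w₀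
  | t + 1 => agglio inv z y τ₀ β η w₀ t -
      η t • gradient (gradObjective inv z y (temperature τ₀ β t)) (agglio inv z y τ₀ β η w₀ t)

/-- A sample point is a Gaussian vector and a noise value for each of `n` data points. -/
abbrev Sample (d n : ℕ) : Type := Fin n → EuclideanSpace ℝ (Fin d) × ℝ

/-- The law of the sample: the pairs `(xᵢ, εᵢ)` are i.i.d., `xᵢ ∼ N(0, I_d)`, and `εᵢ ∼ ν` is
independent of `xᵢ`. -/
noncomputable def sampleLaw (d n : ℕ) (ν : Measure ℝ) : Measure (Sample d n) :=
  Measure.pi fun _ => (stdGaussian (EuclideanSpace ℝ (Fin d))).prod ν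

/-- The normalized covariates `xᵢ / √d`. -/
noncomputable def covariate {d n : ℕ} (S : Sample d n) (i : Fin n) : EuclideanSpace ℝ (Fin d) :=
  (1 / √(d : ℝ)) • (S i).1

/-- Labels with post-activation noise: `yᵢ = σ(⟨xᵢ / √d, w⋆⟩) + εᵢ`. -/
noncomputable def postLabel {d n : ℕ} (wStar : EuclideanSpace ℝ (Fin d)) (S : Sample d n)
    (i : Fin n) : ℝ :=
  Real.sigmoid (inner ℝ (covariate S i) wStar) + (S i).2

/-- The recovery error `‖w_T - w⋆‖` of AGGLIO on the sample `S`. -/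
noncomputable def recoveryError {d n : ℕ} (inv : ℝ → ℝ) (wStar w₀ : EuclideanSpace ℝ (Fin d))
    (τ₀ : ℝ) (β η : ℕ → ℝ) (S : Sample d n) (T : ℕ) : ℝ :=
  ‖agglio inv (covariate S) (postLabel wStar S) τ₀ β η w₀ T - wStar‖

/-- Unbiased noise distribution with support in `[-ς, ς]`. -/
structure IsBoundedNoise (ν : Measure ℝ) (ς : ℝ) : Prop where
  isProb : IsProbabilityMeasure ν
  bounded : ∀ᵐ e ∂ν, |e| ≤ ς
  mean_zero : ∫ e, e ∂ν = 0

/-- The temperature cap for post-activation noise of width `ς`, normalized covariates and the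
model norm bound `R = 1`. -/
noncomputable def tauMax (d : ℕ) (ς : ℝ) : ℝ :=
  Real.exp (-3 / √(d : ℝ)) / 26 * √(2 / Real.pi) * (1 / ς)

/-- Admissible hyperparameters: the initial temperature lies in `[t₀, 1]`, the temperature is
multiplied by at least `b` at each step until it reaches `1`, and the step lengths are of the
order `d / τ_t²` of an inverse smoothness constant of `𝓛_{τ_t}`. -/
structure Admissible (d : ℕ) (t₀ b κ τ₀ : ℝ) (β η : ℕ → ℝ) : Prop where
  init_ge : t₀ ≤ τ₀
  init_le : τ₀ ≤ 1
  incr : ∀ t, b ≤ β t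
  step_ge : ∀ t, κ * (d / temperature τ₀ β t ^ 2) ≤ η t
  step_le : ∀ t, η t ≤ 2 * (d / temperature τ₀ β t ^ 2)

/-! Work in units of `√d`: put `u = (w_t - w⋆)/√d`, `v = w⋆/√d`, and let `x_i = √d z_i` be standard
Gaussian. A step becomes `u - 2ρ g` with rate `ρ = η_t τ_t²/d` in `[κ, 2]`. If the label equals
`σ_τ(⟨x_i, v⟩ + δ_i)`, the mean value theorem gives `g = avg w_i (⟨x_i, u⟩ - δ_i) x_i` with `0 ≤ w_i
≤ 1/16`. So each step is a gradient step for weighted least squares. The weights degenerate only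
where `⟨x_i, u⟩`, `⟨x_i, v⟩` or `δ_i` is large. A design whose second moment is bounded above, and
below even after truncation, therefore still has some curvature `h > 0`
(`WellConditioned.le_avg_weighted`). Gaussian designs have this property with high probability once
`n` is a large multiple of `d`, by Chernoff bounds on a net (`sampleLaw_not_wellConditioned_le`).

The temperature equals `1` after `T₀` steps, with `T₀` depending only on `t₀` and `b`. From then on
the noise is additive and centered. The noise part of the gradient at `v` has size of order `ς
√(d/n)`, and at `v + u` it differs from this by at most `θ ‖u‖`. If `2θ < 3h/2` the step is a
contraction up to that perturbation, and the error decays geometrically to the noise level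
(`WellConditioned.norm_step_le_of_noise`, `perturbed_contraction`). Undoing the scaling costs a
factor `√d`.

The two quantitative parts differ in the burn-in and in the bound for `θ`. In fixed dimension every
step moves by at most `3/t₀`, so the error at time `T₀` is bounded whatever the labels are. The
constant `h` then depends on this bound, and `θ` has to be made small against it: the noise Hessian
is centered, hence uniformly small on balls for large `n` (`exists_sampleLaw_noise_form_le`).

In high dimension the constants have to be universal. With probability at least `1 - 2n e^{-d}` all
`|⟨x_i, v⟩|` are at most `√2`, so all labels lie in `(0, 1)` and the logit errors `δ_i` are small.
This makes the ball `‖u‖ ≤ 3/10` invariant, with a universal `h`; the assumption on `ς` makes the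
Lipschitz bound for `θ` sufficient. For the number of steps to be independent of `d`, the error at
time `T₀` must also be of order `1/√d + ς √(d/n)`. This holds because the label logit is close to a
function of the noise alone, whose average against `x_i` is centered
(`WellConditioned.norm_step_le_growth`). The factor `2^T₀` lost on the way is absorbed by further
contraction steps. Dimensions below `10⁶` are covered by a constant `C` that makes the probability
bound trivial. Consistency follows from the fixed-dimension statement. -/

/-- The derivative `σ (1 - σ)` of the sigmoid. -/
noncomputable def sigmoidDeriv (a : ℝ) : ℝ := Real.sigmoid a * (1 - Real.sigmoid a)

/-- The second derivative `σ (1 - σ) (1 - 2 σ)` of the sigmoid. -/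
noncomputable def sigmoidDeriv₂ (a : ℝ) : ℝ := sigmoidDeriv a * (1 - 2 * Real.sigmoid a)

/-! ### Calculus of the sigmoid and its derivatives. -/

theorem sigmoidDeriv_eq (a : ℝ) : sigmoidDeriv a = 1 / 4 - (Real.sigmoid a - 1 / 2) ^ 2 := by
  unfold sigmoidDeriv; ring

theorem sigmoidDeriv_pos (a : ℝ) : 0 < sigmoidDeriv a :=
  mul_pos (Real.sigmoid_pos a) (by linarith [Real.sigmoid_lt_one a])

theorem sigmoidDeriv_le (a : ℝ) : sigmoidDeriv a ≤ 1 / 4 := by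
  rw [sigmoidDeriv_eq]; linarith [sq_nonneg (Real.sigmoid a - 1 / 2)]

theorem hasDerivAt_sigmoid_sigmoidDeriv (a : ℝ) :
    HasDerivAt Real.sigmoid (sigmoidDeriv a) a := Real.hasDerivAt_sigmoid a

theorem hasDerivAt_sigmoidDeriv (a : ℝ) : HasDerivAt sigmoidDeriv (sigmoidDeriv₂ a) a := by
  have h := hasDerivAt_sigmoid_sigmoidDeriv a
  have := h.mul (h.const_sub 1)
  refine this.congr_deriv ?_
  unfold sigmoidDeriv₂; ring

theorem continuous_sigmoidDeriv : Continuous sigmoidDeriv := by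
  unfold sigmoidDeriv
  have := continuous_sigmoid
  fun_prop

theorem continuous_sigmoidDeriv₂ : Continuous sigmoidDeriv₂ := by
  unfold sigmoidDeriv₂
  have := continuous_sigmoid
  have := continuous_sigmoidDeriv
  fun_prop

theorem sigmoid_sub_eq_of_lt {a b : ℝ} (h : a < b) :
    ∃ ξ ∈ Set.Icc a b, Real.sigmoid b - Real.sigmoid a = sigmoidDeriv ξ * (b - a) := by
  obtain ⟨ξ, hξ, h'⟩ := exists_hasDerivAt_eq_slope Real.sigmoid sigmoidDeriv h
    continuous_sigmoid.continuousOn (fun x _ => hasDerivAt_sigmoid_sigmoidDeriv x)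
  refine ⟨ξ, ⟨hξ.1.le, hξ.2.le⟩, ?_⟩
  rw [h', div_mul_cancel₀ _ (sub_ne_zero.2 h.ne')]

theorem sigmoid_sub_eq (a b : ℝ) :
    ∃ ξ ∈ Set.uIcc a b, Real.sigmoid a - Real.sigmoid b = sigmoidDeriv ξ * (a - b) := by
  rcases lt_trichotomy a b with h | h | h
  · obtain ⟨ξ, hξ, e⟩ := sigmoid_sub_eq_of_lt h
    exact ⟨ξ, Set.Icc_subset_uIcc hξ, by linarith⟩
  · exact ⟨a, Set.left_mem_uIcc, by simp [h]⟩
  · obtain ⟨ξ, hξ, e⟩ := sigmoid_sub_eq_of_lt h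
    exact ⟨ξ, Set.Icc_subset_uIcc' hξ, e⟩

theorem abs_sigmoid_sub_le (a b : ℝ) : |Real.sigmoid a - Real.sigmoid b| ≤ |a - b| / 4 := by
  obtain ⟨ξ, -, e⟩ := sigmoid_sub_eq a b
  rw [e, abs_mul, abs_of_pos (sigmoidDeriv_pos ξ)]
  nlinarith [sigmoidDeriv_le ξ, abs_nonneg (a - b)]

theorem abs_sigmoid_sub_half_le (a : ℝ) : |Real.sigmoid a - 1 / 2| ≤ |a| / 4 := by
  have := abs_sigmoid_sub_le a 0
  rw [Real.sigmoid_zero, sub_zero] at this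
  convert this using 3; norm_num

theorem abs_sigmoidDeriv_sub_le_abs_sigmoid_sub (a b : ℝ) :
    |sigmoidDeriv a - sigmoidDeriv b| ≤ |Real.sigmoid a - Real.sigmoid b| := by
  have : sigmoidDeriv a - sigmoidDeriv b
      = (Real.sigmoid a - Real.sigmoid b) * (1 - Real.sigmoid a - Real.sigmoid b) := by
    unfold sigmoidDeriv; ring
  rw [this, abs_mul]
  refine mul_le_of_le_one_right (abs_nonneg _) (abs_le.2 ⟨?_, ?_⟩) <;>
  linarith [Real.sigmoid_pos a, Real.sigmoid_pos b, Real.sigmoid_lt_one a, Real.sigmoid_lt_one b]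

theorem abs_sigmoidDeriv_sub_le (a b : ℝ) : |sigmoidDeriv a - sigmoidDeriv b| ≤ |a - b| / 4 :=
  (abs_sigmoidDeriv_sub_le_abs_sigmoid_sub a b).trans (abs_sigmoid_sub_le a b)

theorem sigmoidDeriv_zero : sigmoidDeriv 0 = 1 / 4 := by
  rw [sigmoidDeriv_eq, Real.sigmoid_zero]; norm_num

theorem le_sigmoidDeriv (a : ℝ) : 1 / 4 * (1 - a ^ 2 / 4) ≤ sigmoidDeriv a := by
  rw [sigmoidDeriv_eq]
  have h := abs_sigmoid_sub_half_le a
  have := sq_le_sq' (by linarith [abs_nonneg a, abs_nonneg (Real.sigmoid a - 1 / 2)]) h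
  rw [sq_abs, div_pow, sq_abs] at this
  linarith

/-- Turns bounds on pre-activations into lower bounds on the weights of the least squares problem.
-/
theorem sigmoidDeriv_anti {a B : ℝ} (h : |a| ≤ B) : sigmoidDeriv B ≤ sigmoidDeriv a := by
  rw [sigmoidDeriv_eq, sigmoidDeriv_eq]
  have h1 : Real.sigmoid a ≤ Real.sigmoid B := Real.sigmoid_le (le_of_abs_le h)
  have h2 : Real.sigmoid (-B) ≤ Real.sigmoid a := Real.sigmoid_le (neg_le_of_abs_le h)
  rw [Real.sigmoid_neg] at h2
  nlinarith

theorem abs_le_of_mem_uIcc {a b ξ B : ℝ} (hξ : ξ ∈ Set.uIcc a b) (ha : |a| ≤ B) (hb : |b| ≤ B) :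
    |ξ| ≤ B := by
  rw [abs_le] at *
  rcases Set.mem_uIcc.1 hξ with h | h <;> constructor <;> linarith [h.1, h.2, ha.1, ha.2, hb.1, hb.2]

/-- The increments of `σ_τ` as multiples of the increments of the argument. -/
theorem exists_slope_gradSigmoid {τ : ℝ} (h0 : 0 ≤ τ) (h1 : τ ≤ 1) (a b : ℝ) :
    ∃ s, 0 ≤ s ∧ s ≤ 1 / 4 ∧ gradSigmoid τ a - gradSigmoid τ b = τ * s * (a - b) ∧
      ∀ B, |a| ≤ B → |b| ≤ B → sigmoidDeriv B ≤ s := by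
  obtain ⟨ξ, hξ, e⟩ := sigmoid_sub_eq (τ * a) (τ * b)
  refine ⟨sigmoidDeriv ξ, (sigmoidDeriv_pos ξ).le, sigmoidDeriv_le ξ, ?_, fun B ha hb => ?_⟩
  · unfold gradSigmoid; rw [e]; ring
  · refine sigmoidDeriv_anti (abs_le_of_mem_uIcc hξ ?_ ?_) <;> rw [abs_mul, abs_of_nonneg h0]
    · exact (mul_le_of_le_one_left (abs_nonneg _) h1).trans ha
    · exact (mul_le_of_le_one_left (abs_nonneg _) h1).trans hb

theorem abs_gradSigmoid_sub_le {τ : ℝ} (h0 : 0 ≤ τ) (a b : ℝ) :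
    |gradSigmoid τ a - gradSigmoid τ b| ≤ τ * |a - b| / 4 := by
  refine (abs_sigmoid_sub_le _ _).trans (le_of_eq ?_)
  rw [← mul_sub, abs_mul, abs_of_nonneg h0]

/-- The logit is Lipschitz on label values that stay away from `0` and `1`. -/
theorem abs_sub_le_of_sigmoid_near_half {a b r : ℝ} (ha : |Real.sigmoid a - 1 / 2| ≤ r)
    (hb : |Real.sigmoid b - 1 / 2| ≤ r) :
    (1 / 4 - r ^ 2) * |a - b| ≤ |Real.sigmoid a - Real.sigmoid b| := by
  obtain ⟨ξ, hξ, e⟩ := sigmoid_sub_eq a b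
  rw [e, abs_mul, abs_of_pos (sigmoidDeriv_pos ξ)]
  refine mul_le_mul_of_nonneg_right ?_ (abs_nonneg _)
  have : |Real.sigmoid ξ - 1 / 2| ≤ r := by
    rw [abs_le] at *
    rcases Set.mem_uIcc.1 hξ with h | h <;> constructor <;>
    linarith [Real.sigmoid_le h.1, Real.sigmoid_le h.2, ha.1, ha.2, hb.1, hb.2]
  rw [sigmoidDeriv_eq]
  have := sq_le_sq' (by linarith [abs_nonneg (Real.sigmoid ξ - 1 / 2)]) this
  rw [sq_abs] at this
  linarith

theorem exists_sigmoid_eq {y : ℝ} (h0 : 0 < y) (h1 : y < 1) : ∃ L, Real.sigmoid L = y := by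
  have : y ∈ Set.range Real.sigmoid := by rw [Real.range_sigmoid]; exact ⟨h0, h1⟩
  exact this

theorem abs_sigmoidDeriv₂_le (a : ℝ) : |sigmoidDeriv₂ a| ≤ 1 / 4 := by
  unfold sigmoidDeriv₂
  rw [abs_mul, abs_of_pos (sigmoidDeriv_pos a)]
  have : |1 - 2 * Real.sigmoid a| ≤ 1 :=
    abs_le.2 ⟨by linarith [Real.sigmoid_lt_one a], by linarith [Real.sigmoid_pos a]⟩
  nlinarith [sigmoidDeriv_le a, sigmoidDeriv_pos a, abs_nonneg (1 - 2 * Real.sigmoid a)]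

theorem abs_sigmoidDeriv₂_sub_le (a b : ℝ) :
    |sigmoidDeriv₂ a - sigmoidDeriv₂ b| ≤ |a - b| := by
  have e : sigmoidDeriv₂ a - sigmoidDeriv₂ b
      = (sigmoidDeriv a - sigmoidDeriv b) * (1 - 2 * Real.sigmoid a)
        - sigmoidDeriv b * (2 * (Real.sigmoid a - Real.sigmoid b)) := by
    unfold sigmoidDeriv₂; ring
  have h1 : |1 - 2 * Real.sigmoid a| ≤ 1 :=
    abs_le.2 ⟨by linarith [Real.sigmoid_lt_one a], by linarith [Real.sigmoid_pos a]⟩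
  have h2 := abs_sigmoidDeriv_sub_le a b
  have h3 := abs_sigmoid_sub_le a b
  rw [e]
  refine (abs_sub _ _).trans ?_
  rw [abs_mul, abs_mul, abs_mul, abs_of_pos (sigmoidDeriv_pos b), abs_two]
  nlinarith [sigmoidDeriv_le b, sigmoidDeriv_pos b, abs_nonneg (1 - 2 * Real.sigmoid a),
    abs_nonneg (sigmoidDeriv a - sigmoidDeriv b), abs_nonneg (Real.sigmoid a - Real.sigmoid b)]

/-! ### Averages over the data and weighted least squares steps on a well conditioned design. -/

section WellConditioned

variable {E : Type*} [NormedAddCommGroup E] [InnerProductSpace ℝ E] {n : ℕ}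

/-- The average of `n` real numbers. -/
noncomputable def avg (f : Fin n → ℝ) : ℝ := (1 / (n : ℝ)) * ∑ i, f i

/-- The average of the vectors `c i • x i`. -/
noncomputable def vavg (c : Fin n → ℝ) (x : Fin n → E) : E := (1 / (n : ℝ)) • ∑ i, c i • x i

theorem avg_mono {f g : Fin n → ℝ} (h : ∀ i, f i ≤ g i) : avg f ≤ avg g :=
  mul_le_mul_of_nonneg_left (Finset.sum_le_sum fun i _ => h i) (by positivity)

theorem avg_nonneg {f : Fin n → ℝ} (h : ∀ i, 0 ≤ f i) : 0 ≤ avg f :=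
  mul_nonneg (by positivity) (Finset.sum_nonneg fun i _ => h i)

theorem avg_add (f g : Fin n → ℝ) : avg (fun i => f i + g i) = avg f + avg g := by
  unfold avg; rw [Finset.sum_add_distrib, mul_add]

theorem avg_sub (f g : Fin n → ℝ) : avg (fun i => f i - g i) = avg f - avg g := by
  unfold avg; rw [Finset.sum_sub_distrib, mul_sub]

theorem avg_const_mul (a : ℝ) (f : Fin n → ℝ) : avg (fun i => a * f i) = a * avg f := by
  unfold avg; rw [← Finset.mul_sum]; ring

theorem avg_const_le {a : ℝ} (ha : 0 ≤ a) : avg (fun _ : Fin n => a) ≤ a := by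
  unfold avg
  rcases Nat.eq_zero_or_pos n with rfl | h
  · simpa using ha
  · have : (0 : ℝ) < n := by exact_mod_cast h
    simp [this.ne']

theorem abs_avg_le (f : Fin n → ℝ) : |avg f| ≤ avg fun i => |f i| := by
  unfold avg
  rw [abs_mul, abs_of_nonneg (by positivity : (0 : ℝ) ≤ 1 / n)]
  exact mul_le_mul_of_nonneg_left (Finset.abs_sum_le_sum_abs _ _) (by positivity)

theorem avg_mul_le (f g : Fin n → ℝ) :
    avg (fun i => f i * g i) ≤ √(avg fun i => f i ^ 2) * √(avg fun i => g i ^ 2) := by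
  rw [← Real.sqrt_mul (avg_nonneg fun i => sq_nonneg _)]
  refine Real.le_sqrt_of_sq_le ?_
  have := Finset.sum_mul_sq_le_sq_mul_sq Finset.univ f g
  unfold avg
  calc _ = (1 / (n : ℝ)) ^ 2 * (∑ i, f i * g i) ^ 2 := by ring
    _ ≤ (1 / (n : ℝ)) ^ 2 * ((∑ i, f i ^ 2) * ∑ i, g i ^ 2) := by gcongr
    _ = _ := by ring

theorem inner_vavg (c : Fin n → ℝ) (x : Fin n → E) (y : E) :
    inner ℝ (vavg c x) y = avg fun i => c i * inner ℝ (x i) y := by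
  unfold vavg avg
  rw [real_inner_smul_left, sum_inner]
  simp_rw [real_inner_smul_left]

theorem vavg_sub (c c' : Fin n → ℝ) (x : Fin n → E) :
    vavg (fun i => c i - c' i) x = vavg c x - vavg c' x := by
  unfold vavg; simp_rw [sub_smul]; rw [Finset.sum_sub_distrib, smul_sub]

theorem vavg_const_mul (a : ℝ) (c : Fin n → ℝ) (x : Fin n → E) :
    vavg (fun i => a * c i) x = a • vavg c x := by
  unfold vavg
  simp_rw [mul_smul]
  rw [← Finset.smul_sum, smul_comm]

/-- The design `x` is well conditioned: the empirical second moment is at most `5/4` in each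
direction, and at least `61/100` even when large values are discarded. -/
structure WellConditioned (x : Fin n → E) : Prop where
  upper : ∀ u, (avg fun i => inner ℝ (x i) u ^ 2) ≤ 5 / 4 * ‖u‖ ^ 2
  lower : ∀ u, 61 / 100 * ‖u‖ ^ 2 ≤
    avg fun i => if |inner ℝ (x i) u| ≤ 10 / 3 * ‖u‖ then inner ℝ (x i) u ^ 2 else 0

variable {x : Fin n → E}

/-- Duality: pair the vector average with itself, apply Cauchy-Schwarz over the data, and bound the
second moment in its own direction by `upper`. -/
theorem WellConditioned.norm_vavg_sq_le (hx : WellConditioned x) (c : Fin n → ℝ) :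
    ‖vavg c x‖ ^ 2 ≤ 5 / 4 * avg fun i => c i ^ 2 := by
  set y := vavg c x
  set A := avg fun i => c i ^ 2
  have hA : 0 ≤ A := avg_nonneg fun i => sq_nonneg _
  have h1 : ‖y‖ ^ 2 ≤ √A * √(5 / 4 * ‖y‖ ^ 2) := by
    calc ‖y‖ ^ 2 = avg fun i => c i * inner ℝ (x i) y := by
          rw [← real_inner_self_eq_norm_sq]; exact inner_vavg c x y
      _ ≤ √A * √(avg fun i => inner ℝ (x i) y ^ 2) := avg_mul_le _ _
      _ ≤ _ := by gcongr; exact hx.upper y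
  rw [← Real.sqrt_mul hA] at h1
  have h2 : (‖y‖ ^ 2) ^ 2 ≤ A * (5 / 4 * ‖y‖ ^ 2) := by
    calc _ ≤ (√(A * (5 / 4 * ‖y‖ ^ 2))) ^ 2 := by gcongr
      _ = _ := Real.sq_sqrt (by positivity)
  rcases eq_or_lt_of_le (sq_nonneg ‖y‖) with h | h
  · rw [← h]; positivity
  · nlinarith

theorem WellConditioned.norm_vavg_le (hx : WellConditioned x) {c : Fin n → ℝ} {B : ℝ}
    (hB : 0 ≤ B) (hc : (avg fun i => c i ^ 2) ≤ B ^ 2) : ‖vavg c x‖ ≤ 9 / 8 * B := by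
  refine abs_le_of_sq_le_sq' ?_ (by positivity) |>.2
  have := hx.norm_vavg_sq_le c
  nlinarith [sq_nonneg B]

theorem WellConditioned.norm_vavg_le_of_abs_le (hx : WellConditioned x) {c : Fin n → ℝ} {B : ℝ}
    (hB : 0 ≤ B) (hc : ∀ i, |c i| ≤ B) : ‖vavg c x‖ ≤ 9 / 8 * B := by
  refine hx.norm_vavg_le hB ((avg_mono fun i => ?_).trans (avg_const_le (sq_nonneg B)))
  exact sq_le_sq' (neg_le_of_abs_le (hc i)) (le_of_abs_le (hc i))

theorem WellConditioned.norm_vavg_le_of_abs_le_inner (hx : WellConditioned x) {c : Fin n → ℝ}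
    {B : ℝ} (hB : 0 ≤ B) (u : E) (hc : ∀ i, |c i| ≤ B * |inner ℝ (x i) u|) :
    ‖vavg c x‖ ≤ 5 / 4 * (B * ‖u‖) := by
  refine abs_le_of_sq_le_sq' ?_ (by positivity) |>.2
  have h := hx.norm_vavg_sq_le c
  have : (avg fun i => c i ^ 2) ≤ B ^ 2 * (5 / 4 * ‖u‖ ^ 2) := by
    calc _ ≤ avg fun i => B ^ 2 * inner ℝ (x i) u ^ 2 := by
          refine avg_mono fun i => ?_
          have := hc i
          have h0 : 0 ≤ B * |inner ℝ (x i) u| := by positivity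
          calc c i ^ 2 ≤ (B * |inner ℝ (x i) u|) ^ 2 :=
                sq_le_sq' (neg_le_of_abs_le this) (le_of_abs_le this)
            _ = _ := by rw [mul_pow, sq_abs]
      _ = B ^ 2 * avg fun i => inner ℝ (x i) u ^ 2 := avg_const_mul _ _
      _ ≤ _ := by gcongr; exact hx.upper u
  calc _ ≤ _ := h
    _ ≤ 5 / 4 * (B ^ 2 * (5 / 4 * ‖u‖ ^ 2)) := by gcongr
    _ = _ := by ring

/-- Expand the square. Since `w ≤ 1/16`, the quadratic term is at most `4ρ² · 5/64 · avg w r²`, and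
`ρ ≤ 2` turns it into `5/8 · ρ · avg w r²`. This smoothness bound is what the upper limit on the
step lengths is for. -/
theorem WellConditioned.norm_sq_weighted_step (hx : WellConditioned x) (u : E)
    {w r : Fin n → ℝ} {ρ : ℝ} (hw0 : ∀ i, 0 ≤ w i) (hw1 : ∀ i, w i ≤ 1 / 16) (h0 : 0 ≤ ρ)
    (h2 : ρ ≤ 2) :
    ‖u - (2 * ρ) • vavg (fun i => w i * r i) x‖ ^ 2 ≤ ‖u‖ ^ 2
      - ρ * avg fun i => w i * (4 * r i * inner ℝ (x i) u - 5 / 8 * r i ^ 2) := by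
  set y := vavg (fun i => w i * r i) x
  have hy : ‖y‖ ^ 2 ≤ 5 / 64 * avg fun i => w i * r i ^ 2 := by
    refine (hx.norm_vavg_sq_le _).trans ?_
    rw [show (5 / 64 : ℝ) = 5 / 4 * (1 / 16) by norm_num, mul_assoc, ← avg_const_mul (1 / 16)]
    gcongr
    refine avg_mono fun i => ?_
    have := mul_le_mul_of_nonneg_right (hw1 i) (mul_nonneg (hw0 i) (sq_nonneg (r i)))
    nlinarith
  have hin : inner ℝ u y = avg fun i => w i * r i * inner ℝ (x i) u := by
    rw [real_inner_comm, inner_vavg]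
  have hS : 0 ≤ avg fun i => w i * r i ^ 2 :=
    avg_nonneg fun i => mul_nonneg (hw0 i) (sq_nonneg _)
  have e : (avg fun i => w i * (4 * r i * inner ℝ (x i) u - 5 / 8 * r i ^ 2))
      = 4 * inner ℝ u y - 5 / 8 * avg fun i => w i * r i ^ 2 := by
    rw [hin, ← avg_const_mul, ← avg_const_mul, ← avg_sub]
    congr 1; funext i; ring
  rw [norm_sub_sq_real, real_inner_smul_right, norm_smul, mul_pow, Real.norm_eq_abs, sq_abs, e]
  nlinarith [mul_le_mul_of_nonneg_left hy (by positivity : 0 ≤ 4 * ρ ^ 2),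
    mul_nonneg h0 (mul_nonneg (sub_nonneg.2 h2) hS)]

/-- With `g = ⟨x, u⟩` and `r = g - δ` one has `2 (g² - δ²) = 4 r g - 2 r²`, which is at most `4 r g
- 5/8 r²`. No cross term between signal and bias remains. -/
theorem WellConditioned.norm_sq_biased_step (hx : WellConditioned x) (u : E)
    {w δ : Fin n → ℝ} {ρ : ℝ} (hw0 : ∀ i, 0 ≤ w i) (hw1 : ∀ i, w i ≤ 1 / 16) (h0 : 0 ≤ ρ)
    (h2 : ρ ≤ 2) :
    ‖u - (2 * ρ) • vavg (fun i => w i * (inner ℝ (x i) u - δ i)) x‖ ^ 2 ≤ ‖u‖ ^ 2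
      - 2 * ρ * ((avg fun i => w i * inner ℝ (x i) u ^ 2) - avg fun i => w i * δ i ^ 2) := by
  refine (hx.norm_sq_weighted_step u hw0 hw1 h0 h2).trans ?_
  rw [← avg_sub, mul_comm 2 ρ, mul_assoc, ← avg_const_mul 2]
  gcongr
  refine avg_mono fun i => ?_
  nlinarith [mul_nonneg (hw0 i) (sq_nonneg (inner ℝ (x i) u - δ i))]

/-- Without bias the decrease of the square is `27/8 · ρ h ≥ 3 ρ h`, so the norm itself contracts at
rate `3/2 · ρ h`. The bound `h ≤ 1/3` keeps that factor nonnegative for `ρ ≤ 2`. -/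
theorem WellConditioned.norm_unbiased_step (hx : WellConditioned x) (u : E)
    {w : Fin n → ℝ} {ρ h : ℝ} (hw0 : ∀ i, 0 ≤ w i) (hw1 : ∀ i, w i ≤ 1 / 16) (h0 : 0 ≤ ρ)
    (h2 : ρ ≤ 2) (hh1 : h ≤ 1 / 3)
    (hh : h * ‖u‖ ^ 2 ≤ avg fun i => w i * inner ℝ (x i) u ^ 2) :
    ‖u - (2 * ρ) • vavg (fun i => w i * inner ℝ (x i) u) x‖ ≤ (1 - 3 / 2 * ρ * h) * ‖u‖ := by
  have hk := hx.norm_sq_weighted_step u (r := fun i => inner ℝ (x i) u) hw0 hw1 h0 h2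
  have e : (avg fun i => w i * (4 * inner ℝ (x i) u * inner ℝ (x i) u
      - 5 / 8 * inner ℝ (x i) u ^ 2)) = 27 / 8 * avg fun i => w i * inner ℝ (x i) u ^ 2 := by
    rw [← avg_const_mul]; congr 1; funext i; ring
  rw [e] at hk
  refine abs_le_of_sq_le_sq' (hk.trans ?_) (mul_nonneg (by nlinarith) (norm_nonneg _)) |>.2
  have h3 : 0 ≤ avg fun i => w i * inner ℝ (x i) u ^ 2 :=
    avg_nonneg fun i => mul_nonneg (hw0 i) (sq_nonneg _)
  nlinarith [mul_le_mul_of_nonneg_left hh h0, mul_nonneg h0 h3, sq_nonneg (ρ * h * ‖u‖)]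

/-- A lower bound for the weighted second moment when the weights are bounded below at the points
with moderate values. -/
theorem WellConditioned.le_avg_weighted (hx : WellConditioned x) (u v : E) {w : Fin n → ℝ}
    {m B : ℝ} (hm : 0 ≤ m) (hB : 0 < B) (hw0 : ∀ i, 0 ≤ w i)
    (hw : ∀ i, |inner ℝ (x i) u| ≤ 10 / 3 * ‖u‖ → |inner ℝ (x i) v| ≤ B → m ≤ w i) :
    m * (61 / 100 - 125 / 9 * (‖v‖ / B) ^ 2) * ‖u‖ ^ 2
      ≤ avg fun i => w i * inner ℝ (x i) u ^ 2 := by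
  -- Markov's inequality: a point with `|⟨x, v⟩| > B` loses at most `(10/3 ‖u‖)²`, which is charged
  -- to `⟨x, v⟩² / B²`.
  have key : ∀ i, m * ((if |inner ℝ (x i) u| ≤ 10 / 3 * ‖u‖ then inner ℝ (x i) u ^ 2 else 0)
      - 100 / 9 * ‖u‖ ^ 2 / B ^ 2 * inner ℝ (x i) v ^ 2) ≤ w i * inner ℝ (x i) u ^ 2 := by
    intro i
    have hn : 0 ≤ 100 / 9 * ‖u‖ ^ 2 / B ^ 2 * inner ℝ (x i) v ^ 2 := by positivity
    have hp : 0 ≤ w i * inner ℝ (x i) u ^ 2 := mul_nonneg (hw0 i) (sq_nonneg _)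
    split_ifs with h1
    · by_cases h2 : |inner ℝ (x i) v| ≤ B
      · have := mul_le_mul_of_nonneg_right (hw i h1 h2) (sq_nonneg (inner ℝ (x i) u))
        nlinarith [mul_nonneg hm hn]
      · have h3 : inner ℝ (x i) u ^ 2 ≤ 100 / 9 * ‖u‖ ^ 2 / B ^ 2 * inner ℝ (x i) v ^ 2 := by
          have h4 : inner ℝ (x i) u ^ 2 ≤ (10 / 3 * ‖u‖) ^ 2 :=
            sq_le_sq' (neg_le_of_abs_le h1) (le_of_abs_le h1)
          have h5 : B ^ 2 ≤ inner ℝ (x i) v ^ 2 := by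
            rw [← sq_abs (inner ℝ (x i) v)]; gcongr; exact (not_le.1 h2).le
          rw [div_mul_eq_mul_div, le_div_iff₀ (by positivity)]
          calc _ ≤ (10 / 3 * ‖u‖) ^ 2 * inner ℝ (x i) v ^ 2 := by gcongr
            _ = _ := by ring
        nlinarith [mul_nonneg hm (sub_nonneg.2 h3)]
    · nlinarith [mul_nonneg hm hn]
  refine le_trans ?_ (avg_mono key)
  rw [avg_const_mul, avg_sub, avg_const_mul, mul_assoc]
  refine mul_le_mul_of_nonneg_left ?_ hm
  have h1 := hx.lower u
  have h2 := mul_le_mul_of_nonneg_left (hx.upper v)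
    (by positivity : 0 ≤ 100 / 9 * ‖u‖ ^ 2 / B ^ 2)
  have e : 100 / 9 * ‖u‖ ^ 2 / B ^ 2 * (5 / 4 * ‖v‖ ^ 2)
      = 125 / 9 * (‖v‖ / B) ^ 2 * ‖u‖ ^ 2 := by
    field_simp; ring
  linarith

end WellConditioned

/-! ### One step of the algorithm in scaled variables: invariance, contraction, growth. -/

section Steps

variable {E : Type*} [NormedAddCommGroup E] [InnerProductSpace ℝ E] {n : ℕ} {x : Fin n → E}

/-- The direction of a gradient step at temperature `τ` from `v` with graduated labels `y`. -/
noncomputable def stepDir (x : Fin n → E) (τ : ℝ) (y : Fin n → ℝ) (v : E) : E :=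
  vavg (fun i => 1 / τ * (gradSigmoid τ (inner ℝ (x i) v) - y i)
    * sigmoidDeriv (τ * inner ℝ (x i) v)) x

/-- A gradient step on labels whose pre-activations are off by `δ`. -/
theorem WellConditioned.norm_sq_step_le_of_shift (hx : WellConditioned x) (u v : E)
    {τ ρ B R h : ℝ} {y δ : Fin n → ℝ} (hτ : 0 < τ) (hτ1 : τ ≤ 1) (h0 : 0 ≤ ρ) (h2 : ρ ≤ 2)
    (hB : 0 < B) (hu : ‖u‖ ≤ R) (hy : ∀ i, y i = gradSigmoid τ (inner ℝ (x i) v + δ i))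
    (hδ : ∀ i, |inner ℝ (x i) v| ≤ B → |δ i| ≤ 10 / 3 * R)
    (hh : h ≤ sigmoidDeriv (B + 10 / 3 * R) ^ 2 * (61 / 100 - 125 / 9 * (‖v‖ / B) ^ 2)) :
    ‖u - (2 * ρ) • stepDir x τ y (v + u)‖ ^ 2 ≤
      ‖u‖ ^ 2 - 2 * ρ * (h * ‖u‖ ^ 2 - 1 / 16 * avg fun i => δ i ^ 2) := by
  choose s hs0 hs1 hs hsB using fun i => exists_slope_gradSigmoid hτ.le hτ1
    (inner ℝ (x i) (v + u)) (inner ℝ (x i) v + δ i)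
  set p : Fin n → ℝ := fun i => sigmoidDeriv (τ * inner ℝ (x i) (v + u)) with hp
  have hp0 : ∀ i, 0 ≤ p i := fun i => (sigmoidDeriv_pos _).le
  have hp1 : ∀ i, p i ≤ 1 / 4 := fun i => sigmoidDeriv_le _
  have hw0 : ∀ i, 0 ≤ s i * p i := fun i => mul_nonneg (hs0 i) (hp0 i)
  have hw1 : ∀ i, s i * p i ≤ 1 / 16 := fun i => by
    have := mul_le_mul (hs1 i) (hp1 i) (hp0 i) (by norm_num)
    linarith
  have e : stepDir x τ y (v + u) = vavg (fun i => s i * p i * (inner ℝ (x i) u - δ i)) x := by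
    unfold stepDir
    congr 1; funext i
    rw [hy, hs, inner_add_right]
    simp only [hp, inner_add_right]
    field_simp
    ring
  rw [e]
  refine (hx.norm_sq_biased_step u hw0 hw1 h0 h2).trans ?_
  have hl : h * ‖u‖ ^ 2 ≤ avg fun i => s i * p i * inner ℝ (x i) u ^ 2 := by
    refine le_trans ?_ (hx.le_avg_weighted u v (m := sigmoidDeriv (B + 10 / 3 * R) ^ 2)
      (sq_nonneg _) hB hw0 fun i hi1 hi2 => ?_)
    · gcongr
    · have ht : |inner ℝ (x i) u| ≤ 10 / 3 * R := hi1.trans (by gcongr)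
      have ha : |inner ℝ (x i) (v + u)| ≤ B + 10 / 3 * R := by
        rw [inner_add_right]
        exact (abs_add_le _ _).trans (add_le_add hi2 ht)
      have hL : |inner ℝ (x i) v + δ i| ≤ B + 10 / 3 * R :=
        (abs_add_le _ _).trans (add_le_add hi2 (hδ i hi2))
      have h3 := hsB i _ ha hL
      have h4 : sigmoidDeriv (B + 10 / 3 * R) ≤ p i := by
        refine sigmoidDeriv_anti ?_
        rw [abs_mul, abs_of_pos hτ]
        exact (mul_le_of_le_one_left (abs_nonneg _) hτ1).trans ha
      rw [sq]
      exact mul_le_mul h3 h4 (sigmoidDeriv_pos _).le (hs0 i)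
  have hr : (avg fun i => s i * p i * δ i ^ 2) ≤ 1 / 16 * avg fun i => δ i ^ 2 := by
    rw [← avg_const_mul]
    exact avg_mono fun i => mul_le_mul_of_nonneg_right (hw1 i) (sq_nonneg _)
  nlinarith [mul_le_mul_of_nonneg_left (sub_le_sub hl hr) h0]

/-- A ball is invariant when the bias of the labels is small. -/
theorem WellConditioned.norm_step_le_of_shift (hx : WellConditioned x) (u v : E)
    {τ ρ B R h : ℝ} {y δ : Fin n → ℝ} (hτ : 0 < τ) (hτ1 : τ ≤ 1) (h0 : 0 ≤ ρ) (h2 : ρ ≤ 2)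
    (hB : 0 < B) (hu : ‖u‖ ≤ R) (hy : ∀ i, y i = gradSigmoid τ (inner ℝ (x i) v + δ i))
    (hδ : ∀ i, |inner ℝ (x i) v| ≤ B → |δ i| ≤ 10 / 3 * R)
    (hh : h ≤ sigmoidDeriv (B + 10 / 3 * R) ^ 2 * (61 / 100 - 125 / 9 * (‖v‖ / B) ^ 2))
    (hh1 : h ≤ 1 / 4) (hD : (1 / 16 * avg fun i => δ i ^ 2) ≤ h * R ^ 2) :
    ‖u - (2 * ρ) • stepDir x τ y (v + u)‖ ≤ R := by
  have hR : 0 ≤ R := (norm_nonneg u).trans hu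
  refine abs_le_of_sq_le_sq' ((hx.norm_sq_step_le_of_shift u v hτ hτ1 h0 h2 hB hu hy hδ
    hh).trans ?_) hR |>.2
  have h3 : ‖u‖ ^ 2 ≤ R ^ 2 := by gcongr
  have h4 : 0 ≤ 1 - 2 * ρ * h := by nlinarith
  nlinarith [mul_le_mul_of_nonneg_left hD h0, mul_nonneg h4 (sub_nonneg.2 h3)]

/-- A gradient step at temperature `1` on labels with additive noise `e`. -/
theorem WellConditioned.norm_step_le_of_noise (hx : WellConditioned x) (u v : E)
    {ρ B R h θ D : ℝ} {e : Fin n → ℝ} (h0 : 0 ≤ ρ) (h2 : ρ ≤ 2) (hB : 0 < B) (hu : ‖u‖ ≤ R)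
    (hh : h ≤ sigmoidDeriv (B + 10 / 3 * R) ^ 2 * (61 / 100 - 125 / 9 * (‖v‖ / B) ^ 2))
    (hh1 : h ≤ 1 / 3)
    (hD : ‖vavg (fun i => e i * sigmoidDeriv (inner ℝ (x i) v)) x‖ ≤ D)
    (hθ : ‖vavg (fun i => e i * (sigmoidDeriv (inner ℝ (x i) (v + u))
      - sigmoidDeriv (inner ℝ (x i) v))) x‖ ≤ θ * ‖u‖) :
    ‖u - (2 * ρ) • stepDir x 1 (fun i => Real.sigmoid (inner ℝ (x i) v) + e i) (v + u)‖
      ≤ (1 - ρ * (3 / 2 * h - 2 * θ)) * ‖u‖ + 2 * ρ * D := by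
  have hR : 0 ≤ R := (norm_nonneg u).trans hu
  choose s hs0 hs1 hs hsB using fun i => exists_slope_gradSigmoid zero_le_one le_rfl
    (inner ℝ (x i) (v + u)) (inner ℝ (x i) v)
  set p : Fin n → ℝ := fun i => sigmoidDeriv (inner ℝ (x i) (v + u)) with hp
  have hp0 : ∀ i, 0 ≤ p i := fun i => (sigmoidDeriv_pos _).le
  have hp1 : ∀ i, p i ≤ 1 / 4 := fun i => sigmoidDeriv_le _
  have hw0 : ∀ i, 0 ≤ s i * p i := fun i => mul_nonneg (hs0 i) (hp0 i)
  have hw1 : ∀ i, s i * p i ≤ 1 / 16 := fun i => by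
    have := mul_le_mul (hs1 i) (hp1 i) (hp0 i) (by norm_num)
    linarith
  have hl : h * ‖u‖ ^ 2 ≤ avg fun i => s i * p i * inner ℝ (x i) u ^ 2 := by
    refine le_trans ?_ (hx.le_avg_weighted u v (m := sigmoidDeriv (B + 10 / 3 * R) ^ 2)
      (sq_nonneg _) hB hw0 fun i hi1 hi2 => ?_)
    · gcongr
    · have ht : |inner ℝ (x i) u| ≤ 10 / 3 * R := hi1.trans (by gcongr)
      have ha : |inner ℝ (x i) (v + u)| ≤ B + 10 / 3 * R := by
        rw [inner_add_right]
        exact (abs_add_le _ _).trans (add_le_add hi2 ht)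
      have h3 := hsB i _ ha (hi2.trans (by linarith))
      rw [sq]
      exact mul_le_mul h3 (sigmoidDeriv_anti ha) (sigmoidDeriv_pos _).le (hs0 i)
  set d₁ := vavg (fun i => s i * p i * inner ℝ (x i) u) x with hd₁
  set d₂ := vavg (fun i => e i * (p i - sigmoidDeriv (inner ℝ (x i) v))) x with hd₂
  set d₃ := vavg (fun i => e i * sigmoidDeriv (inner ℝ (x i) v)) x with hd₃
  -- `d₁` is the contracting signal, `d₃` the noise gradient at `v`, and `d₂` its change from `v` to
  -- `v + u`.
  have ed : stepDir x 1 (fun i => Real.sigmoid (inner ℝ (x i) v) + e i) (v + u)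
      = d₁ - d₂ - d₃ := by
    rw [hd₁, hd₂, hd₃, ← vavg_sub, ← vavg_sub]
    unfold stepDir
    congr 1; funext i
    have := hs i
    simp only [gradSigmoid, one_mul, inner_add_right] at this
    simp only [gradSigmoid, one_mul, hp, inner_add_right]
    linear_combination (this) * sigmoidDeriv (inner ℝ (x i) v + inner ℝ (x i) u)
  rw [ed]
  have h1 := hx.norm_unbiased_step u hw0 hw1 h0 h2 hh1 hl
  rw [show u - (2 * ρ) • (d₁ - d₂ - d₃)
    = (u - (2 * ρ) • d₁) + (2 * ρ) • d₂ + (2 * ρ) • d₃ by module]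
  refine (norm_add₃_le).trans ?_
  rw [norm_smul, norm_smul, Real.norm_eq_abs, abs_of_nonneg (by positivity)]
  nlinarith [mul_le_mul_of_nonneg_left hθ h0, mul_le_mul_of_nonneg_left hD h0]

/-- A gradient step moves little when the pre-activation `L` of the label is close to a
pre-activation `L₀` without covariate dependence. -/
theorem WellConditioned.norm_step_le_growth (hx : WellConditioned x) (u v : E)
    {τ ρ C D : ℝ} {L L₀ : Fin n → ℝ} (hτ : 0 < τ) (hτ1 : τ ≤ 1) (h0 : 0 ≤ ρ) (h2 : ρ ≤ 2)
    (hC : 0 ≤ C) (hL : ∀ i, |L i - L₀ i| ≤ C * |inner ℝ (x i) v|) (hL₀ : ∀ i, |L₀ i| ≤ 1)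
    (hD : ‖vavg (fun i => 1 / τ * (gradSigmoid τ (L₀ i) - 1 / 2)) x‖ ≤ D) :
    ‖u - (2 * ρ) • stepDir x τ (fun i => gradSigmoid τ (L i)) (v + u)‖
      ≤ 2 * ‖u‖ + (1 + C) * ‖v‖ + D := by
  set p : Fin n → ℝ := fun i => sigmoidDeriv (τ * inner ℝ (x i) (v + u)) with hp
  have hp0 : ∀ i, 0 ≤ p i := fun i => (sigmoidDeriv_pos _).le
  have hp1 : ∀ i, p i ≤ 1 / 4 := fun i => sigmoidDeriv_le _
  have half : gradSigmoid τ 0 = 1 / 2 := by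
    unfold gradSigmoid; rw [mul_zero, Real.sigmoid_zero]; norm_num
  have hlip : ∀ a b, |1 / τ * (gradSigmoid τ a - gradSigmoid τ b)| ≤ |a - b| / 4 := by
    intro a b
    rw [abs_mul, abs_of_pos (by positivity)]
    calc _ ≤ 1 / τ * (τ * |a - b| / 4) := by gcongr; exact abs_gradSigmoid_sub_le hτ.le a b
      _ = _ := by field_simp
  set d₁ := vavg (fun i => 1 / τ * (gradSigmoid τ (inner ℝ (x i) (v + u)) - gradSigmoid τ 0)
    * p i) x with hd₁
  set d₂ := vavg (fun i => 1 / τ * (gradSigmoid τ (L i) - gradSigmoid τ (L₀ i)) * p i) x with hd₂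
  set d₃ := vavg (fun i => 1 / τ * (gradSigmoid τ (L₀ i) - gradSigmoid τ 0) * (p i - 1 / 4)) x
    with hd₃
  set d₄ := vavg (fun i => 1 / 4 * (1 / τ * (gradSigmoid τ (L₀ i) - 1 / 2))) x with hd₄
  -- The factors `p i` depend on the iterate and hence on all the data. Freezing them at `σ'(0) =
  -- 1/4` leaves in `d₄` an average that involves only `L₀`, to which concentration will apply. The
  -- replacement error `d₃` is linear in `⟨x, v + u⟩` because `|L₀| ≤ 1`.
  have ed : stepDir x τ (fun i => gradSigmoid τ (L i)) (v + u) = d₁ - d₂ - d₃ - d₄ := by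
    rw [hd₁, hd₂, hd₃, hd₄, ← vavg_sub, ← vavg_sub, ← vavg_sub]
    unfold stepDir
    congr 1; funext i
    rw [half]
    simp only [hp]
    ring
  have b₁ : ‖d₁‖ ≤ 5 / 4 * (1 / 16 * ‖v + u‖) := by
    refine hx.norm_vavg_le_of_abs_le_inner (by norm_num) _ fun i => ?_
    rw [abs_mul, abs_of_nonneg (hp0 i)]
    have := hlip (inner ℝ (x i) (v + u)) 0
    rw [sub_zero] at this
    have := mul_le_mul this (hp1 i) (hp0 i) (by positivity)
    linarith
  have b₂ : ‖d₂‖ ≤ 5 / 4 * (C / 16 * ‖v‖) := by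
    refine hx.norm_vavg_le_of_abs_le_inner (by positivity) _ fun i => ?_
    rw [abs_mul, abs_of_nonneg (hp0 i)]
    have := mul_le_mul (hlip (L i) (L₀ i)) (hp1 i) (hp0 i) (by positivity)
    linarith [hL i]
  have b₃ : ‖d₃‖ ≤ 5 / 4 * (1 / 16 * ‖v + u‖) := by
    refine hx.norm_vavg_le_of_abs_le_inner (by norm_num) _ fun i => ?_
    rw [abs_mul]
    have h3 := hlip (L₀ i) 0
    rw [sub_zero] at h3
    have h4 := abs_sigmoidDeriv_sub_le (τ * inner ℝ (x i) (v + u)) 0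
    rw [sigmoidDeriv_zero, sub_zero, abs_mul, abs_of_pos hτ] at h4
    have h5 := mul_le_of_le_one_left (abs_nonneg (inner ℝ (x i) (v + u))) hτ1
    have := mul_le_mul (h3.trans (div_le_div_of_nonneg_right (hL₀ i) (by norm_num)))
      (h4.trans (div_le_div_of_nonneg_right h5 (by norm_num))) (abs_nonneg _) (by norm_num)
    linarith
  have b₄ : ‖d₄‖ ≤ D / 4 := by
    rw [hd₄, vavg_const_mul, norm_smul, Real.norm_eq_abs, abs_of_pos (by norm_num)]
    linarith
  have hv := norm_add_le v u
  rw [ed]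
  refine (norm_sub_le _ _).trans ?_
  rw [norm_smul, Real.norm_eq_abs, abs_of_nonneg (by positivity)]
  have b : ‖d₁ - d₂ - d₃ - d₄‖ ≤ ‖d₁‖ + ‖d₂‖ + ‖d₃‖ + ‖d₄‖ := by
    have h1 := norm_sub_le (d₁ - d₂ - d₃) d₄
    have h2 := norm_sub_le (d₁ - d₂) d₃
    have h3 := norm_sub_le d₁ d₂
    linarith
  have hn := norm_nonneg (d₁ - d₂ - d₃ - d₄)
  nlinarith [norm_nonneg u, norm_nonneg v, mul_nonneg hC (norm_nonneg v)]

/-- Only boundedness of the residuals enters, so labels outside `(0, 1)` and an arbitrary inverse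
there do no harm. -/
theorem WellConditioned.norm_step_le_bounded (hx : WellConditioned x) (u v : E)
    {τ ρ t : ℝ} {y : Fin n → ℝ} (ht : 0 < t) (hτ : t ≤ τ) (h0 : 0 ≤ ρ) (h2 : ρ ≤ 2)
    (hy : ∀ i, |gradSigmoid τ (inner ℝ (x i) (v + u)) - y i| ≤ 2) :
    ‖u - (2 * ρ) • stepDir x τ y (v + u)‖ ≤ ‖u‖ + 3 / t := by
  have hτ0 := ht.trans_le hτ
  have b : ‖stepDir x τ y (v + u)‖ ≤ 9 / 8 * (1 / (2 * t)) := by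
    refine hx.norm_vavg_le_of_abs_le (by positivity) fun i => ?_
    rw [abs_mul, abs_mul, abs_of_pos (by positivity), abs_of_pos (sigmoidDeriv_pos _)]
    calc _ ≤ 1 / t * 2 * (1 / 4) := by
          gcongr
          · exact (sigmoidDeriv_pos _).le
          · exact hy i
          · exact sigmoidDeriv_le _
      _ = _ := by field_simp; norm_num
  refine (norm_sub_le _ _).trans ?_
  rw [norm_smul, Real.norm_eq_abs, abs_of_nonneg (by positivity)]
  have : 2 * ρ * ‖stepDir x τ y (v + u)‖ ≤ 2 * 2 * (9 / 8 * (1 / (2 * t))) := by gcongr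
  have e : 2 * 2 * (9 / 8 * (1 / (2 * t))) = (9 / 4) / t := by field_simp; norm_num
  have : (9 / 4) / t ≤ 3 / t := by gcongr; norm_num
  linarith

end Steps

/-! ### Scalar recursions for the error and the temperature. -/

section Recursions

/-- A perturbed contraction stays in its ball and approaches the noise level geometrically. -/
theorem perturbed_contraction {X ρ : ℕ → ℝ} {κ r D R : ℝ} (hX : ∀ t, 0 ≤ X t) (hκ : 0 < κ)
    (hρ : ∀ t, κ ≤ ρ t) (hρ2 : ∀ t, ρ t ≤ 2) (hr : 0 < r) (hr1 : 2 * r ≤ 1) (hD : 0 ≤ D)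
    (hDR : 2 * D ≤ r * R) (h0 : X 0 ≤ R)
    (hstep : ∀ t, X t ≤ R → X (t + 1) ≤ (1 - ρ t * r) * X t + 2 * ρ t * D) (t : ℕ) :
    X t ≤ R ∧ X t ≤ (1 - κ * r) ^ t * X 0 + 2 * D / r := by
  have hB : 2 * D / r * r = 2 * D := div_mul_cancel₀ _ hr.ne'
  have hB0 : 0 ≤ 2 * D / r := by positivity
  have hκ2 : κ ≤ 2 := (hρ 0).trans (hρ2 0)
  induction t with
  | zero => exact ⟨h0, by simpa using hB0⟩
  | succ t ih =>
    obtain ⟨ih1, ih2⟩ := ih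
    have hs := hstep t ih1
    have hρ0 : 0 < ρ t := hκ.trans_le (hρ t)
    have hc : 0 ≤ 1 - ρ t * r := by nlinarith [hρ2 t]
    have hq : 0 ≤ 1 - κ * r := by nlinarith
    refine ⟨?_, ?_⟩
    · nlinarith [mul_le_mul_of_nonneg_left ih1 hc, mul_le_mul_of_nonneg_left hDR hρ0.le]
    · have hp : 0 ≤ (1 - κ * r) ^ t * X 0 := mul_nonneg (pow_nonneg hq t) (hX 0)
      rw [pow_succ]
      have h1 := mul_le_mul_of_nonneg_left ih2 hc
      have h2 := mul_le_mul_of_nonneg_right (hρ t) (mul_nonneg hr.le hp)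
      nlinarith

/-- The number of steps after which a geometric sequence is below `min 1 ε`. -/
theorem exists_steps_geometric {a : ℝ} (ha : 0 < a) (ha1 : a ≤ 1) (M : ℝ) (T₀ : ℕ) :
    ∃ A : ℝ, 0 < A ∧ ∀ ε : ℝ, 0 < ε → ∀ T : ℕ, A * max 1 (Real.log (1 / ε)) ≤ T →
      T₀ ≤ T ∧ M * (1 - a) ^ (T - T₀) ≤ 1 ∧ M * (1 - a) ^ (T - T₀) ≤ ε := by
  set P := Real.log (max M 1) + a * T₀ with hP
  have hM : 0 < max M 1 := lt_max_of_lt_right one_pos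
  have hP0 : 0 ≤ Real.log (max M 1) := Real.log_nonneg (le_max_right _ _)
  -- With this choice `a (T - T₀) ≥ log (max M 1) + m`, where `m = max 1 (log (1/ε))`; one
  -- exponential bound then gives both `1` and `ε`.
  refine ⟨(P + 1) / a, by positivity, fun ε hε T hT => ?_⟩
  set m := max 1 (Real.log (1 / ε)) with hm
  have hm1 : 1 ≤ m := le_max_left _ _
  have hT' : (P + 1) * m ≤ a * T := by
    rw [div_mul_eq_mul_div, div_le_iff₀ ha] at hT; linarith
  have hP' : 0 ≤ P := by positivity
  have hT0 : T₀ ≤ T := by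
    have : a * T₀ ≤ a * T := by nlinarith
    exact_mod_cast le_of_mul_le_mul_left this ha
  have h1 : M * (1 - a) ^ (T - T₀) ≤ Real.exp (-m) := by
    have h2 : (1 - a) ^ (T - T₀) ≤ Real.exp (-a) ^ (T - T₀) :=
      pow_le_pow_left₀ (by linarith) (Real.one_sub_le_exp_neg a) _
    calc _ ≤ max M 1 * (1 - a) ^ (T - T₀) := by
          have : 0 ≤ (1 - a) ^ (T - T₀) := pow_nonneg (by linarith) _
          gcongr; exact le_max_left _ _
      _ ≤ max M 1 * Real.exp (-a) ^ (T - T₀) := by gcongr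
      _ = Real.exp (Real.log (max M 1) + (T - T₀ : ℕ) * (-a)) := by
          rw [Real.exp_add, Real.exp_log hM, Real.exp_nat_mul]
      _ ≤ _ := by
          rw [Real.exp_le_exp, Nat.cast_sub hT0]
          nlinarith
  refine ⟨hT0, h1.trans (Real.exp_le_one_iff.2 (by linarith)), h1.trans ?_⟩
  have : Real.log (1 / ε) ≤ m := le_max_right _ _
  rw [one_div, Real.log_inv] at this
  calc Real.exp (-m) ≤ Real.exp (Real.log ε) := Real.exp_le_exp.2 (by linarith)
    _ = ε := Real.exp_log hε

variable {d : ℕ} {t₀ b κ τ₀ : ℝ} {β η : ℕ → ℝ}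

theorem Admissible.temperature_bounds (h : Admissible d t₀ b κ τ₀ β η) (ht : 0 < t₀)
    (hb : 1 < b) (t : ℕ) :
    min (t₀ * b ^ t) 1 ≤ temperature τ₀ β t ∧ temperature τ₀ β t ≤ 1 := by
  induction t with
  | zero => simpa [temperature] using ⟨Or.inl h.init_ge, h.init_le⟩
  | succ t ih =>
    refine ⟨?_, min_le_right _ _⟩
    have h0 : 0 < t₀ * b ^ t := by positivity
    have h1 : 0 < temperature τ₀ β t := (lt_min h0 one_pos).trans_le ih.1
    have h2 : b * temperature τ₀ β t ≤ β t * temperature τ₀ β t :=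
      mul_le_mul_of_nonneg_right (h.incr t) h1.le
    simp only [temperature]
    refine le_min ?_ (min_le_right _ _)
    rcases le_total (t₀ * b ^ t) 1 with h3 | h3
    · rw [min_eq_left h3] at ih
      refine (min_le_left _ _).trans (le_trans ?_ h2)
      rw [pow_succ]; nlinarith [ih.1]
    · rw [min_eq_right h3] at ih
      refine (min_le_right _ _).trans (le_trans ?_ h2)
      nlinarith [ih.1]

theorem Admissible.temperature_ge (h : Admissible d t₀ b κ τ₀ β η) (ht : 0 < t₀)
    (hb : 1 < b) (t : ℕ) : t₀ ≤ temperature τ₀ β t := by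
  refine le_trans (le_min ?_ (h.init_ge.trans h.init_le)) (h.temperature_bounds ht hb t).1
  exact le_mul_of_one_le_right ht.le (one_le_pow₀ hb.le)

/-- The temperature reaches `1` after a number of steps depending only on `t₀` and `b`. -/
theorem exists_temperature_eq_one (ht : 0 < t₀) (hb : 1 < b) :
    ∃ T₀ : ℕ, ∀ (d : ℕ) (κ τ₀ : ℝ) (β η : ℕ → ℝ), Admissible d t₀ b κ τ₀ β η →
      ∀ t, T₀ ≤ t → temperature τ₀ β t = 1 := by
  obtain ⟨T₀, hT⟩ := pow_unbounded_of_one_lt (1 / t₀) hb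
  refine ⟨T₀, fun d κ τ₀ β η h t hTt => ?_⟩
  obtain ⟨h1, h2⟩ := h.temperature_bounds ht hb t
  refine le_antisymm h2 (le_trans (le_min ?_ le_rfl) h1)
  rw [div_lt_iff₀ ht] at hT
  have : b ^ T₀ ≤ b ^ t := pow_le_pow_right₀ hb.le hTt
  nlinarith

/-- The step lengths in units of the inverse smoothness. -/
theorem Admissible.rate_bounds (h : Admissible d t₀ b κ τ₀ β η) (ht : 0 < t₀) (hb : 1 < b)
    (hd : 1 ≤ d) (t : ℕ) :
    κ ≤ η t * temperature τ₀ β t ^ 2 / d ∧ η t * temperature τ₀ β t ^ 2 / d ≤ 2 := by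
  have hτ := ht.trans_le (h.temperature_ge ht hb t)
  have hd' : (0 : ℝ) < d := by exact_mod_cast hd
  have h1 := h.step_ge t
  have h2 := h.step_le t
  rw [← mul_div_assoc, div_le_iff₀ (by positivity)] at h1
  rw [← mul_div_assoc, le_div_iff₀ (by positivity)] at h2
  exact ⟨by rwa [le_div_iff₀ hd'], by rwa [div_le_iff₀ hd']⟩

end Recursions

/-! ### The gradient of the objective and the iteration in scaled variables. -/

section Iterates

variable {d n : ℕ}

theorem hasGradientAt_gradObjective (inv : ℝ → ℝ) (z : Fin n → EuclideanSpace ℝ (Fin d))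
    (y : Fin n → ℝ) (τ : ℝ) (w : EuclideanSpace ℝ (Fin d)) :
    HasGradientAt (gradObjective inv z y τ)
      ((2 * τ) • vavg (fun i => (gradSigmoid τ (inner ℝ (z i) w) - gradLabel inv τ (y i))
        * sigmoidDeriv (τ * inner ℝ (z i) w)) z) w := by
  have h1 : ∀ i, HasFDerivAt (fun w => inner ℝ (z i) w) (innerSL ℝ (z i)) w :=
    fun i => (innerSL ℝ (z i)).hasFDerivAt
  have h2 : ∀ i, HasFDerivAt
      (fun w => (gradLabel inv τ (y i) - gradSigmoid τ (inner ℝ (z i) w)) ^ 2)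
      ((2 * (gradLabel inv τ (y i) - gradSigmoid τ (inner ℝ (z i) w))
        * -(sigmoidDeriv (τ * inner ℝ (z i) w) * τ)) • innerSL ℝ (z i)) w := by
    intro i
    have h3 : HasDerivAt (fun a => (gradLabel inv τ (y i) - gradSigmoid τ a) ^ 2)
        (2 * (gradLabel inv τ (y i) - gradSigmoid τ (inner ℝ (z i) w))
        * -(sigmoidDeriv (τ * inner ℝ (z i) w) * τ)) (inner ℝ (z i) w) := by
      have h4 : HasDerivAt (fun a : ℝ => τ * a) τ (inner ℝ (z i) w) := by
        simpa using (hasDerivAt_id (inner ℝ (z i) w)).const_mul τ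
      have h5 := (hasDerivAt_sigmoid_sigmoidDeriv (τ * inner ℝ (z i) w)).comp _ h4
      have h6 := (h5.const_sub (gradLabel inv τ (y i))).pow 2
      refine h6.congr_deriv ?_
      simp [gradSigmoid]
    exact h3.comp_hasFDerivAt w (h1 i)
  have h3 := (HasFDerivAt.fun_sum (u := Finset.univ) fun i _ => h2 i).const_mul (1 / (n : ℝ))
  rw [hasGradientAt_iff_hasFDerivAt]
  refine h3.congr_fderiv ?_
  ext v
  simp only [InnerProductSpace.toDual_apply_apply, smul_apply,
    sum_apply, innerSL_apply_apply, smul_eq_mul]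
  rw [real_inner_smul_left, inner_vavg, ← avg_const_mul]
  unfold avg
  congr 1
  refine Finset.sum_congr rfl fun i _ => ?_
  ring

/-- The error of an iterate in units of `√d`. -/
noncomputable def scaledError (inv : ℝ → ℝ) (wStar w₀ : EuclideanSpace ℝ (Fin d))
    (τ₀ : ℝ) (β η : ℕ → ℝ) (S : Sample d n) (t : ℕ) : EuclideanSpace ℝ (Fin d) :=
  (1 / √(d : ℝ)) • (agglio inv (covariate S) (postLabel wStar S) τ₀ β η w₀ t - wStar)

variable {inv : ℝ → ℝ} {wStar w₀ : EuclideanSpace ℝ (Fin d)} {τ₀ : ℝ} {β η : ℕ → ℝ}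
  {S : Sample d n}

theorem inner_covariate (S : Sample d n) (i : Fin n) (w : EuclideanSpace ℝ (Fin d)) :
    inner ℝ (covariate S i) w = inner ℝ (S i).1 ((1 / √(d : ℝ)) • w) := by
  unfold covariate
  rw [real_inner_smul_left, real_inner_smul_right]

theorem recoveryError_eq (hd : 1 ≤ d) (t : ℕ) :
    recoveryError inv wStar w₀ τ₀ β η S t
      = √(d : ℝ) * ‖scaledError inv wStar w₀ τ₀ β η S t‖ := by
  have hd' : (0 : ℝ) < d := by exact_mod_cast hd
  have : 0 < √(d : ℝ) := Real.sqrt_pos.2 hd'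
  unfold recoveryError scaledError
  rw [norm_smul, Real.norm_eq_abs, abs_of_pos (by positivity)]
  field_simp

theorem norm_scaledError_zero_le (hd : 1 ≤ d) (hw : ‖wStar‖ ≤ 1) (hw₀ : ‖w₀‖ ≤ 1) :
    ‖scaledError inv wStar w₀ τ₀ β η S 0‖ ≤ 2 * (1 / √(d : ℝ)) := by
  have hd' : (0 : ℝ) < d := by exact_mod_cast hd
  have : 0 < √(d : ℝ) := Real.sqrt_pos.2 hd'
  unfold scaledError agglio
  rw [norm_smul, Real.norm_eq_abs, abs_of_pos (by positivity), mul_comm]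
  gcongr
  exact (norm_sub_le _ _).trans (by linarith)

/-- One factor `1/√d` comes from the covariate and one from the scaling of the error, while `2τ =
2τ² · (1/τ)`. Hence the dimensionless rate `η τ²/d`. -/
theorem scaledError_succ (hd : 1 ≤ d) {t : ℕ} (hτ : 0 < temperature τ₀ β t) :
    scaledError inv wStar w₀ τ₀ β η S (t + 1) = scaledError inv wStar w₀ τ₀ β η S t
      - (2 * (η t * temperature τ₀ β t ^ 2 / d)) • stepDir (fun i => (S i).1)
        (temperature τ₀ β t)
        (fun i => gradLabel inv (temperature τ₀ β t) (postLabel wStar S i))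
        ((1 / √(d : ℝ)) • wStar + scaledError inv wStar w₀ τ₀ β η S t) := by
  have hd' : (0 : ℝ) < d := by exact_mod_cast hd
  have hs : 0 < √(d : ℝ) := Real.sqrt_pos.2 hd'
  have hss : √(d : ℝ) * √(d : ℝ) = d := Real.mul_self_sqrt hd'.le
  set τ := temperature τ₀ β t with hτe
  set w := agglio inv (covariate S) (postLabel wStar S) τ₀ β η w₀ t with hw
  have e1 : (1 / √(d : ℝ)) • wStar + scaledError inv wStar w₀ τ₀ β η S t
      = (1 / √(d : ℝ)) • w := by
    unfold scaledError; rw [← smul_add, ← hw]; congr 1; abel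
  have e2 : agglio inv (covariate S) (postLabel wStar S) τ₀ β η w₀ (t + 1)
      = w - η t • ((2 * τ) • vavg (fun i => (gradSigmoid τ (inner ℝ (covariate S i) w)
        - gradLabel inv τ (postLabel wStar S i))
        * sigmoidDeriv (τ * inner ℝ (covariate S i) w)) (covariate S)) := by
    rw [agglio, ← hw, ← hτe, (hasGradientAt_gradObjective _ _ _ _ _).gradient]
  have e3 : ∀ c : Fin n → ℝ, vavg c (covariate S)
      = (1 / √(d : ℝ)) • vavg c (fun i => (S i).1) := by
    intro c
    unfold vavg covariate
    rw [smul_comm (1 / √(d : ℝ)), Finset.smul_sum (r := 1 / √(d : ℝ))]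
    congr 1
    exact Finset.sum_congr rfl fun i _ => smul_comm _ _ _
  rw [e1]
  conv_lhs => unfold scaledError
  conv_rhs => rw [scaledError, ← hw]
  rw [e2, e3]
  simp_rw [inner_covariate]
  have e4 : stepDir (fun i => (S i).1) τ (fun i => gradLabel inv τ (postLabel wStar S i))
      ((1 / √(d : ℝ)) • w) = (1 / τ) • vavg (fun i =>
        (gradSigmoid τ (inner ℝ (S i).1 ((1 / √(d : ℝ)) • w))
        - gradLabel inv τ (postLabel wStar S i))
        * sigmoidDeriv (τ * inner ℝ (S i).1 ((1 / √(d : ℝ)) • w))) (fun i => (S i).1) := by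
    unfold stepDir
    rw [← vavg_const_mul]
    congr 1; funext i; ring
  rw [e4]
  set V := vavg (fun i =>
        (gradSigmoid τ (inner ℝ (S i).1 ((1 / √(d : ℝ)) • w))
        - gradLabel inv τ (postLabel wStar S i))
        * sigmoidDeriv (τ * inner ℝ (S i).1 ((1 / √(d : ℝ)) • w))) (fun i => (S i).1)
  rw [sub_right_comm, smul_sub, smul_smul, smul_smul, smul_smul, smul_smul]
  congr 2
  field_simp
  rw [sq, hss, mul_comm]

end Iterates

/-! ### Nets of the unit ball. -/

section Nets

/-- The unit ball of a `d`-dimensional space has a `2⁻ᵏ`-net with `5 ^ (d k)` points. -/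
theorem exists_net (d k : ℕ) : ∃ N : Finset (EuclideanSpace ℝ (Fin d)),
    N.card ≤ 5 ^ (d * k) ∧ ∀ u, ‖u‖ ≤ 1 → ∃ c ∈ N, ‖u - c‖ ≤ (1 / 2) ^ k := by
  classical
  -- A maximal `1`-separated set in the ball of radius `2` has at most `5^d` points and is a
  -- `1`-net. Iterating over dyadic scales gives the finer nets.
  have base : ∃ N : Finset (EuclideanSpace ℝ (Fin d)), N.card ≤ 5 ^ d ∧
      ∀ u, ‖u‖ ≤ 2 → ∃ c ∈ N, ‖u - c‖ ≤ 1 := by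
    set P : ℕ → Prop := fun m => ∃ N : Finset (EuclideanSpace ℝ (Fin d)), N.card = m ∧
      (∀ c ∈ N, ‖c‖ ≤ 2) ∧ ∀ c ∈ N, ∀ c' ∈ N, c ≠ c' → 1 ≤ ‖c - c'‖ with hP
    have hP5 : ∀ m, P m → m ≤ 5 ^ d := by
      rintro m ⟨N, rfl, h1, h2⟩
      simpa using Besicovitch.card_le_of_separated N h1 h2
    have hP0 : P 0 := ⟨∅, by simp, by simp, by simp⟩
    obtain ⟨N, hN, h1, h2⟩ : P (Nat.findGreatest P (5 ^ d)) :=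
      Nat.findGreatest_spec (Nat.zero_le _) hP0
    refine ⟨N, hN.le.trans (Nat.findGreatest_le _), fun u hu => ?_⟩
    by_contra! hc
    have huN : u ∉ N := fun h => by simpa using (hc u h).trans_le' zero_le_one
    have hQ : P (Nat.findGreatest P (5 ^ d) + 1) := by
      refine ⟨insert u N, by rw [Finset.card_insert_of_notMem huN, hN], ?_, ?_⟩
      · intro c hc'
        rcases Finset.mem_insert.1 hc' with rfl | h
        exacts [hu, h1 c h]
      · intro c hc' c' hc'' hne
        rcases Finset.mem_insert.1 hc' with rfl | h <;>
        rcases Finset.mem_insert.1 hc'' with rfl | h'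
        · exact absurd rfl hne
        · exact (hc _ h').le
        · rw [norm_sub_rev]; exact (hc _ h).le
        · exact h2 c h c' h' hne
    have := Nat.le_findGreatest (hP5 _ hQ) hQ
    omega
  obtain ⟨N₁, hN₁, hN₁'⟩ := base
  induction k with
  | zero => exact ⟨{0}, by simp, fun u hu => ⟨0, by simp, by simpa using hu⟩⟩
  | succ k ih =>
    obtain ⟨N, hN, hN'⟩ := ih
    refine ⟨(N ×ˢ N₁).image fun p => p.1 + ((1 / 2 : ℝ) ^ (k + 1)) • p.2, ?_, fun u hu => ?_⟩
    · refine Finset.card_image_le.trans ?_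
      rw [Finset.card_product, mul_add, mul_one, pow_add]
      exact Nat.mul_le_mul hN hN₁
    · obtain ⟨c, hc, h1⟩ := hN' u hu
      obtain ⟨c', hc', h2⟩ := hN₁' ((2 : ℝ) ^ (k + 1) • (u - c)) (by
        rw [norm_smul, Real.norm_eq_abs, abs_of_pos (by positivity)]
        calc _ ≤ (2 : ℝ) ^ (k + 1) * (1 / 2) ^ k := by gcongr
          _ = 2 := by rw [pow_succ, mul_right_comm, ← mul_pow]; norm_num)
      refine ⟨_, Finset.mem_image.2 ⟨(c, c'), Finset.mem_product.2 ⟨hc, hc'⟩, rfl⟩, ?_⟩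
      have e : u - (c + ((1 / 2 : ℝ) ^ (k + 1)) • c')
          = ((1 / 2 : ℝ) ^ (k + 1)) • ((2 : ℝ) ^ (k + 1) • (u - c) - c') := by
        rw [smul_sub, smul_smul, ← mul_pow]; norm_num [sub_sub]
      simp only
      rw [e, norm_smul, Real.norm_eq_abs, abs_of_pos (by positivity)]
      exact mul_le_of_le_one_right (by positivity) h2

end Nets

/-! ### The exponential Markov inequality for i.i.d. sums. -/

section Chernoff

/-- Markov's inequality for the product of the exponentials, whose integral factors. Thresholds and
Chernoff parameters are absorbed into `f`. -/
theorem pi_real_sum_nonneg_le {Ω : Type*} [MeasurableSpace Ω] (μ : Measure Ω)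
    [IsProbabilityMeasure μ] (n : ℕ) {f : Ω → ℝ} {r : ℝ}
    (hf : Integrable (fun ω => Real.exp (f ω)) μ) (h : ∫ ω, Real.exp (f ω) ∂μ ≤ Real.exp r) :
    (Measure.pi fun _ : Fin n => μ).real {S | 0 ≤ ∑ i, f (S i)} ≤ Real.exp (n * r) := by
  have h1 : Integrable (fun S : Fin n → Ω => ∏ i, Real.exp (f (S i)))
      (Measure.pi fun _ => μ) := Integrable.fintype_prod fun _ => hf
  have h2 := mul_meas_ge_le_integral_of_nonneg
    (ae_of_all _ fun S => Finset.prod_nonneg fun i _ => (Real.exp_pos _).le) h1 1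
  rw [integral_fintype_prod_eq_prod (f := fun _ ω => Real.exp (f ω)), one_mul] at h2
  have e : {S : Fin n → Ω | 0 ≤ ∑ i, f (S i)} = {S | 1 ≤ ∏ i, Real.exp (f (S i))} := by
    ext S; simp only [Set.mem_ofPred_eq, ← Real.exp_sum, Real.one_le_exp_iff]
  rw [e]
  refine h2.trans ?_
  rw [Finset.prod_const, Finset.card_univ, Fintype.card_fin, Real.exp_nat_mul]
  exact pow_le_pow_left₀ (integral_nonneg fun _ => (Real.exp_pos _).le) h _

end Chernoff

/-! ### Marginals and moments of Gaussian vectors. -/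

section Gaussian

variable {d : ℕ}

theorem map_inner_stdGaussian (u : EuclideanSpace ℝ (Fin d)) :
    (stdGaussian (EuclideanSpace ℝ (Fin d))).map (fun x => inner ℝ x u)
      = gaussianReal 0 (‖u‖ ^ 2).toNNReal := by
  have h := IsGaussian.map_eq_gaussianReal (μ := stdGaussian (EuclideanSpace ℝ (Fin d)))
    (innerSL ℝ u)
  have e := integral_strongDual_stdGaussian (innerSL ℝ u)
  rw [e, variance_dual_stdGaussian, innerSL_apply_norm] at h
  rw [← h]
  congr 1; funext x; simp [real_inner_comm]

theorem integral_inner_stdGaussian (u : EuclideanSpace ℝ (Fin d)) :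
    ∫ x, inner ℝ x u ∂stdGaussian (EuclideanSpace ℝ (Fin d)) = 0 := by
  have e := integral_strongDual_stdGaussian (innerSL ℝ u)
  simpa [real_inner_comm] using e

theorem measurable_inner_right (u : EuclideanSpace ℝ (Fin d)) :
    Measurable fun x : EuclideanSpace ℝ (Fin d) => inner ℝ x u :=
  (Continuous.inner continuous_id continuous_const).measurable

theorem exp_mul_sq_gaussian {s : ℝ} (hs : s < 1 / 2) :
    Integrable (fun t => Real.exp (s * t ^ 2)) (gaussianReal 0 1) ∧
      ∫ t, Real.exp (s * t ^ 2) ∂gaussianReal 0 1 = √(1 / (1 - 2 * s)) := by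
  have hb : 0 < 1 / 2 - s := by linarith
  have e : ∀ t, gaussianPDFReal 0 1 t * Real.exp (s * t ^ 2)
      = (√(2 * Real.pi))⁻¹ * Real.exp (-(1 / 2 - s) * t ^ 2) := by
    intro t
    rw [gaussianPDFReal_def]
    simp only [NNReal.coe_one, mul_one, sub_zero]
    rw [mul_assoc, ← Real.exp_add]
    congr 2; ring
  constructor
  · rw [gaussianReal_of_var_ne_zero _ one_ne_zero]
    rw [integrable_withDensity_iff (measurable_gaussianPDF 0 1)
      (ae_of_all _ fun _ => gaussianPDF_lt_top)]
    simp_rw [toReal_gaussianPDF, mul_comm (Real.exp _), e]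
    exact (integrable_exp_neg_mul_sq hb).const_mul _
  · rw [integral_gaussianReal_eq_integral_smul one_ne_zero]
    simp_rw [smul_eq_mul, e]
    rw [integral_const_mul, integral_gaussian, ← Real.sqrt_inv, ← Real.sqrt_mul (by positivity)]
    congr 1
    have := Real.pi_pos
    field_simp

theorem sq_gaussian : Integrable (fun t : ℝ => t ^ 2) (gaussianReal 0 1) ∧
    ∫ t, t ^ 2 ∂gaussianReal 0 1 = 1 := by
  have hm : MemLp id 2 (gaussianReal 0 1) := memLp_id_gaussianReal 2
  refine ⟨hm.integrable_sq, ?_⟩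
  have h := variance_id_gaussianReal (μ := 0) (v := 1)
  rw [variance_of_integral_eq_zero aemeasurable_id (by simp)] at h
  simpa using h

/-- Read off from `E e^{s t²} = (1 - 2s)^{-1/2}` at `s = 1/200` by means of `e^x ≥ 1 + x + x²/2`;
the slack over the exact value `3` is affordable. -/
theorem pow_four_gaussian : Integrable (fun t : ℝ => t ^ 4) (gaussianReal 0 1) ∧
    ∫ t, t ^ 4 ∂gaussianReal 0 1 ≤ 304 / 100 := by
  have hi : Integrable (fun t : ℝ => t ^ 4) (gaussianReal 0 1) := by
    have hm : MemLp id 4 (gaussianReal 0 1) := memLp_id_gaussianReal 4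
    have := hm.integrable_norm_pow (by norm_num)
    refine this.congr (ae_of_all _ fun t => ?_)
    simp only [id, Real.norm_eq_abs]
    exact (show Even 4 by decide).pow_abs t
  refine ⟨hi, ?_⟩
  obtain ⟨h1, h2⟩ := exp_mul_sq_gaussian (s := 1 / 200) (by norm_num)
  obtain ⟨h3, h4⟩ := sq_gaussian
  have h7 : Integrable (fun t : ℝ => 1 + 1 / 200 * t ^ 2) (gaussianReal 0 1) :=
    (integrable_const _).add (h3.const_mul _)
  have h5 : ∫ t, (1 + 1 / 200 * t ^ 2 + 1 / 80000 * t ^ 4) ∂gaussianReal 0 1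
      ≤ √(1 / (1 - 2 * (1 / 200))) := by
    rw [← h2]
    refine integral_mono (h7.add (hi.const_mul _)) h1
      fun t => ?_
    have := Real.quadratic_le_exp_of_nonneg (by positivity : 0 ≤ 1 / 200 * t ^ 2)
    simp only
    nlinarith
  rw [integral_add h7 (hi.const_mul _),
    integral_add (integrable_const _) (h3.const_mul _), integral_const_mul, integral_const_mul,
    h4] at h5
  have h6 : √(1 / (1 - 2 * (1 / 200) : ℝ)) ≤ 1.005038 := by
    rw [Real.sqrt_le_left (by norm_num)]; norm_num
  simp at h5
  norm_num at h5 h6 ⊢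
  linarith

end Gaussian

/-! ### Root mean squares of the design and transfer from nets. -/

section RootMeanSquare

variable {n : ℕ}

/-- The root mean square of `n` numbers. -/
noncomputable def rms (f : Fin n → ℝ) : ℝ := √(avg fun i => f i ^ 2)

theorem rms_sq (f : Fin n → ℝ) : rms f ^ 2 = avg fun i => f i ^ 2 :=
  Real.sq_sqrt (avg_nonneg fun _ => sq_nonneg _)

theorem rms_nonneg (f : Fin n → ℝ) : 0 ≤ rms f := Real.sqrt_nonneg _

theorem rms_eq_norm (f : Fin n → ℝ) : rms f = √(1 / (n : ℝ)) * ‖WithLp.toLp 2 f‖ := by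
  rw [EuclideanSpace.norm_eq, ← Real.sqrt_mul (by positivity)]
  simp [rms, avg]

theorem rms_add_le (f g : Fin n → ℝ) : rms (fun i => f i + g i) ≤ rms f + rms g := by
  simp only [rms_eq_norm]
  rw [← mul_add]
  gcongr
  exact norm_add_le (WithLp.toLp 2 f) (WithLp.toLp 2 g)

theorem rms_const_mul {a : ℝ} (ha : 0 ≤ a) (f : Fin n → ℝ) :
    rms (fun i => a * f i) = a * rms f := by
  unfold rms
  simp_rw [mul_pow]
  rw [avg_const_mul, Real.sqrt_mul (sq_nonneg a), Real.sqrt_sq ha]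

theorem rms_mono {f g : Fin n → ℝ} (h : ∀ i, |f i| ≤ |g i|) : rms f ≤ rms g :=
  Real.sqrt_le_sqrt (avg_mono fun i => sq_le_sq.2 (h i))

variable {E : Type*} [NormedAddCommGroup E] [InnerProductSpace ℝ E]

theorem rms_inner_smul (x : Fin n → E) {a : ℝ} (ha : 0 ≤ a) (u : E) :
    rms (fun i => inner ℝ (x i) (a • u)) = a * rms fun i => inner ℝ (x i) u := by
  rw [← rms_const_mul ha]; simp_rw [real_inner_smul_right]

/-- A bound for the root mean square of a design on the unit ball, from a bound on a net. -/
theorem rms_inner_le_of_net [FiniteDimensional ℝ E] (x : Fin n → E) {b ε : ℝ} (hε : 0 ≤ ε)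
    (hε1 : ε < 1) (hnet : ∀ u : E, ‖u‖ ≤ 1 → ∃ c, ‖u - c‖ ≤ ε ∧
      rms (fun i => inner ℝ (x i) c) ≤ b) (u : E) :
    rms (fun i => inner ℝ (x i) u) ≤ b / (1 - ε) * ‖u‖ := by
  set Φ : E →L[ℝ] EuclideanSpace ℝ (Fin n) := LinearMap.toContinuousLinearMap
    (√(1 / (n : ℝ)) • (((WithLp.linearEquiv 2 ℝ (Fin n → ℝ)).symm : _ →ₗ[ℝ] _) ∘ₗ
      LinearMap.pi fun i => (innerₗ E (x i)))) with hΦ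
  have hr : ∀ v, rms (fun i => inner ℝ (x i) v) = ‖Φ v‖ := by
    intro v
    rw [rms_eq_norm, hΦ, LinearMap.coe_toContinuousLinearMap', LinearMap.smul_apply, norm_smul,
      Real.norm_eq_abs, abs_of_nonneg (Real.sqrt_nonneg _)]
    rfl
  have h1 : ∀ v, ‖v‖ = 1 → ‖Φ v‖ ≤ b + ε * ‖Φ‖ := by
    intro v hv
    obtain ⟨c, hc, hcb⟩ := hnet v hv.le
    rw [hr] at hcb
    have h2 : ‖Φ v‖ ≤ ‖Φ c‖ + ‖Φ (v - c)‖ := by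
      rw [map_sub]; exact norm_le_norm_add_norm_sub' _ _
    have h3 : ‖Φ (v - c)‖ ≤ ‖Φ‖ * ε := (Φ.le_opNorm _).trans (by gcongr)
    linarith
  have hb : 0 ≤ b := by
    obtain ⟨c, -, hcb⟩ := hnet 0 (by simp)
    exact (rms_nonneg _).trans hcb
  -- The discretization error is charged to the operator norm itself and then absorbed, since `ε <
  -- 1`.
  have h4 : ‖Φ‖ ≤ b + ε * ‖Φ‖ :=
    ContinuousLinearMap.opNorm_le_of_unit_norm (by positivity) h1
  rw [hr]
  refine (Φ.le_opNorm u).trans ?_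
  gcongr
  rw [le_div_iff₀ (by linarith)]
  linarith

end RootMeanSquare

/-! ### A Lipschitz substitute for the truncation in the lower second moment. -/

section Tent

/-- The function `|t|` cut off linearly to `0` between `3` and `10/3`. -/
noncomputable def tent (t : ℝ) : ℝ := max 0 (min |t| (30 - 9 * |t|))

theorem tent_nonneg (t : ℝ) : 0 ≤ tent t := le_max_left _ _

theorem tent_le_abs (t : ℝ) : tent t ≤ |t| := max_le (abs_nonneg _) (min_le_left _ _)

theorem tent_le_three (t : ℝ) : tent t ≤ 3 := by
  refine max_le (by norm_num) ?_
  rcases le_total |t| 3 with h | h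
  · exact (min_le_left _ _).trans h
  · exact (min_le_right _ _).trans (by linarith)

theorem tent_eq_zero {t : ℝ} (h : 10 / 3 < |t|) : tent t = 0 :=
  max_eq_left ((min_le_right _ _).trans (by linarith))

/-- Bounds the truncated Gaussian second moment from below by `1 - 3.04/9 > 0.64`. -/
theorem sub_pow_four_le_tent_sq (t : ℝ) : t ^ 2 - t ^ 4 / 9 ≤ tent t ^ 2 := by
  rcases le_total |t| 3 with h | h
  · have : tent t = |t| := by
      unfold tent; rw [min_eq_left (by linarith), max_eq_right (abs_nonneg _)]
    rw [this, sq_abs]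
    linarith [show (0 : ℝ) ≤ t ^ 4 by positivity]
  · have : 3 ^ 2 ≤ t ^ 2 := by rw [← sq_abs t]; gcongr
    nlinarith [sq_nonneg (tent t)]

theorem abs_tent_sub_le (s t : ℝ) : |tent s - tent t| ≤ |9 * (s - t)| := by
  have h := abs_abs_sub_abs_le_abs_sub s t
  unfold tent
  rw [abs_mul, abs_of_pos (by norm_num : (0 : ℝ) < 9)]
  refine (abs_max_sub_max_le_max _ _ _ _).trans (max_le (by simp) ?_)
  refine (abs_min_sub_min_le_max _ _ _ _).trans (max_le ?_ ?_)
  · linarith [abs_nonneg (s - t)]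
  · rw [show 30 - 9 * |s| - (30 - 9 * |t|) = -(9 * (|s| - |t|)) by ring, abs_neg, abs_mul,
      abs_of_pos (by norm_num : (0 : ℝ) < 9)]
    linarith

theorem continuous_tent : Continuous tent := by unfold tent; fun_prop

end Tent

/-! ### From a net to all directions. -/

section Design

variable {d n : ℕ}

/-- A design is well conditioned if it behaves well in the directions of a net. -/
theorem wellConditioned_of_net (x : Fin n → EuclideanSpace ℝ (Fin d))
    (N : Finset (EuclideanSpace ℝ (Fin d)))
    (hN : ∀ u, ‖u‖ ≤ 1 → ∃ c ∈ N, ‖u - c‖ ≤ (1 / 2) ^ 11)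
    (h1 : ∀ c ∈ N, c ≠ 0 → (avg fun i => inner ℝ (x i) (‖c‖⁻¹ • c) ^ 2) ≤ 6 / 5)
    (h2 : ∀ c ∈ N, c ≠ 0 → 64 / 100 ≤ avg fun i => tent (inner ℝ (x i) (‖c‖⁻¹ • c)) ^ 2) :
    WellConditioned x := by
  have key : ∀ u, rms (fun i => inner ℝ (x i) u) ≤ 11 / 10 * ‖u‖ := by
    intro u
    refine (rms_inner_le_of_net x (b := 1098 / 1000) (ε := (1 / 2) ^ 11) (by positivity)
      (by norm_num) (fun v hv => ?_) u).trans
      (mul_le_mul_of_nonneg_right (by norm_num) (norm_nonneg _))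
    obtain ⟨c, hc, hvc⟩ := hN v hv
    refine ⟨c, hvc, ?_⟩
    rcases eq_or_ne c 0 with rfl | hc0
    · simp [rms, avg]; norm_num
    have hc' : ‖c‖ ≤ 1 + (1 / 2) ^ 11 := by
      have := norm_le_norm_add_norm_sub v c
      linarith
    have e : c = ‖c‖ • (‖c‖⁻¹ • c) := by
      rw [smul_smul, mul_inv_cancel₀ (norm_ne_zero_iff.2 hc0), one_smul]
    have h3 : rms (fun i => inner ℝ (x i) (‖c‖⁻¹ • c)) ≤ 1097 / 1000 := by
      refine abs_le_of_sq_le_sq' ?_ (by norm_num) |>.2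
      rw [rms_sq]
      exact (h1 c hc hc0).trans (by norm_num)
    rw [e, rms_inner_smul x (norm_nonneg c)]
    calc _ ≤ (1 + (1 / 2) ^ 11) * (1097 / 1000 : ℝ) := by
          gcongr; exact rms_nonneg _
      _ ≤ _ := by norm_num
  refine ⟨fun u => ?_, fun u => ?_⟩
  · rw [← rms_sq]
    calc _ ≤ (11 / 10 * ‖u‖) ^ 2 := by gcongr; exacts [rms_nonneg _, key u]
      _ ≤ _ := by nlinarith [sq_nonneg ‖u‖]
  · rcases eq_or_ne u 0 with rfl | hu
    · simp [avg]
    have hu0 : 0 < ‖u‖ := norm_pos_iff.2 hu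
    set v := ‖u‖⁻¹ • u with hv
    have hv1 : ‖v‖ = 1 := by rw [hv, norm_smul, norm_inv, norm_norm, inv_mul_cancel₀ hu0.ne']
    have euv : u = ‖u‖ • v := by rw [hv, smul_smul, mul_inv_cancel₀ hu0.ne', one_smul]
    obtain ⟨c, hc, hvc⟩ := hN v hv1.le
    have hc0 : c ≠ 0 := by
      rintro rfl
      rw [sub_zero, hv1] at hvc
      norm_num at hvc
    set c' := ‖c‖⁻¹ • c with hc'
    have hcc' : ‖v - c'‖ ≤ 2 * (1 / 2) ^ 11 := by
      have e : c - c' = (‖c‖ - 1) • c' := by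
        rw [sub_smul, one_smul, hc', smul_smul, mul_inv_cancel₀ (norm_ne_zero_iff.2 hc0),
          one_smul]
      have h3 : ‖c - c'‖ ≤ (1 / 2) ^ 11 := by
        rw [e, norm_smul, hc', norm_smul, norm_inv, norm_norm,
          inv_mul_cancel₀ (norm_ne_zero_iff.2 hc0), mul_one, Real.norm_eq_abs]
        have h0 := abs_norm_sub_norm_le c v
        rw [hv1, norm_sub_rev] at h0
        exact h0.trans hvc
      have := norm_sub_le_norm_sub_add_norm_sub v c c'
      linarith
    -- Moving from `c'` to `v` costs `9 · 1.1 · 2⁻¹⁰ < 0.01`, by the Lipschitz constant `9` of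
    -- `tent` and the upper bound already proved; `0.79²` still exceeds `0.61`.
    have h4 : 8 / 10 ≤ rms fun i => tent (inner ℝ (x i) c') := by
      refine Real.le_sqrt_of_sq_le ((le_of_eq (by norm_num)).trans (h2 c hc hc0))
    have h5 : rms (fun i => tent (inner ℝ (x i) c')) ≤ rms (fun i => tent (inner ℝ (x i) v))
        + 9 * (11 / 10 * (2 * (1 / 2) ^ 11)) := by
      calc _ = rms (fun i => tent (inner ℝ (x i) v)
            + (tent (inner ℝ (x i) c') - tent (inner ℝ (x i) v))) := by
              congr 1; funext i; ring
        _ ≤ _ := rms_add_le _ _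
        _ ≤ rms (fun i => tent (inner ℝ (x i) v))
            + rms (fun i => 9 * inner ℝ (x i) (v - c')) := by
              gcongr
              refine rms_mono fun i => ?_
              rw [abs_sub_comm, inner_sub_right]
              exact abs_tent_sub_le _ _
        _ ≤ _ := by
              rw [rms_const_mul (by norm_num)]
              gcongr
              exact (key _).trans (by gcongr)
    have h6 : 61 / 100 ≤ avg fun i => tent (inner ℝ (x i) v) ^ 2 := by
      rw [← rms_sq]
      have : 79 / 100 ≤ rms (fun i => tent (inner ℝ (x i) v)) := by norm_num at h5; linarith
      nlinarith
    have h7 : ∀ i, ‖u‖ ^ 2 * tent (inner ℝ (x i) v) ^ 2 ≤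
        if |inner ℝ (x i) u| ≤ 10 / 3 * ‖u‖ then inner ℝ (x i) u ^ 2 else 0 := by
      intro i
      have e : inner ℝ (x i) u = ‖u‖ * inner ℝ (x i) v := by
        conv_lhs => rw [euv, real_inner_smul_right]
      rw [e, abs_mul, abs_norm]
      split_ifs with h
      · rw [mul_pow, ← sq_abs (inner ℝ (x i) v)]
        gcongr
        exacts [tent_nonneg _, tent_le_abs _]
      · rw [tent_eq_zero (lt_of_mul_lt_mul_left (by linarith) (norm_nonneg u))]
        simp
    calc _ ≤ ‖u‖ ^ 2 * avg fun i => tent (inner ℝ (x i) v) ^ 2 := by nlinarith [sq_nonneg ‖u‖]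
      _ = avg fun i => ‖u‖ ^ 2 * tent (inner ℝ (x i) v) ^ 2 := (avg_const_mul _ _).symm
      _ ≤ _ := avg_mono h7

end Design

/-! ### Gaussian integrals under the law of one data point. -/

section SampleGaussian

variable {d n : ℕ} {ν : Measure ℝ} [IsProbabilityMeasure ν]

/-- The law of one data point. -/
noncomputable abbrev pointLaw (d : ℕ) (ν : Measure ℝ) : Measure (EuclideanSpace ℝ (Fin d) × ℝ) :=
  (stdGaussian (EuclideanSpace ℝ (Fin d))).prod ν

instance (d n : ℕ) : IsProbabilityMeasure (sampleLaw d n ν) := by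
  unfold sampleLaw; infer_instance

theorem measurable_inner_fst (u : EuclideanSpace ℝ (Fin d)) :
    Measurable fun ω : EuclideanSpace ℝ (Fin d) × ℝ => inner ℝ ω.1 u :=
  (measurable_inner_right u).comp measurable_fst

theorem map_inner_fst (u : EuclideanSpace ℝ (Fin d)) :
    (pointLaw d ν).map (fun ω => inner ℝ ω.1 u) = gaussianReal 0 (‖u‖ ^ 2).toNNReal := by
  rw [← map_inner_stdGaussian u, ← (measurePreserving_fst (μ := stdGaussian
    (EuclideanSpace ℝ (Fin d))) (ν := ν)).map_eq, Measure.map_map (measurable_inner_right u)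
    measurable_fst]
  rfl

theorem map_inner_fst_unit {u : EuclideanSpace ℝ (Fin d)} (hu : ‖u‖ = 1) :
    (pointLaw d ν).map (fun ω => inner ℝ ω.1 u) = gaussianReal 0 1 := by
  rw [map_inner_fst, hu, one_pow, Real.toNNReal_one]

theorem integral_comp_inner_fst {u : EuclideanSpace ℝ (Fin d)} (hu : ‖u‖ = 1)
    {f : ℝ → ℝ} (hf : Measurable f) :
    ∫ ω, f (inner ℝ ω.1 u) ∂pointLaw d ν = ∫ t, f t ∂gaussianReal 0 1 := by
  rw [← map_inner_fst_unit (ν := ν) hu,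
    integral_map (measurable_inner_fst u).aemeasurable hf.aestronglyMeasurable]

theorem integrable_comp_inner_fst {u : EuclideanSpace ℝ (Fin d)} (hu : ‖u‖ = 1)
    {f : ℝ → ℝ} (hf : Measurable f) (hi : Integrable f (gaussianReal 0 1)) :
    Integrable (fun ω => f (inner ℝ ω.1 u)) (pointLaw d ν) := by
  rw [← map_inner_fst_unit (ν := ν) hu,
    integrable_map_measure hf.aestronglyMeasurable (measurable_inner_fst u).aemeasurable] at hi
  exact hi

theorem norm_inv_norm_smul {u : EuclideanSpace ℝ (Fin d)} (hu : u ≠ 0) : ‖‖u‖⁻¹ • u‖ = 1 := by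
  rw [norm_smul, norm_inv, norm_norm, inv_mul_cancel₀ (norm_ne_zero_iff.2 hu)]

theorem sqrt_one_div_one_sub_le_exp {s : ℝ} (h0 : 0 ≤ s) (h : s ≤ 1 / 4) :
    √(1 / (1 - 2 * s)) ≤ Real.exp (2 * s) := by
  have h1 : 0 < 1 - 2 * s := by linarith
  rw [Real.sqrt_le_left (Real.exp_pos _).le, ← Real.exp_nat_mul, one_div,
    ← Real.exp_log (inv_pos.2 h1), Real.exp_le_exp, Real.log_inv]
  have h2 := Real.one_sub_inv_le_log_of_pos h1
  have h3 : (1 - 2 * s)⁻¹ ≤ 1 + 4 * s := by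
    rw [inv_le_iff_one_le_mul₀ h1]; nlinarith
  push_cast
  linarith

theorem exp_mul_inner_sq {a : ℝ} (u : EuclideanSpace ℝ (Fin d)) (ha : 0 ≤ a)
    (h : a * ‖u‖ ^ 2 ≤ 1 / 4) :
    Integrable (fun ω => Real.exp (a * inner ℝ ω.1 u ^ 2)) (pointLaw d ν) ∧
      ∫ ω, Real.exp (a * inner ℝ ω.1 u ^ 2) ∂pointLaw d ν ≤ Real.exp (2 * (a * ‖u‖ ^ 2)) := by
  rcases eq_or_ne u 0 with rfl | hu
  · simp
  have hm : Measurable fun t : ℝ => Real.exp (a * ‖u‖ ^ 2 * t ^ 2) := by fun_prop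
  obtain ⟨h1, h2⟩ := exp_mul_sq_gaussian (s := a * ‖u‖ ^ 2) (by linarith)
  have e : (fun ω : EuclideanSpace ℝ (Fin d) × ℝ => Real.exp (a * inner ℝ ω.1 u ^ 2))
      = fun ω => Real.exp (a * ‖u‖ ^ 2 * inner ℝ ω.1 (‖u‖⁻¹ • u) ^ 2) := by
    funext ω
    rw [real_inner_smul_right]
    have := norm_ne_zero_iff.2 hu
    congr 1; field_simp
  rw [e]
  refine ⟨integrable_comp_inner_fst (norm_inv_norm_smul hu) hm h1, ?_⟩
  rw [integral_comp_inner_fst (norm_inv_norm_smul hu) hm, h2]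
  exact sqrt_one_div_one_sub_le_exp (by positivity) h

end SampleGaussian

/-! ### Gaussian designs are well conditioned. -/

section DesignProbability

variable {d n : ℕ} {ν : Measure ℝ} [IsProbabilityMeasure ν]

theorem sum_le_of_not_nonneg {f : Fin n → ℝ} {a b : ℝ} (ha : 0 < a)
    (h : ¬ 0 ≤ ∑ i, a * (f i - b)) : avg f ≤ b := by
  have hn : 0 < n := by
    rcases Nat.eq_zero_or_pos n with rfl | hn
    · simp at h
    · exact hn
  have hn' : (0 : ℝ) < n := by exact_mod_cast hn
  rw [← Finset.mul_sum, Finset.sum_sub_distrib, Finset.sum_const, Finset.card_univ,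
    Fintype.card_fin, nsmul_eq_mul, not_le] at h
  unfold avg
  rw [one_div, inv_mul_le_iff₀ hn']
  nlinarith

/-- Chernoff at parameter `1/20`: the moment is below `e^{0.053}` and the threshold contributes
`e^{-0.06}`. The exponent is weakened to the one available for the lower tail. -/
theorem sampleLaw_upper_le {u : EuclideanSpace ℝ (Fin d)} (hu : ‖u‖ = 1) :
    (sampleLaw d n ν).real {S | 0 ≤ ∑ i, 1 / 20 * (inner ℝ (S i).1 u ^ 2 - 6 / 5)}
      ≤ Real.exp (n * -(18 / 1000000)) := by
  have e : ∀ ω : EuclideanSpace ℝ (Fin d) × ℝ, Real.exp (1 / 20 * (inner ℝ ω.1 u ^ 2 - 6 / 5))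
      = Real.exp (-(3 / 50)) * Real.exp (1 / 20 * inner ℝ ω.1 u ^ 2) := by
    intro ω; rw [← Real.exp_add]; congr 1; ring
  have hm : Measurable fun t : ℝ => Real.exp (1 / 20 * t ^ 2) := by fun_prop
  obtain ⟨h1, h2⟩ := exp_mul_sq_gaussian (s := 1 / 20) (by norm_num)
  refine pi_real_sum_nonneg_le (pointLaw d ν) n
    (f := fun ω => 1 / 20 * (inner ℝ ω.1 u ^ 2 - 6 / 5)) ?_ ?_
  · simp_rw [e]
    exact (integrable_comp_inner_fst hu hm h1).const_mul _
  · simp_rw [e]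
    rw [integral_const_mul, integral_comp_inner_fst hu hm, h2]
    have h3 : √(1 / (1 - 2 * (1 / 20)) : ℝ) ≤ 1.0542 := by
      rw [Real.sqrt_le_left (by norm_num)]; norm_num
    have h4 : (1.0542 : ℝ) ≤ Real.exp (53 / 1000) := by
      refine le_trans ?_ (Real.quadratic_le_exp_of_nonneg (by norm_num))
      norm_num
    calc _ ≤ Real.exp (-(3 / 50)) * Real.exp (53 / 1000) := by gcongr; exact h3.trans h4
      _ = Real.exp (-(7 / 1000)) := by rw [← Real.exp_add]; norm_num
      _ ≤ _ := by rw [Real.exp_le_exp]; norm_num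

/-- Chernoff at parameter `1/1000`, with `e^{-y} ≤ 1 - y + y²` and the fourth moment bound. The gap
between `0.659` and `0.64`, times `1/1000`, leaves the exponent. -/
theorem sampleLaw_lower_le {u : EuclideanSpace ℝ (Fin d)} (hu : ‖u‖ = 1) :
    (sampleLaw d n ν).real
      {S | 0 ≤ ∑ i, 1 / 1000 * (-tent (inner ℝ (S i).1 u) ^ 2 - -(64 / 100))}
      ≤ Real.exp (n * -(18 / 1000000)) := by
  have e : ∀ ω : EuclideanSpace ℝ (Fin d) × ℝ,
      Real.exp (1 / 1000 * (-tent (inner ℝ ω.1 u) ^ 2 - -(64 / 100)))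
      = Real.exp (64 / 100000) * Real.exp (-(1 / 1000 * tent (inner ℝ ω.1 u) ^ 2)) := by
    intro ω; rw [← Real.exp_add]; congr 1; ring
  have hm : Measurable fun t : ℝ => Real.exp (-(1 / 1000 * tent t ^ 2)) := by
    have := continuous_tent
    fun_prop
  have hi : Integrable (fun t : ℝ => Real.exp (-(1 / 1000 * tent t ^ 2))) (gaussianReal 0 1) := by
    refine Integrable.of_bound hm.aestronglyMeasurable 1 (ae_of_all _ fun t => ?_)
    rw [Real.norm_eq_abs, Real.abs_exp, Real.exp_le_one_iff]
    have := sq_nonneg (tent t)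
    linarith
  obtain ⟨i2, h2⟩ := sq_gaussian
  obtain ⟨i4, h4⟩ := pow_four_gaussian
  have key : ∫ t, Real.exp (-(1 / 1000 * tent t ^ 2)) ∂gaussianReal 0 1
      ≤ 1 - 1 / 1000 + (1 / 9000 + 1 / 1000000) * (304 / 100) := by
    have i5 : Integrable (fun t : ℝ => 1 - 1 / 1000 * t ^ 2) (gaussianReal 0 1) :=
      (integrable_const _).sub (i2.const_mul _)
    calc _ ≤ ∫ t, (1 - 1 / 1000 * t ^ 2 + (1 / 9000 + 1 / 1000000) * t ^ 4)
          ∂gaussianReal 0 1 := by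
          refine integral_mono hi (i5.add (i4.const_mul _)) fun t => ?_
          have h5 := tent_nonneg t
          have h6 := tent_le_three t
          have h7 : tent t ^ 2 ≤ 9 := by nlinarith
          have h8 := sub_pow_four_le_tent_sq t
          have h9 : (tent t ^ 2) ^ 2 ≤ t ^ 4 := by
            rw [← pow_mul, ← (show Even 4 by decide).pow_abs t]
            exact pow_le_pow_left₀ h5 (tent_le_abs t) 4
          have h10 := Real.abs_exp_sub_one_sub_id_le (x := -(1 / 1000 * tent t ^ 2)) (by
            rw [abs_neg, abs_of_nonneg (by positivity)]; linarith)
          have h11 := (abs_le.1 h10).2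
          simp only
          nlinarith
      _ = 1 - 1 / 1000 + (1 / 9000 + 1 / 1000000) * ∫ t, t ^ 4 ∂gaussianReal 0 1 := by
          rw [integral_add i5 (i4.const_mul _), integral_sub (integrable_const _)
            (i2.const_mul _), integral_const_mul, integral_const_mul, h2]
          simp
      _ ≤ _ := by gcongr
  refine pi_real_sum_nonneg_le (pointLaw d ν) n
    (f := fun ω => 1 / 1000 * (-tent (inner ℝ ω.1 u) ^ 2 - -(64 / 100))) ?_ ?_
  · simp_rw [e]
    exact (integrable_comp_inner_fst hu hm hi).const_mul _
  · simp_rw [e]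
    rw [integral_const_mul, integral_comp_inner_fst hu hm]
    have h3 : (1 - 1 / 1000 + (1 / 9000 + 1 / 1000000) * (304 / 100) : ℝ)
        ≤ Real.exp (-(659 / 1000000)) :=
      le_trans (by norm_num) (Real.one_sub_le_exp_neg _)
    calc _ ≤ Real.exp (64 / 100000) * Real.exp (-(659 / 1000000)) := by
          gcongr; exact key.trans h3
      _ ≤ _ := by rw [← Real.exp_add, Real.exp_le_exp]; norm_num

/-- A Gaussian design is well conditioned with high probability. -/
theorem sampleLaw_not_wellConditioned_le (d n : ℕ) (ν : Measure ℝ) [IsProbabilityMeasure ν] :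
    (sampleLaw d n ν).real {S | ¬ WellConditioned fun i => (S i).1}
      ≤ 5 ^ (d * 11) * (2 * Real.exp (n * -(18 / 1000000))) := by
  classical
  obtain ⟨N, hN, hN'⟩ := exists_net d 11
  set U : EuclideanSpace ℝ (Fin d) → Set (Sample d n) := fun u =>
    {S | 0 ≤ ∑ i, 1 / 20 * (inner ℝ (S i).1 u ^ 2 - 6 / 5)} ∪
    {S | 0 ≤ ∑ i, 1 / 1000 * (-tent (inner ℝ (S i).1 u) ^ 2 - -(64 / 100))} with hU
  have hsub : {S : Sample d n | ¬ WellConditioned fun i => (S i).1}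
      ⊆ ⋃ c ∈ N.filter (· ≠ 0), U (‖c‖⁻¹ • c) := by
    intro S hS
    by_contra hc
    refine hS (wellConditioned_of_net _ N hN' (fun c hc1 hc0 => ?_) fun c hc1 hc0 => ?_)
    · refine sum_le_of_not_nonneg (a := 1 / 20) (by norm_num) fun h => hc ?_
      exact Set.mem_biUnion (Finset.mem_filter.2 ⟨hc1, hc0⟩) (Or.inl h)
    · have : (avg fun i => -tent (inner ℝ (S i).1 (‖c‖⁻¹ • c)) ^ 2) ≤ -(64 / 100) := by
        refine sum_le_of_not_nonneg (a := 1 / 1000) (by norm_num) fun h => hc ?_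
        exact Set.mem_biUnion (Finset.mem_filter.2 ⟨hc1, hc0⟩) (Or.inr h)
      have e := avg_const_mul (n := n) (-1)
        (fun i => tent (inner ℝ (S i).1 (‖c‖⁻¹ • c)) ^ 2)
      simp only [neg_one_mul] at e
      linarith
  refine (measureReal_mono hsub (measure_ne_top _ _)).trans ((measureReal_biUnion_finset_le _ _).trans ?_)
  calc _ ≤ ∑ c ∈ N.filter (· ≠ 0), 2 * Real.exp (n * -(18 / 1000000)) := by
        refine Finset.sum_le_sum fun c hc => (measureReal_union_le _ _).trans ?_
        have hc0 := norm_inv_norm_smul (Finset.mem_filter.1 hc).2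
        linarith [sampleLaw_upper_le (n := n) (ν := ν) hc0,
          sampleLaw_lower_le (n := n) (ν := ν) hc0]
    _ ≤ _ := by
        rw [Finset.sum_const, nsmul_eq_mul]
        gcongr
        exact_mod_cast (Finset.card_filter_le _ _).trans hN

end DesignProbability

/-! ### Concentration of averages of bounded multiples of Gaussian vectors. -/

section VectorAverage

variable {d n : ℕ} {ν : Measure ℝ} [IsProbabilityMeasure ν]

/-- For a centered variable the linear term integrates to zero, leaving the exponential moment of a
square. -/
theorem exp_le_add_exp_sq (x : ℝ) : Real.exp x ≤ x + Real.exp (x ^ 2) := by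
  have h1 := Real.add_one_le_exp (x ^ 2)
  rcases le_total 1 x with h | h
  · have : Real.exp x ≤ Real.exp (x ^ 2) := Real.exp_le_exp.2 (by nlinarith)
    linarith
  · rcases le_total x (-1) with h' | h'
    · have : Real.exp x ≤ 1 := Real.exp_le_one_iff.2 (by linarith)
      nlinarith
    · have := (abs_le.1 (Real.abs_exp_sub_one_sub_id_le (abs_le.2 ⟨h', h⟩))).2
      linarith

/-- The exponential moment of a centered variable dominated by a Gaussian. -/
theorem exp_moment_of_le_inner {c : EuclideanSpace ℝ (Fin d) × ℝ → ℝ} (hc : Measurable c)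
    {a : ℝ} (u : EuclideanSpace ℝ (Fin d)) (hau : a ^ 2 * ‖u‖ ^ 2 ≤ 1 / 4)
    (hca : ∀ᵐ ω ∂pointLaw d ν, |c ω| ≤ a)
    (h0 : ∫ ω, c ω * inner ℝ ω.1 u ∂pointLaw d ν = 0) :
    Integrable (fun ω => Real.exp (c ω * inner ℝ ω.1 u)) (pointLaw d ν) ∧
      ∫ ω, Real.exp (c ω * inner ℝ ω.1 u) ∂pointLaw d ν
        ≤ Real.exp (2 * (a ^ 2 * ‖u‖ ^ 2)) := by
  obtain ⟨i1, h1⟩ := exp_mul_inner_sq (ν := ν) u (sq_nonneg a) hau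
  have hm : Measurable fun ω : EuclideanSpace ℝ (Fin d) × ℝ => c ω * inner ℝ ω.1 u :=
    hc.mul (measurable_inner_fst u)
  have hsq : ∀ᵐ ω ∂pointLaw d ν, (c ω * inner ℝ ω.1 u) ^ 2 ≤ a ^ 2 * inner ℝ ω.1 u ^ 2 := by
    filter_upwards [hca] with ω hω
    rw [mul_pow]
    exact mul_le_mul_of_nonneg_right (sq_le_sq' (neg_le_of_abs_le hω) (le_of_abs_le hω))
      (sq_nonneg _)
  have i2 : Integrable (fun ω => c ω * inner ℝ ω.1 u) (pointLaw d ν) := by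
    refine i1.mono' hm.aestronglyMeasurable ?_
    filter_upwards [hsq] with ω hω
    have h2 := Real.add_one_le_exp (a ^ 2 * inner ℝ ω.1 u ^ 2)
    rw [Real.norm_eq_abs]
    nlinarith [sq_abs (c ω * inner ℝ ω.1 u), sq_nonneg (|c ω * inner ℝ ω.1 u| - 1)]
  have hle : ∀ᵐ ω ∂pointLaw d ν, Real.exp (c ω * inner ℝ ω.1 u)
      ≤ c ω * inner ℝ ω.1 u + Real.exp (a ^ 2 * inner ℝ ω.1 u ^ 2) := by
    filter_upwards [hsq] with ω hω
    exact (exp_le_add_exp_sq _).trans (by gcongr)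
  have i3 : Integrable (fun ω => Real.exp (c ω * inner ℝ ω.1 u)) (pointLaw d ν) := by
    refine (i2.add i1).mono' (Real.measurable_exp.comp hm).aestronglyMeasurable ?_
    filter_upwards [hle] with ω hω
    rwa [Real.norm_eq_abs, Real.abs_exp]
  refine ⟨i3, (integral_mono_ae i3 (i2.add i1) hle).trans ?_⟩
  rw [integral_add' i2 i1, h0, zero_add]
  exact h1

/-- Concentration of averages of centered vectors `c x` with bounded `c`. -/
theorem sampleLaw_norm_vavg_le (hd : 1 ≤ d) (hdn : d ≤ n)
    {c : EuclideanSpace ℝ (Fin d) × ℝ → ℝ} (hc : Measurable c) {a : ℝ} (ha : 0 < a)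
    (hca : ∀ᵐ ω ∂pointLaw d ν, |c ω| ≤ a)
    (h0 : ∀ u, ∫ ω, c ω * inner ℝ ω.1 u ∂pointLaw d ν = 0) {K : ℝ} (hK : 0 ≤ K) :
    (sampleLaw d n ν).real {S | 3 * K * a * √(d / n)
        < ‖vavg (fun i => c (S i)) fun i => (S i).1‖}
      ≤ 5 ^ d * Real.exp (-((K - 1) * d / 2)) := by
  classical
  have hd' : (0 : ℝ) < d := by exact_mod_cast hd
  have hn' : (0 : ℝ) < n := by exact_mod_cast (hd.trans hdn)
  have hdn' : (d : ℝ) ≤ n := by exact_mod_cast hdn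
  obtain ⟨N, hN, hN'⟩ := exists_net d 1
  rw [mul_one] at hN
  set s := √((d : ℝ) / n) with hs
  have hs0 : 0 < s := Real.sqrt_pos.2 (by positivity)
  have hs2 : s ^ 2 = d / n := Real.sq_sqrt (by positivity)
  have hs1 : s ^ 2 ≤ 1 := by rw [hs2, div_le_one hn']; exact hdn'
  -- A `1/2`-net loses a factor `2`, hence the threshold `3/2 · K a s`; its relevant points have
  -- norm at most `3/2`. With this `l` the moment contributes `s²/2` and the threshold `-K s²/2`,
  -- and `n s² = d`.
  set l := s / (3 * a) with hl
  have hl0 : 0 < l := by positivity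
  set U : EuclideanSpace ℝ (Fin d) → Set (Sample d n) := fun u =>
    {S | 0 ≤ ∑ i, l * (c (S i) * inner ℝ (S i).1 u - 3 / 2 * K * a * s)} with hU
  have hsub : {S : Sample d n | 3 * K * a * s
        < ‖vavg (fun i => c (S i)) fun i => (S i).1‖}
      ⊆ ⋃ u ∈ N.filter (‖·‖ ≤ 3 / 2), U u := by
    intro S hS
    rw [Set.mem_ofPred_eq] at hS
    set y := vavg (fun i => c (S i)) fun i => (S i).1 with hy
    have hy0 : 0 < ‖y‖ := (by positivity : (0:ℝ) ≤ 3 * K * a * s).trans_lt hS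
    have hv1 := norm_inv_norm_smul (norm_pos_iff.1 hy0)
    set v := ‖y‖⁻¹ • y with hv
    obtain ⟨u, hu, hvu⟩ := hN' v hv1.le
    rw [pow_one] at hvu
    have hu2 : ‖u‖ ≤ 3 / 2 := by
      have := norm_le_norm_add_norm_sub v u
      linarith
    refine Set.mem_biUnion (Finset.mem_filter.2 ⟨hu, hu2⟩) ?_
    by_contra hneg
    have h1 : (avg fun i => c (S i) * inner ℝ (S i).1 u) ≤ 3 / 2 * K * a * s :=
      sum_le_of_not_nonneg hl0 hneg
    rw [← inner_vavg, ← hy] at h1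
    have h2 : inner ℝ y v = ‖y‖ := by
      rw [hv, real_inner_smul_right, real_inner_self_eq_norm_sq]; field_simp
    have h3 : inner ℝ y (v - u) ≤ ‖y‖ * (1 / 2) :=
      (real_inner_le_norm _ _).trans (by gcongr)
    rw [inner_sub_right, h2] at h3
    linarith
  have hUle : ∀ u : EuclideanSpace ℝ (Fin d), ‖u‖ ≤ 3 / 2 → (sampleLaw d n ν).real (U u)
      ≤ Real.exp (-((K - 1) * d / 2)) := by
    intro u hu
    have hla : (l * a) ^ 2 * ‖u‖ ^ 2 ≤ s ^ 2 / 4 := by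
      have e : l * a = s / 3 := by rw [hl]; field_simp
      rw [e]
      have : ‖u‖ ^ 2 ≤ (3 / 2) ^ 2 := by gcongr
      nlinarith [sq_nonneg s]
    obtain ⟨i1, h1⟩ := exp_moment_of_le_inner (ν := ν) (c := fun ω => l * c ω) (hc.const_mul l)
      (a := l * a) u (by linarith) (by
        filter_upwards [hca] with ω hω
        rw [abs_mul, abs_of_pos hl0]; gcongr) (by
        simp_rw [mul_assoc]; rw [integral_const_mul, h0, mul_zero])
    have e : ∀ ω : EuclideanSpace ℝ (Fin d) × ℝ,
        Real.exp (l * (c ω * inner ℝ ω.1 u - 3 / 2 * K * a * s))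
        = Real.exp (-(l * (3 / 2 * K * a * s))) * Real.exp (l * c ω * inner ℝ ω.1 u) := by
      intro ω; rw [← Real.exp_add]; congr 1; ring
    have h2 := pi_real_sum_nonneg_le (pointLaw d ν) n
      (f := fun ω => l * (c ω * inner ℝ ω.1 u - 3 / 2 * K * a * s))
      (r := -((K - 1) / 2 * s ^ 2)) (by simp_rw [e]; exact i1.const_mul _) (by
        simp_rw [e]
        rw [integral_const_mul]
        refine (mul_le_mul_of_nonneg_left h1 (Real.exp_pos _).le).trans ?_
        rw [← Real.exp_add, Real.exp_le_exp]
        have e2 : l * (3 / 2 * K * a * s) = K * s ^ 2 / 2 := by rw [hl]; field_simp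
        rw [e2]
        linarith)
    refine h2.trans (le_of_eq ?_)
    rw [hs2]
    congr 1; field_simp
  refine (measureReal_mono hsub (measure_ne_top _ _)).trans ((measureReal_biUnion_finset_le _ _).trans ?_)
  calc _ ≤ ∑ c ∈ N.filter (‖·‖ ≤ 3 / 2), Real.exp (-((K - 1) * d / 2)) :=
        Finset.sum_le_sum fun u hu => hUle u (Finset.mem_filter.1 hu).2
    _ ≤ _ := by
        rw [Finset.sum_const, nsmul_eq_mul]
        gcongr
        exact_mod_cast (Finset.card_filter_le _ _).trans hN

end VectorAverage

/-! ### The noise distribution, logits of the noise, and tails of the pre-activations. -/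

section Noise

variable {d n : ℕ} {ν : Measure ℝ} {ς : ℝ}

/-- All that the proof uses of `τ_max ≥ 1`: a universal bound on the noise width. -/
theorem noise_width_le {d : ℕ} (hς : 0 < ς) (h : 1 ≤ tauMax d ς) : ς ≤ 4 / 130 := by
  unfold tauMax at h
  have h1 : Real.exp (-3 / √(d : ℝ)) ≤ 1 :=
    Real.exp_le_one_iff.2 (div_nonpos_of_nonpos_of_nonneg (by norm_num) (Real.sqrt_nonneg _))
  have h2 : √(2 / Real.pi) ≤ 4 / 5 := by
    rw [Real.sqrt_le_left (by norm_num), div_le_iff₀ Real.pi_pos]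
    linarith [Real.pi_gt_d2]
  have h3 : Real.exp (-3 / √(d : ℝ)) / 26 * √(2 / Real.pi) ≤ 1 / 26 * (4 / 5) := by gcongr
  rw [mul_one_div, le_div_iff₀ hς] at h
  linarith

theorem IsBoundedNoise.ae_point [IsProbabilityMeasure ν] (h : IsBoundedNoise ν ς) :
    ∀ᵐ ω ∂pointLaw d ν, |ω.2| ≤ ς :=
  (measurePreserving_snd (μ := stdGaussian (EuclideanSpace ℝ (Fin d))) (ν := ν))
    |>.quasiMeasurePreserving.ae h.bounded

theorem IsBoundedNoise.ae_sample [IsProbabilityMeasure ν] (h : IsBoundedNoise ν ς) :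
    ∀ᵐ S ∂sampleLaw d n ν, ∀ i, |(S i).2| ≤ ς := by
  rw [ae_all_iff]
  intro i
  exact (measurePreserving_eval (fun _ : Fin n => pointLaw d ν) i).quasiMeasurePreserving.ae
    h.ae_point

/-- The mean of a product of a function of the covariate and a function of the noise. -/
theorem integral_pointLaw_mul [IsProbabilityMeasure ν] (f : EuclideanSpace ℝ (Fin d) → ℝ)
    (g : ℝ → ℝ) : ∫ ω, f ω.1 * g ω.2 ∂pointLaw d ν
      = (∫ x, f x ∂stdGaussian (EuclideanSpace ℝ (Fin d))) * ∫ e, g e ∂ν :=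
  integral_prod_mul f g

/-- Concentration of the noise part of the gradient at the gold model. -/
theorem sampleLaw_norm_vavg_noise_le (hd : 1 ≤ d) (hdn : d ≤ n) (hς : 0 < ς)
    [IsProbabilityMeasure ν] (h : IsBoundedNoise ν ς) (v : EuclideanSpace ℝ (Fin d)) {K : ℝ}
    (hK : 0 ≤ K) :
    (sampleLaw d n ν).real {S | 3 * K * ς * √(d / n)
        < ‖vavg (fun i => (S i).2 * sigmoidDeriv (inner ℝ (S i).1 v)) fun i => (S i).1‖}
      ≤ 5 ^ d * Real.exp (-((K - 1) * d / 2)) := by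
  refine sampleLaw_norm_vavg_le (c := fun ω => ω.2 * sigmoidDeriv (inner ℝ ω.1 v)) hd hdn
    (measurable_snd.mul (continuous_sigmoidDeriv.measurable.comp (measurable_inner_fst v))) hς
    ?_ (fun u => ?_) hK
  · filter_upwards [h.ae_point] with ω hω
    rw [abs_mul, abs_of_pos (sigmoidDeriv_pos _)]
    have := sigmoidDeriv_le (inner ℝ ω.1 v)
    nlinarith [sigmoidDeriv_pos (inner ℝ ω.1 v), abs_nonneg ω.2]
  · have := integral_pointLaw_mul (ν := ν)
      (fun x : EuclideanSpace ℝ (Fin d) => sigmoidDeriv (inner ℝ x v) * inner ℝ x u) (fun e => e)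
    rw [h.mean_zero, mul_zero] at this
    rw [← this]
    congr 1; funext ω; ring

/-- Concentration of averages of the covariates weighted by functions of the noise. -/
theorem sampleLaw_norm_vavg_indep_le (hd : 1 ≤ d) (hdn : d ≤ n)
    [IsProbabilityMeasure ν] (h : IsBoundedNoise ν ς) {g : ℝ → ℝ} (hg : Measurable g) {a : ℝ}
    (ha : 0 < a) (hga : ∀ e, |e| ≤ ς → |g e| ≤ a) {K : ℝ} (hK : 0 ≤ K) :
    (sampleLaw d n ν).real {S | 3 * K * a * √(d / n)
        < ‖vavg (fun i => g (S i).2) fun i => (S i).1‖}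
      ≤ 5 ^ d * Real.exp (-((K - 1) * d / 2)) := by
  refine sampleLaw_norm_vavg_le (c := fun ω => g ω.2) hd hdn (hg.comp measurable_snd) ha
    ?_ (fun u => ?_) hK
  · filter_upwards [h.ae_point] with ω hω
    exact hga _ hω
  · have := integral_pointLaw_mul (ν := ν)
      (fun x : EuclideanSpace ℝ (Fin d) => inner ℝ x u) g
    rw [integral_inner_stdGaussian, zero_mul] at this
    rw [← this]
    congr 1; funext ω; ring

/-- The logit of `1 / 2 + e`. -/
noncomputable def halfLogit (e : ℝ) : ℝ := Real.log ((1 / 2 + e) / (1 / 2 - e))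

theorem measurable_halfLogit : Measurable halfLogit := by unfold halfLogit; fun_prop

theorem sigmoid_halfLogit {e : ℝ} (h : |e| < 1 / 2) : Real.sigmoid (halfLogit e) = 1 / 2 + e := by
  obtain ⟨h1, h2⟩ := abs_lt.1 h
  have h3 : 0 < 1 / 2 + e := by linarith
  have h4 : 0 < 1 / 2 - e := by linarith
  rw [Real.sigmoid_def, halfLogit, Real.exp_neg, Real.exp_log (by positivity), inv_div]
  have : 1 + (1 / 2 - e) / (1 / 2 + e) = (1 / 2 + e)⁻¹ := by
    rw [inv_eq_one_div, eq_div_iff h3.ne', add_mul, div_mul_cancel₀ _ h3.ne']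
    ring
  rw [this, inv_inv]

/-- The slope of the logit on this range is at most `1/(1/4 - (4/130)²) < 5`. -/
theorem abs_halfLogit_le {e : ℝ} (h : |e| ≤ 4 / 130) : |halfLogit e| ≤ 5 * |e| := by
  have h1 : Real.sigmoid (halfLogit e) = 1 / 2 + e := sigmoid_halfLogit (by linarith)
  have h2 := abs_sub_le_of_sigmoid_near_half (a := halfLogit e) (b := 0) (r := 4 / 130)
    (by rw [h1]; simpa using h) (by rw [Real.sigmoid_zero]; norm_num)
  rw [h1, Real.sigmoid_zero, sub_zero, show (1 / 2 + e - 2⁻¹ : ℝ) = e by ring] at h2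
  norm_num at h2
  linarith [abs_nonneg e, abs_nonneg (halfLogit e)]

/-- A Gaussian tail bound for one covariate. -/
theorem pointLaw_abs_inner_gt_le [IsProbabilityMeasure ν] (hd : 1 ≤ d)
    {v : EuclideanSpace ℝ (Fin d)} (hv : ‖v‖ ≤ 1 / √(d : ℝ)) :
    (pointLaw d ν).real {ω | √2 < |inner ℝ ω.1 v|} ≤ 2 * Real.exp (-d) := by
  have hd' : (0 : ℝ) < d := by exact_mod_cast hd
  have one : ∀ u : EuclideanSpace ℝ (Fin d), ‖u‖ ≤ 1 / √(d : ℝ) →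
      (pointLaw d ν).real {ω | √2 ≤ inner ℝ ω.1 u} ≤ Real.exp (-d) := by
    intro u hu
    have hmap := map_inner_fst (ν := ν) u
    have hi : Integrable (fun ω : EuclideanSpace ℝ (Fin d) × ℝ =>
        Real.exp (√2 * d * inner ℝ ω.1 u)) (pointLaw d ν) := by
      have := integrable_exp_mul_gaussianReal (μ := 0) (v := (‖u‖ ^ 2).toNNReal) (√2 * d)
      rw [← hmap, integrable_map_measure (by fun_prop) (measurable_inner_fst u).aemeasurable]
        at this
      exact this
    -- The variance of `⟨x, u⟩` is at most `1/d`, so `√2 d` is the Chernoff parameter giving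
    -- `e^{-d}` at level `√2`.
    have h1 := measure_ge_le_exp_mul_mgf (μ := pointLaw d ν) (X := fun ω => inner ℝ ω.1 u)
      (t := √2 * d) √2 (by positivity) hi
    refine h1.trans ?_
    rw [mgf_gaussianReal hmap, ← Real.exp_add, Real.exp_le_exp,
      Real.coe_toNNReal _ (sq_nonneg _)]
    have h2 : ‖u‖ ^ 2 * d ≤ 1 := by
      have : ‖u‖ ^ 2 ≤ (1 / √(d : ℝ)) ^ 2 := by gcongr
      rw [div_pow, Real.sq_sqrt hd'.le, one_pow] at this
      rwa [le_div_iff₀ hd'] at this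
    have h3 : √2 ^ 2 = (2 : ℝ) := Real.sq_sqrt (by norm_num)
    have e : -(√2 * ↑d) * √2 + (0 * (√2 * ↑d) + ‖u‖ ^ 2 * (√2 * ↑d) ^ 2 / 2)
        = -(√2 ^ 2) * d + √2 ^ 2 / 2 * (‖u‖ ^ 2 * d) * d := by ring
    rw [e, h3]
    nlinarith
  have hsub : {ω : EuclideanSpace ℝ (Fin d) × ℝ | √2 < |inner ℝ ω.1 v|}
      ⊆ {ω | √2 ≤ inner ℝ ω.1 v} ∪ {ω | √2 ≤ inner ℝ ω.1 (-v)} := by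
    intro ω hω
    rcases lt_abs.1 (show √2 < |inner ℝ ω.1 v| from hω) with h | h
    · exact Or.inl h.le
    · exact Or.inr (by rw [Set.mem_ofPred_eq, inner_neg_right]; exact h.le)
  refine (measureReal_mono hsub).trans ((measureReal_union_le _ _).trans ?_)
  linarith [one v hv, one (-v) (by rwa [norm_neg])]

/-- A union bound over the sample; this is the source of the term `2n e^{-d}` in the theorem. -/
theorem sampleLaw_exists_abs_inner_gt_le [IsProbabilityMeasure ν] (hd : 1 ≤ d) (n : ℕ)
    {v : EuclideanSpace ℝ (Fin d)} (hv : ‖v‖ ≤ 1 / √(d : ℝ)) :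
    (sampleLaw d n ν).real {S | ∃ i, √2 < |inner ℝ (S i).1 v|} ≤ 2 * n * Real.exp (-d) := by
  have e : {S : Sample d n | ∃ i, √2 < |inner ℝ (S i).1 v|}
      = ⋃ i ∈ Finset.univ, {S | √2 < |inner ℝ (S i).1 v|} := by ext S; simp
  rw [e]
  refine (measureReal_biUnion_finset_le _ _).trans ?_
  have h1 : ∀ i, (sampleLaw d n ν).real {S | √2 < |inner ℝ (S i).1 v|} ≤ 2 * Real.exp (-d) := by
    intro i
    refine le_trans (le_of_eq ?_) (pointLaw_abs_inner_gt_le (ν := ν) hd hv)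
    have hm : MeasurableSet {ω : EuclideanSpace ℝ (Fin d) × ℝ | √2 < |inner ℝ ω.1 v|} :=
      measurableSet_lt measurable_const (measurable_inner_fst v).abs
    exact (measurePreserving_eval (fun _ : Fin n => pointLaw d ν) i).measureReal_preimage
      hm.nullMeasurableSet
  refine (Finset.sum_le_sum fun i _ => h1 i).trans (le_of_eq ?_)
  simp; ring

end Noise

/-! ### Deviation of centered variables dominated by a squared Gaussian. -/

section QuadraticForm

variable {d n : ℕ} {ν : Measure ℝ} [IsProbabilityMeasure ν]

theorem exp_le_one_add_add_sq_mul (y : ℝ) :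
    Real.exp y ≤ 1 + y + y ^ 2 * Real.exp |y| := by
  have h0 : 1 ≤ Real.exp |y| := Real.one_le_exp (abs_nonneg y)
  rcases le_total |y| 1 with h | h
  · have := (abs_le.1 (Real.abs_exp_sub_one_sub_id_le h)).2
    nlinarith [mul_le_mul_of_nonneg_left h0 (sq_nonneg y)]
  · have h1 : 1 ≤ y ^ 2 := by rw [← sq_abs]; nlinarith
    rcases le_total 0 y with h2 | h2
    · rw [abs_of_nonneg h2] at *
      nlinarith [Real.exp_pos y]
    · rw [abs_of_nonpos h2] at h
      have : Real.exp y ≤ 1 := Real.exp_le_one_iff.2 h2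
      nlinarith [mul_le_mul_of_nonneg_left h0 (sq_nonneg y)]

/-- A one-sided deviation bound for centered variables dominated by a squared Gaussian. -/
theorem sampleLaw_quadratic_le {k : EuclideanSpace ℝ (Fin d) × ℝ → ℝ} (hk : Measurable k)
    {u : EuclideanSpace ℝ (Fin d)} (hu : ‖u‖ = 1) {B θ : ℝ} (hB : 0 < B) (hθ : 0 < θ)
    (hθ1 : θ ≤ 1) (hkB : ∀ᵐ ω ∂pointLaw d ν, |k ω| ≤ B * inner ℝ ω.1 u ^ 2)
    (h0 : ∫ ω, k ω ∂pointLaw d ν = 0) :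
    (sampleLaw d n ν).real {S | 0 ≤ ∑ i, θ / (384 * B) * (k (S i) - θ * B)}
      ≤ Real.exp (n * -(θ ^ 2 / 768)) := by
  -- Minimizes `192 a² - a θ` over `a = l B`; the minimum is `-θ²/768`. The constant `192` is `128 ·
  -- 3/2`, with `3/2` bounding `E e^{g²/4} = √2`.
  set l := θ / (384 * B) with hl
  have hl0 : 0 < l := by positivity
  set a := θ / 384 with ha
  have ha0 : 0 < a := by positivity
  have ha1 : a ≤ 1 / 8 := by rw [ha]; linarith
  have hlB : l * B = a := by rw [hl, ha]; field_simp
  have hm : Measurable fun t : ℝ => Real.exp (1 / 4 * t ^ 2) := by fun_prop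
  obtain ⟨i1, h1⟩ := exp_mul_sq_gaussian (s := 1 / 4) (by norm_num)
  have i2 := integrable_comp_inner_fst (ν := ν) hu hm i1
  have h2 := integral_comp_inner_fst (ν := ν) hu hm
  rw [h1] at h2
  have h3 : √(1 / (1 - 2 * (1 / 4)) : ℝ) ≤ 3 / 2 := by
    rw [Real.sqrt_le_left (by norm_num)]; norm_num
  have hg : ∀ g : ℝ, g ^ 2 ≤ 8 * Real.exp (1 / 4 * g ^ 2) := by
    intro g
    have := Real.add_one_le_exp (1 / 4 * g ^ 2)
    nlinarith [sq_nonneg g]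
  have i3 : Integrable k (pointLaw d ν) := by
    refine (i2.const_mul (B * 8)).mono' hk.aestronglyMeasurable ?_
    filter_upwards [hkB] with ω hω
    rw [Real.norm_eq_abs]
    refine hω.trans ?_
    rw [mul_assoc]
    gcongr
    exact hg _
  have hle : ∀ᵐ ω ∂pointLaw d ν, Real.exp (l * k ω)
      ≤ 1 + l * k ω + 128 * a ^ 2 * Real.exp (1 / 4 * inner ℝ ω.1 u ^ 2) := by
    filter_upwards [hkB] with ω hω
    set q := inner ℝ ω.1 u ^ 2 with hq
    have hq0 : 0 ≤ q := sq_nonneg _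
    have hY : |l * k ω| ≤ a * q := by
      rw [abs_mul, abs_of_pos hl0, ← hlB, mul_assoc]
      gcongr
    refine (exp_le_one_add_add_sq_mul _).trans ?_
    have h4 : (l * k ω) ^ 2 ≤ (a * q) ^ 2 := sq_le_sq' (neg_le_of_abs_le hY) (le_of_abs_le hY)
    have h5 : Real.exp |l * k ω| ≤ Real.exp (1 / 8 * q) :=
      Real.exp_le_exp.2 (hY.trans (by gcongr))
    have h6 : q ^ 2 ≤ 128 * Real.exp (1 / 8 * q) := by
      have := Real.quadratic_le_exp_of_nonneg (by positivity : 0 ≤ 1 / 8 * q)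
      nlinarith
    have h7 : Real.exp (1 / 4 * q) = Real.exp (1 / 8 * q) * Real.exp (1 / 8 * q) := by
      rw [← Real.exp_add]; congr 1; ring
    have h8 : (l * k ω) ^ 2 * Real.exp |l * k ω| ≤ (a * q) ^ 2 * Real.exp (1 / 8 * q) :=
      mul_le_mul h4 h5 (Real.exp_pos _).le (sq_nonneg _)
    have h9 : (a * q) ^ 2 * Real.exp (1 / 8 * q) ≤ 128 * a ^ 2 * Real.exp (1 / 4 * q) := by
      rw [h7, mul_pow]
      calc _ ≤ a ^ 2 * (128 * Real.exp (1 / 8 * q)) * Real.exp (1 / 8 * q) := by gcongr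
        _ = _ := by ring
    linarith
  have i4 : Integrable (fun ω => 1 + l * k ω) (pointLaw d ν) :=
    (integrable_const _).add (i3.const_mul l)
  have i5 : Integrable (fun ω => 1 + l * k ω
      + 128 * a ^ 2 * Real.exp (1 / 4 * inner ℝ ω.1 u ^ 2)) (pointLaw d ν) :=
    i4.add (i2.const_mul _)
  have i6 : Integrable (fun ω => Real.exp (l * k ω)) (pointLaw d ν) := by
    refine i5.mono' (Real.measurable_exp.comp (hk.const_mul l)).aestronglyMeasurable ?_
    filter_upwards [hle] with ω hω
    rwa [Real.norm_eq_abs, Real.abs_exp]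
  have h4 : ∫ ω, Real.exp (l * k ω) ∂pointLaw d ν ≤ Real.exp (192 * a ^ 2) := by
    refine (integral_mono_ae i6 i5 hle).trans ?_
    rw [integral_add i4 (i2.const_mul _), integral_add (integrable_const _) (i3.const_mul l),
      integral_const_mul, integral_const_mul, h0, h2]
    simp only [integral_const, probReal_univ, smul_eq_mul, one_mul, mul_zero, add_zero]
    have := Real.add_one_le_exp (192 * a ^ 2)
    nlinarith [sq_nonneg a]
  have e : ∀ ω, Real.exp (l * (k ω - θ * B)) = Real.exp (-(a * θ)) * Real.exp (l * k ω) := by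
    intro ω
    rw [← Real.exp_add, ← hlB]; congr 1; ring
  refine pi_real_sum_nonneg_le (pointLaw d ν) n (f := fun ω => l * (k ω - θ * B))
    (by simp_rw [e]; exact i6.const_mul _) ?_
  simp_rw [e]
  rw [integral_const_mul]
  refine (mul_le_mul_of_nonneg_left h4 (Real.exp_pos _).le).trans ?_
  rw [← Real.exp_add, Real.exp_le_exp, ha]
  nlinarith [sq_nonneg θ]

end QuadraticForm

/-! ### Uniform smallness of the noise Hessian in fixed dimension. -/

section UniformQuadraticForm

variable {d n : ℕ} {ν : Measure ℝ}

theorem measurePreserving_covariate [IsProbabilityMeasure ν] (i : Fin n) :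
    MeasurePreserving (fun S : Sample d n => (S i).1) (sampleLaw d n ν)
      (stdGaussian (EuclideanSpace ℝ (Fin d))) :=
  (measurePreserving_fst (μ := stdGaussian (EuclideanSpace ℝ (Fin d))) (ν := ν)).comp
    (measurePreserving_eval (fun _ : Fin n => pointLaw d ν) i)

/-- Empirical averages of powers of the norms of the covariates are bounded in probability. -/
theorem exists_sampleLaw_avg_norm_pow_le (d : ℕ) {δ : ℝ} (hδ : 0 < δ) :
    ∃ C : ℝ, 0 < C ∧ ∀ n : ℕ, ∀ (ν : Measure ℝ) [IsProbabilityMeasure ν],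
      (sampleLaw d n ν).real {S | C < avg fun i => ‖(S i).1‖ ^ 2 + ‖(S i).1‖ ^ 3} ≤ δ := by
  set g : EuclideanSpace ℝ (Fin d) → ℝ := fun x => ‖x‖ ^ 2 + ‖x‖ ^ 3 with hg
  have hg0 : ∀ x, 0 ≤ g x := fun x => by positivity
  have hgm : Continuous g := by fun_prop
  have hgi : Integrable g (stdGaussian (EuclideanSpace ℝ (Fin d))) := by
    have h2 := (IsGaussian.memLp_id (stdGaussian (EuclideanSpace ℝ (Fin d))) 2
      (by norm_num)).integrable_norm_pow (by norm_num)
    have h3 := (IsGaussian.memLp_id (stdGaussian (EuclideanSpace ℝ (Fin d))) 3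
      (by norm_num)).integrable_norm_pow (by norm_num)
    exact h2.add h3
  set G := ∫ x, g x ∂stdGaussian (EuclideanSpace ℝ (Fin d)) with hG
  have hG0 : 0 ≤ G := integral_nonneg hg0
  refine ⟨(G + 1) / δ, by positivity, fun n ν _ => ?_⟩
  have hi : ∀ i : Fin n, Integrable (fun S : Sample d n => g (S i).1) (sampleLaw d n ν) :=
    fun i => (measurePreserving_covariate i).integrable_comp_of_integrable hgi
  have hint : ∀ i : Fin n, ∫ S, g (S i).1 ∂sampleLaw d n ν = G := by
    intro i
    have hmp := measurePreserving_covariate (d := d) (ν := ν) i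
    rw [hG, ← hmp.map_eq, integral_map hmp.measurable.aemeasurable hgm.aestronglyMeasurable]
  have hI : ∫ S, avg (fun i => g (S i).1) ∂sampleLaw d n ν ≤ G := by
    unfold avg
    rw [integral_const_mul, integral_finsetSum _ fun i _ => hi i]
    simp_rw [hint]
    exact avg_const_le hG0
  have hM := mul_meas_ge_le_integral_of_nonneg (μ := sampleLaw d n ν)
    (f := fun S => avg (fun i => g (S i).1))
    (ae_of_all _ fun S => avg_nonneg fun i => hg0 _)
    ((integrable_finsetSum _ fun i _ => hi i).const_mul _) ((G + 1) / δ)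
  have hsub : {S : Sample d n | (G + 1) / δ < avg fun i => g (S i).1}
      ⊆ {S | (G + 1) / δ ≤ avg fun i => g (S i).1} := fun S hS => by
    rw [Set.mem_ofPred_eq] at *; exact hS.le
  have h1 := measureReal_mono (μ := sampleLaw d n ν) hsub
  have h2 := hM.trans hI
  rw [div_mul_eq_mul_div, div_le_iff₀ hδ] at h2
  have h3 : (sampleLaw d n ν).real {S | (G + 1) / δ ≤ avg fun i => g (S i).1} ≤ δ := by
    nlinarith
  exact h1.trans h3

/-- Lipschitz dependence on base point and direction, with a random constant whose average is
controlled by Markov's inequality; needed to pass from nets to compact sets. -/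
theorem abs_noise_form_sub_le (x v v' u c : EuclideanSpace ℝ (Fin d)) {e ς ε : ℝ}
    (he : |e| ≤ ς) (hv : ‖v - v'‖ ≤ ε) (huc : ‖u - c‖ ≤ ε) (hu : ‖u‖ = 1) (hc : ‖c‖ = 1) :
    |e * sigmoidDeriv₂ (inner ℝ x v) * inner ℝ x u ^ 2
      - e * sigmoidDeriv₂ (inner ℝ x v') * inner ℝ x c ^ 2|
      ≤ 2 * ς * ε * (‖x‖ ^ 2 + ‖x‖ ^ 3) := by
  have hς : 0 ≤ ς := (abs_nonneg e).trans he
  have hε : 0 ≤ ε := (norm_nonneg _).trans hv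
  have h1 : |sigmoidDeriv₂ (inner ℝ x v) - sigmoidDeriv₂ (inner ℝ x v')| ≤ ‖x‖ * ε := by
    refine (abs_sigmoidDeriv₂_sub_le _ _).trans ?_
    rw [← inner_sub_right]
    exact (abs_real_inner_le_norm _ _).trans (by gcongr)
  have h2 : |inner ℝ x u ^ 2| ≤ ‖x‖ ^ 2 := by
    rw [abs_pow]
    gcongr
    simpa [hu] using abs_real_inner_le_norm x u
  have h3 : |inner ℝ x u ^ 2 - inner ℝ x c ^ 2| ≤ ‖x‖ * ε * (‖x‖ * 2) := by
    rw [sq_sub_sq, ← inner_sub_right, ← inner_add_right, abs_mul, mul_comm]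
    refine mul_le_mul ((abs_real_inner_le_norm _ _).trans (by gcongr))
      ((abs_real_inner_le_norm _ _).trans ?_) (abs_nonneg _) (by positivity)
    gcongr
    exact (norm_add_le _ _).trans (by rw [hu, hc]; norm_num)
  have e1 : e * sigmoidDeriv₂ (inner ℝ x v) * inner ℝ x u ^ 2
      - e * sigmoidDeriv₂ (inner ℝ x v') * inner ℝ x c ^ 2
      = e * ((sigmoidDeriv₂ (inner ℝ x v) - sigmoidDeriv₂ (inner ℝ x v')) * inner ℝ x u ^ 2
        + sigmoidDeriv₂ (inner ℝ x v') * (inner ℝ x u ^ 2 - inner ℝ x c ^ 2)) := by ring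
  rw [e1, abs_mul]
  have h4 : |(sigmoidDeriv₂ (inner ℝ x v) - sigmoidDeriv₂ (inner ℝ x v')) * inner ℝ x u ^ 2
        + sigmoidDeriv₂ (inner ℝ x v') * (inner ℝ x u ^ 2 - inner ℝ x c ^ 2)|
      ≤ ‖x‖ * ε * ‖x‖ ^ 2 + 1 / 4 * (‖x‖ * ε * (‖x‖ * 2)) := by
    refine (abs_add_le _ _).trans ?_
    rw [abs_mul, abs_mul]
    gcongr
    exact abs_sigmoidDeriv₂_le _
  calc _ ≤ ς * (‖x‖ * ε * ‖x‖ ^ 2 + 1 / 4 * (‖x‖ * ε * (‖x‖ * 2))) := by gcongr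
    _ = ς * ε * (1 / 2 * ‖x‖ ^ 2 + ‖x‖ ^ 3) := by ring
    _ ≤ ς * ε * (2 * (‖x‖ ^ 2 + ‖x‖ ^ 3)) := by
        gcongr
        nlinarith [sq_nonneg ‖x‖, pow_nonneg (norm_nonneg x) 3]
    _ = _ := by ring

/-- In fixed dimension, the noise part of the Hessian is uniformly small on balls for large
sample sizes. -/
theorem exists_sampleLaw_noise_form_le (d : ℕ) (R : ℝ) {θ δ : ℝ} (hθ : 0 < θ) (hδ : 0 < δ) :
    ∃ n₀ : ℕ, ∀ n : ℕ, n₀ ≤ n → ∀ (ν : Measure ℝ) [IsProbabilityMeasure ν] (ς : ℝ), 0 < ς →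
      IsBoundedNoise ν ς →
      (sampleLaw d n ν).real {S | ¬ ∀ v, ‖v‖ ≤ R → ∀ u,
        |avg fun i => (S i).2 * sigmoidDeriv₂ (inner ℝ (S i).1 v) * inner ℝ (S i).1 u ^ 2|
          ≤ θ * ς * ‖u‖ ^ 2} ≤ δ := by
  classical
  obtain ⟨C, hC, hCP⟩ := exists_sampleLaw_avg_norm_pow_le d (half_pos hδ)
  set p := min θ 1 / 2 with hp
  have hp0 : 0 < p := by positivity
  have hp1 : p ≤ 1 := by have := min_le_right θ 1; linarith
  have hpθ : 2 * p ≤ θ := by have := min_le_left θ 1; linarith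
  -- Makes the discretization error `2 ς ε C` equal to `p ς`. Together with the deviation `p ς` on
  -- the nets this stays below `θ ς`. Everything scales with `ς`, so `n₀` depends on neither `ς` nor
  -- `ν`.
  set ε := p / (2 * C) with hε
  have hε0 : 0 < ε := by positivity
  obtain ⟨V, -, hVf, hV⟩ := (isCompact_closedBall (0 : EuclideanSpace ℝ (Fin d))
    R).finite_cover_balls hε0
  obtain ⟨U, hUs, hUf, hU⟩ := (isCompact_sphere (0 : EuclideanSpace ℝ (Fin d))
    1).finite_cover_balls hε0
  set I : Finset (EuclideanSpace ℝ (Fin d) × EuclideanSpace ℝ (Fin d)) :=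
    hVf.toFinset ×ˢ hUf.toFinset with hI
  have hlim : Tendsto (fun n : ℕ => (I.card : ℝ) * (2 * Real.exp (n * -(p ^ 2 / 768))))
      atTop (𝓝 0) := by
    have h1 : Tendsto (fun n : ℕ => (n : ℝ) * -(p ^ 2 / 768)) atTop atBot :=
      tendsto_natCast_atTop_atTop.atTop_mul_const_of_neg (by
        have : 0 < p ^ 2 / 768 := by positivity
        linarith)
    have h2 := (Real.tendsto_exp_atBot.comp h1).const_mul 2 |>.const_mul (I.card : ℝ)
    simpa using h2
  obtain ⟨n₀, hn₀⟩ := eventually_atTop.1 (hlim.eventually (gt_mem_nhds (half_pos hδ)))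
  refine ⟨n₀, fun n hn ν _ ς hς hν => ?_⟩
  set k : ℝ → EuclideanSpace ℝ (Fin d) × EuclideanSpace ℝ (Fin d) →
    EuclideanSpace ℝ (Fin d) × ℝ → ℝ := fun s q ω =>
      s * (ω.2 * sigmoidDeriv₂ (inner ℝ ω.1 q.1) * inner ℝ ω.1 q.2 ^ 2) with hk
  set W : ℝ → EuclideanSpace ℝ (Fin d) × EuclideanSpace ℝ (Fin d) → Set (Sample d n) :=
    fun s q => {S | 0 ≤ ∑ i, p / (384 * ς) * (k s q (S i) - p * ς)} with hW
  have hWle : ∀ s q, |s| = 1 → ‖q.2‖ = 1 →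
      (sampleLaw d n ν).real (W s q) ≤ Real.exp (n * -(p ^ 2 / 768)) := by
    intro s q hs hq
    refine sampleLaw_quadratic_le (ν := ν) ?_ hq hς hp0 hp1 ?_ ?_
    · exact ((measurable_snd.mul (continuous_sigmoidDeriv₂.measurable.comp
        (measurable_inner_fst q.1))).mul ((measurable_inner_fst q.2).pow_const 2)).const_mul s
    · filter_upwards [hν.ae_point] with ω hω
      simp only [hk]
      rw [abs_mul, hs, one_mul, abs_mul, abs_mul, abs_pow, sq_abs]
      have h1 := abs_sigmoidDeriv₂_le (inner ℝ ω.1 q.1)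
      have h2 : |ω.2| * |sigmoidDeriv₂ (inner ℝ ω.1 q.1)| ≤ ς * 1 :=
        mul_le_mul hω (h1.trans (by norm_num)) (abs_nonneg _) hς.le
      rw [mul_one] at h2
      gcongr
    · have := integral_pointLaw_mul (ν := ν) (fun x : EuclideanSpace ℝ (Fin d) =>
        s * (sigmoidDeriv₂ (inner ℝ x q.1) * inner ℝ x q.2 ^ 2)) (fun e => e)
      rw [hν.mean_zero, mul_zero] at this
      rw [← this]
      congr 1; funext ω; simp only [hk]; ring
  have hae : (sampleLaw d n ν).real {S | ¬ ∀ i, |(S i).2| ≤ ς} = 0 := by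
    rw [measureReal_def, ae_iff.1 hν.ae_sample]; rfl
  set Z : Set (Sample d n) := {S | C < avg fun i => ‖(S i).1‖ ^ 2 + ‖(S i).1‖ ^ 3} with hZ
  have hsub : {S : Sample d n | ¬ ∀ v, ‖v‖ ≤ R → ∀ u,
      |avg fun i => (S i).2 * sigmoidDeriv₂ (inner ℝ (S i).1 v) * inner ℝ (S i).1 u ^ 2|
        ≤ θ * ς * ‖u‖ ^ 2} ⊆ ({S | ¬ ∀ i, |(S i).2| ≤ ς} ∪ Z)
        ∪ ⋃ q ∈ I, (W 1 q ∪ W (-1) q) := by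
    intro S hS
    by_contra hcon
    rw [Set.mem_union, not_or, Set.mem_union, not_or] at hcon
    obtain ⟨⟨hc1, hc2⟩, hc3⟩ := hcon
    have hς' : ∀ i, |(S i).2| ≤ ς := not_not.1 hc1
    have hC' : (avg fun i => ‖(S i).1‖ ^ 2 + ‖(S i).1‖ ^ 3) ≤ C := not_lt.1 hc2
    have hnet : ∀ q ∈ I, |avg fun i => (S i).2 * sigmoidDeriv₂ (inner ℝ (S i).1 q.1)
        * inner ℝ (S i).1 q.2 ^ 2| ≤ p * ς := by
      intro q hq
      have hs : ∀ s : ℝ, S ∉ W s q → s * (avg fun i => (S i).2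
          * sigmoidDeriv₂ (inner ℝ (S i).1 q.1) * inner ℝ (S i).1 q.2 ^ 2) ≤ p * ς := by
        intro s hsW
        rw [← avg_const_mul]
        exact sum_le_of_not_nonneg (by positivity) hsW
      have h1 := hs 1 fun h => hc3 (Set.mem_biUnion hq (Or.inl h))
      have h2 := hs (-1) fun h => hc3 (Set.mem_biUnion hq (Or.inr h))
      exact abs_le.2 ⟨by linarith, by linarith⟩
    have hunit : ∀ v, ‖v‖ ≤ R → ∀ u, ‖u‖ = 1 →
        |avg fun i => (S i).2 * sigmoidDeriv₂ (inner ℝ (S i).1 v) * inner ℝ (S i).1 u ^ 2|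
          ≤ θ * ς := by
      intro v hv u hu
      obtain ⟨v', hv', hvv⟩ := Set.mem_iUnion₂.1 (hV (by simpa using hv : v ∈ Metric.closedBall 0 R))
      obtain ⟨c, hc, huc⟩ := Set.mem_iUnion₂.1 (hU (by simpa using hu : u ∈ Metric.sphere 0 1))
      have hc1 : ‖c‖ = 1 := by simpa using hUs hc
      rw [Metric.mem_ball, dist_eq_norm] at hvv huc
      have h1 := hnet (v', c) (Finset.mem_product.2 ⟨by simpa using hv', by simpa using hc⟩)
      simp only at h1
      have h2 : |(avg fun i => (S i).2 * sigmoidDeriv₂ (inner ℝ (S i).1 v)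
            * inner ℝ (S i).1 u ^ 2) - avg fun i => (S i).2
            * sigmoidDeriv₂ (inner ℝ (S i).1 v') * inner ℝ (S i).1 c ^ 2| ≤ p * ς := by
        rw [← avg_sub]
        refine (abs_avg_le _).trans ((avg_mono fun i => abs_noise_form_sub_le (S i).1 v v' u c
          (hς' i) hvv.le huc.le hu hc1).trans ?_)
        rw [avg_const_mul]
        calc _ ≤ 2 * ς * ε * C := by gcongr
          _ = p * ς := by rw [hε]; field_simp
      have h3 := abs_sub_abs_le_abs_sub (avg fun i => (S i).2
        * sigmoidDeriv₂ (inner ℝ (S i).1 v) * inner ℝ (S i).1 u ^ 2) (avg fun i => (S i).2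
            * sigmoidDeriv₂ (inner ℝ (S i).1 v') * inner ℝ (S i).1 c ^ 2)
      nlinarith
    refine hS fun v hv u => ?_
    rcases eq_or_ne u 0 with rfl | hu
    · simp [avg]
    have hu0 : ‖u‖ ≠ 0 := norm_ne_zero_iff.2 hu
    have h1 := hunit v hv _ (norm_inv_norm_smul hu)
    have e : (avg fun i => (S i).2 * sigmoidDeriv₂ (inner ℝ (S i).1 v) * inner ℝ (S i).1 u ^ 2)
        = ‖u‖ ^ 2 * avg fun i => (S i).2 * sigmoidDeriv₂ (inner ℝ (S i).1 v)
          * inner ℝ (S i).1 (‖u‖⁻¹ • u) ^ 2 := by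
      rw [← avg_const_mul]
      congr 1; funext i
      rw [real_inner_smul_right]; field_simp
    rw [e, abs_mul, abs_of_nonneg (sq_nonneg _), mul_comm]
    gcongr
  refine (measureReal_mono hsub (measure_ne_top _ _)).trans ((measureReal_union_le _ _).trans ?_)
  have h1 := measureReal_union_le (μ := sampleLaw d n ν) {S : Sample d n | ¬ ∀ i, |(S i).2| ≤ ς} Z
  rw [hae, zero_add] at h1
  have h2 := hCP n ν
  have h3 : (sampleLaw d n ν).real (⋃ q ∈ I, (W 1 q ∪ W (-1) q))
      ≤ I.card * (2 * Real.exp (n * -(p ^ 2 / 768))) := by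
    refine (measureReal_biUnion_finset_le _ _).trans ?_
    rw [← nsmul_eq_mul]
    refine Finset.sum_le_card_nsmul _ _ _ fun q hq => (measureReal_union_le _ _).trans ?_
    have hq2 : ‖q.2‖ = 1 := by
      have := (Finset.mem_product.1 hq).2
      simpa using hUs (hUf.mem_toFinset.1 this)
    linarith [hWle 1 q (by simp) hq2, hWle (-1) q (by simp) hq2]
  linarith [hn₀ n hn]

end UniformQuadraticForm

/-! ### From the noise Hessian to differences of noise gradients. -/

section MeanValue

variable {E : Type*} [NormedAddCommGroup E] [InnerProductSpace ℝ E] {n : ℕ}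

/-- Polarization. Rescaling `u` and `z` to equal norms first makes the parallelogram law return the
constant `M` without loss. -/
theorem abs_avg_mul_inner_le {x : Fin n → E} {w : Fin n → ℝ} {M : ℝ}
    (h : ∀ u, |avg fun i => w i * inner ℝ (x i) u ^ 2| ≤ M * ‖u‖ ^ 2) (u z : E) :
    |avg fun i => w i * (inner ℝ (x i) u * inner ℝ (x i) z)| ≤ M * (‖u‖ * ‖z‖) := by
  rcases eq_or_ne u 0 with rfl | hu
  · simp [avg]
  rcases eq_or_ne z 0 with rfl | hz
  · simp [avg]
  have hu0 := norm_pos_iff.2 hu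
  have hz0 := norm_pos_iff.2 hz
  set a := ‖z‖ • u with ha
  set b := ‖u‖ • z with hb
  have e : 4 * (‖u‖ * ‖z‖) * (avg fun i => w i * (inner ℝ (x i) u * inner ℝ (x i) z))
      = (avg fun i => w i * inner ℝ (x i) (a + b) ^ 2)
        - avg fun i => w i * inner ℝ (x i) (a - b) ^ 2 := by
    rw [← avg_const_mul, ← avg_sub]
    congr 1; funext i
    rw [inner_add_right, inner_sub_right, ha, hb, real_inner_smul_right, real_inner_smul_right]
    ring
  have hab : ‖a + b‖ ^ 2 + ‖a - b‖ ^ 2 = 4 * (‖u‖ * ‖z‖) ^ 2 := by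
    rw [norm_add_sq_real, norm_sub_sq_real, ha, hb, norm_smul, norm_smul, norm_norm, norm_norm]
    ring
  have h1 := (abs_sub _ _).trans (add_le_add (h (a + b)) (h (a - b)))
  rw [← e, ← mul_add, hab, abs_mul, abs_of_pos (by positivity)] at h1
  have h2 : 0 < 4 * (‖u‖ * ‖z‖) := by positivity
  refine le_of_mul_le_mul_left (h1.trans (le_of_eq ?_)) h2
  ring

/-- The change of the noise part of the gradient is controlled by its derivative. -/
theorem norm_vavg_noise_sub_le {x : Fin n → E} {e : Fin n → ℝ} {M R : ℝ}
    (h : ∀ v, ‖v‖ ≤ R → ∀ u,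
      |avg fun i => e i * sigmoidDeriv₂ (inner ℝ (x i) v) * inner ℝ (x i) u ^ 2| ≤ M * ‖u‖ ^ 2)
    {v u : E} (hvu : ‖v‖ + ‖u‖ ≤ R) :
    ‖vavg (fun i => e i * (sigmoidDeriv (inner ℝ (x i) (v + u))
      - sigmoidDeriv (inner ℝ (x i) v))) x‖ ≤ M * ‖u‖ := by
  set y := vavg (fun i => e i * (sigmoidDeriv (inner ℝ (x i) (v + u))
      - sigmoidDeriv (inner ℝ (x i) v))) x with hy
  set φ : ℝ → ℝ := fun s => avg fun i =>
    e i * sigmoidDeriv (inner ℝ (x i) v + s * inner ℝ (x i) u) * inner ℝ (x i) y with hφ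
  set φ' : ℝ → ℝ := fun s => avg fun i =>
    e i * sigmoidDeriv₂ (inner ℝ (x i) (v + s • u)) * (inner ℝ (x i) u * inner ℝ (x i) y) with hφ'
  have hd : ∀ s, HasDerivAt φ (φ' s) s := by
    intro s
    have h1 : ∀ i, HasDerivAt (fun s => e i * sigmoidDeriv (inner ℝ (x i) v
        + s * inner ℝ (x i) u) * inner ℝ (x i) y)
        (e i * sigmoidDeriv₂ (inner ℝ (x i) (v + s • u))
          * (inner ℝ (x i) u * inner ℝ (x i) y)) s := by
      intro i
      have h2 : HasDerivAt (fun s : ℝ => inner ℝ (x i) v + s * inner ℝ (x i) u)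
          (inner ℝ (x i) u) s := by
        simpa using ((hasDerivAt_id s).mul_const (inner ℝ (x i) u)).const_add (inner ℝ (x i) v)
      have h3 := (((hasDerivAt_sigmoidDeriv _).comp s h2).const_mul (e i)).mul_const
        (inner ℝ (x i) y)
      refine h3.congr_deriv ?_
      rw [inner_add_right, real_inner_smul_right]
      ring
    exact (HasDerivAt.fun_sum (u := Finset.univ) fun i _ => h1 i).const_mul (1 / (n : ℝ))
  -- The vector is tested against itself: `φ 1 - φ 0 = ‖y‖²`, so the scalar mean value theorem
  -- suffices.
  obtain ⟨s, hs, hslope⟩ := exists_hasDerivAt_eq_slope φ φ' zero_lt_one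
    (fun s _ => (hd s).continuousAt.continuousWithinAt) (fun s _ => hd s)
  have e1 : ‖y‖ ^ 2 = φ' s := by
    rw [hslope, sub_zero, div_one, ← real_inner_self_eq_norm_sq]
    conv_lhs => rw [hy, ← hy, inner_vavg]
    rw [hφ]
    simp only
    rw [← avg_sub]
    congr 1; funext i
    rw [inner_add_right]
    ring_nf
  have hsv : ‖v + s • u‖ ≤ R := by
    refine (norm_add_le _ _).trans (le_trans ?_ hvu)
    rw [norm_smul, Real.norm_eq_abs, abs_of_pos hs.1]
    gcongr
    exact mul_le_of_le_one_left (norm_nonneg _) hs.2.le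
  have h2 := abs_avg_mul_inner_le (h _ hsv) u y
  have h3 : ‖y‖ ^ 2 ≤ M * (‖u‖ * ‖y‖) := by
    rw [e1]; exact (le_abs_self _).trans h2
  rcases eq_or_lt_of_le (norm_nonneg y) with h4 | h4
  · rw [← h4]
    have := h v (by linarith [norm_nonneg u]) u
    rcases eq_or_ne u 0 with rfl | hu
    · simp
    have hu0 := norm_pos_iff.2 hu
    have h5 : 0 ≤ M * ‖u‖ ^ 2 := (abs_nonneg _).trans this
    have h6 : 0 ≤ M := nonneg_of_mul_nonneg_left h5 (by positivity)
    positivity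
  · nlinarith

end MeanValue

/-! ### Geometric convergence at temperature one. -/

section FinalPhase

variable {d n : ℕ} {inv : ℝ → ℝ} {wStar w₀ : EuclideanSpace ℝ (Fin d)} {τ₀ : ℝ} {β η : ℕ → ℝ}
  {S : Sample d n}

theorem norm_gold_le (hw : ‖wStar‖ ≤ 1) : ‖(1 / √(d : ℝ)) • wStar‖ ≤ 1 / √(d : ℝ) := by
  rw [norm_smul, Real.norm_eq_abs, abs_of_nonneg (by positivity)]
  exact mul_le_of_le_one_right (by positivity) hw

theorem one_div_sqrt_le_one (hd : 1 ≤ d) : 1 / √(d : ℝ) ≤ 1 := by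
  have : (1 : ℝ) ≤ √(d : ℝ) := Real.one_le_sqrt.2 (by exact_mod_cast hd)
  exact div_le_one_of_le₀ this (by positivity)

theorem postLabel_eq (i : Fin n) : postLabel wStar S i
    = Real.sigmoid (inner ℝ (S i).1 ((1 / √(d : ℝ)) • wStar)) + (S i).2 := by
  unfold postLabel; rw [inner_covariate]

theorem scaledError_succ_of_temperature_eq_one (hd : 1 ≤ d) {t : ℕ}
    (hτ : temperature τ₀ β t = 1) :
    scaledError inv wStar w₀ τ₀ β η S (t + 1) = scaledError inv wStar w₀ τ₀ β η S t
      - (2 * (η t * temperature τ₀ β t ^ 2 / d)) • stepDir (fun i => (S i).1) 1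
        (fun i => Real.sigmoid (inner ℝ (S i).1 ((1 / √(d : ℝ)) • wStar)) + (S i).2)
        ((1 / √(d : ℝ)) • wStar + scaledError inv wStar w₀ τ₀ β η S t) := by
  rw [scaledError_succ hd (by rw [hτ]; exact one_pos), hτ]
  simp only [gradLabel, if_true, postLabel_eq]

/-- Geometric convergence to the noise level once the temperature is `1`. -/
theorem scaledError_le_of_temperature_eq_one (hd : 1 ≤ d) {T₀ : ℕ} {κ B R h θ r D : ℝ}
    (hx : WellConditioned fun i => (S i).1)
    (hτ : ∀ t, T₀ ≤ t → temperature τ₀ β t = 1) (hκ : 0 < κ)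
    (hρ : ∀ t, κ ≤ η t * temperature τ₀ β t ^ 2 / d ∧ η t * temperature τ₀ β t ^ 2 / d ≤ 2)
    (hB : 0 < B) (hh : h ≤ sigmoidDeriv (B + 10 / 3 * R) ^ 2
      * (61 / 100 - 125 / 9 * (‖(1 / √(d : ℝ)) • wStar‖ / B) ^ 2)) (hh1 : h ≤ 1 / 3)
    (hr : 0 < r) (hr1 : 2 * r ≤ 1) (hrh : r ≤ 3 / 2 * h - 2 * θ)
    (hD : ‖vavg (fun i => (S i).2 * sigmoidDeriv (inner ℝ (S i).1 ((1 / √(d : ℝ)) • wStar)))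
      fun i => (S i).1‖ ≤ D) (hDR : 2 * D ≤ r * R)
    (hθ : ∀ u, ‖u‖ ≤ R → ‖vavg (fun i => (S i).2
      * (sigmoidDeriv (inner ℝ (S i).1 ((1 / √(d : ℝ)) • wStar + u))
      - sigmoidDeriv (inner ℝ (S i).1 ((1 / √(d : ℝ)) • wStar)))) fun i => (S i).1‖ ≤ θ * ‖u‖)
    (h0 : ‖scaledError inv wStar w₀ τ₀ β η S T₀‖ ≤ R) {T : ℕ} (hT : T₀ ≤ T) :
    ‖scaledError inv wStar w₀ τ₀ β η S T‖
      ≤ (1 - κ * r) ^ (T - T₀) * ‖scaledError inv wStar w₀ τ₀ β η S T₀‖ + 2 * D / r := by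
  have hD0 : 0 ≤ D := (norm_nonneg _).trans hD
  have key := perturbed_contraction
    (X := fun t => ‖scaledError inv wStar w₀ τ₀ β η S (T₀ + t)‖)
    (ρ := fun t => η (T₀ + t) * temperature τ₀ β (T₀ + t) ^ 2 / d) (fun t => norm_nonneg _) hκ
    (fun t => (hρ _).1) (fun t => (hρ _).2) hr hr1 hD0 hDR h0 (fun t ht => by
      have hρ0 := hκ.le.trans (hρ (T₀ + t)).1
      rw [← add_assoc, scaledError_succ_of_temperature_eq_one hd (hτ _ (Nat.le_add_right _ _))]
      refine (hx.norm_step_le_of_noise _ _ hρ0 (hρ _).2 hB ht hh hh1 hD (hθ _ ht)).trans ?_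
      gcongr) (T - T₀)
  simp only [Nat.add_sub_cancel' hT, add_zero] at key
  exact key.2

end FinalPhase

/-! ### Recovery in fixed dimension and consistency. -/

section FixedDimension

variable {d n : ℕ} {inv : ℝ → ℝ} {wStar w₀ : EuclideanSpace ℝ (Fin d)} {τ₀ : ℝ} {β η : ℕ → ℝ}
  {S : Sample d n} {t₀ b κ : ℝ}

/-- The iterates move by a bounded amount in each step. -/
theorem norm_scaledError_le_linear (hd : 1 ≤ d) (hx : WellConditioned fun i => (S i).1)
    (he : ∀ i, |(S i).2| ≤ 1) (ht : 0 < t₀) (hb : 1 < b) (hκ : 0 < κ)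
    (had : Admissible d t₀ b κ τ₀ β η) (hw : ‖wStar‖ ≤ 1) (hw₀ : ‖w₀‖ ≤ 1) (t : ℕ) :
    ‖scaledError inv wStar w₀ τ₀ β η S t‖ ≤ 2 + t * (3 / t₀) := by
  induction t with
  | zero =>
    refine (norm_scaledError_zero_le hd hw hw₀).trans ?_
    have := one_div_sqrt_le_one hd
    simp only [Nat.cast_zero, zero_mul, add_zero]
    linarith
  | succ t ih =>
    have hτ := had.temperature_ge ht hb t
    have hρ := had.rate_bounds ht hb hd t
    rw [scaledError_succ hd (ht.trans_le hτ)]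
    refine (hx.norm_step_le_bounded _ _ ht hτ (hκ.le.trans hρ.1) hρ.2 fun i => ?_).trans ?_
    · have h1 : ∀ a, 0 < gradSigmoid (temperature τ₀ β t) a := fun a => Real.sigmoid_pos _
      have h2 : ∀ a, gradSigmoid (temperature τ₀ β t) a < 1 := fun a => Real.sigmoid_lt_one _
      have he' := abs_le.1 (he i)
      unfold gradLabel
      split_ifs with h
      · rw [postLabel_eq, abs_le]
        have h3 := Real.sigmoid_pos (inner ℝ (S i).1 ((1 / √(d : ℝ)) • wStar))
        have h4 := Real.sigmoid_lt_one (inner ℝ (S i).1 ((1 / √(d : ℝ)) • wStar))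
        constructor <;> linarith [h1 (inner ℝ (S i).1 ((1 / √(d : ℝ)) • wStar
          + scaledError inv wStar w₀ τ₀ β η S t)), h2 (inner ℝ (S i).1 ((1 / √(d : ℝ)) • wStar
          + scaledError inv wStar w₀ τ₀ β η S t))]
      · rw [abs_le]
        constructor <;> linarith [h1 (inner ℝ (S i).1 ((1 / √(d : ℝ)) • wStar
          + scaledError inv wStar w₀ τ₀ β η S t)), h2 (inner ℝ (S i).1 ((1 / √(d : ℝ)) • wStar
          + scaledError inv wStar w₀ τ₀ β η S t)), h1 (inv (postLabel wStar S i)),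
          h2 (inv (postLabel wStar S i))]
    · push_cast
      linarith

set_option maxHeartbeats 800000 in
/-- Recovery in fixed dimension with a prescribed confidence. -/
theorem exists_recovery_fixed_dimension (d : ℕ) (hd : 1 ≤ d) (δ t₀ b κ : ℝ) (hδ : 0 < δ)
    (ht : 0 < t₀) (hb : 1 < b) (hκ : 0 < κ) :
    ∃ A C : ℝ, ∃ n₀ : ℕ, 0 < A ∧ 0 < C ∧
      ∀ n : ℕ, n₀ ≤ n →
      ∀ inv : ℝ → ℝ, Function.LeftInverse inv Real.sigmoid →
      ∀ (ν : Measure ℝ) (ς : ℝ), 0 < ς → IsBoundedNoise ν ς → 1 ≤ tauMax d ς →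
      ∀ (wStar w₀ : EuclideanSpace ℝ (Fin d)), ‖wStar‖ ≤ 1 → ‖w₀‖ ≤ 1 →
      ∀ (τ₀ : ℝ) (β η : ℕ → ℝ), Admissible d t₀ b κ τ₀ β η →
        (sampleLaw d n ν).real {S | ¬ ∀ ε : ℝ, 0 < ε → ∀ T : ℕ,
            A * max 1 (Real.log (1 / ε)) ≤ T →
            recoveryError inv wStar w₀ τ₀ β η S T ≤ C * (ς * √(d / n) + ε)} ≤ δ := by
  have hd' : (0 : ℝ) < d := by exact_mod_cast hd
  obtain ⟨T₀, hT₀⟩ := exists_temperature_eq_one ht hb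
  set R : ℝ := 2 + T₀ * (3 / t₀) with hR
  have hR0 : 0 < R := by positivity
  set s := sigmoidDeriv (12 + 10 / 3 * R) with hs
  have hs0 : 0 < s := sigmoidDeriv_pos _
  have hs1 : s ≤ 1 / 4 := sigmoidDeriv_le _
  -- With `B = 12` and `‖v‖ ≤ 1` the factor `61/100 - 125/9 · (1/12)²` exceeds `1/2`.
  set h := s ^ 2 * (1 / 2) with hh
  have hh0 : 0 < h := by positivity
  have hh1 : h ≤ 1 / 32 := by nlinarith
  set κ' := min κ 2 with hκ'
  have hκ0 : 0 < κ' := lt_min hκ two_pos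
  have hκ2 : κ' ≤ 2 := min_le_right _ _
  have hκh : κ' * h ≤ 1 := by nlinarith
  obtain ⟨A, hA, hAT⟩ := exists_steps_geometric (a := κ' * h) (by positivity) hκh R T₀
  -- Chosen so that the failure probability `5^d e^{-(K-1)d/2}` of the gradient noise bound is at
  -- most `δ/4`.
  set L := max 0 (Real.log (4 * 5 ^ d / δ)) with hL
  set K := 1 + 2 * L / d with hK
  have hL0 : 0 ≤ L := le_max_left _ _
  have hK0 : 0 ≤ K := by positivity
  have hKP : 5 ^ d * Real.exp (-((K - 1) * d / 2)) ≤ δ / 4 := by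
    have e : (K - 1) * d / 2 = L := by rw [hK]; field_simp; ring
    have h1 : Real.exp (-L) ≤ (4 * 5 ^ d / δ)⁻¹ := by
      rw [← Real.exp_log (by positivity : 0 < 4 * 5 ^ d / δ), ← Real.exp_neg, Real.exp_le_exp]
      exact neg_le_neg (le_max_right _ _)
    rw [e]
    calc _ ≤ 5 ^ d * (4 * 5 ^ d / δ)⁻¹ := by gcongr
      _ = δ / 4 := by field_simp
  obtain ⟨n₁, hn₁⟩ := exists_sampleLaw_noise_form_le d (1 + R) hh0 (by positivity : 0 < δ / 4)
  have hlim : Tendsto (fun n : ℕ => 5 ^ (d * 11) * (2 * Real.exp (n * -(18 / 1000000))))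
      atTop (𝓝 0) := by
    have h1 : Tendsto (fun n : ℕ => (n : ℝ) * -(18 / 1000000)) atTop atBot :=
      tendsto_natCast_atTop_atTop.atTop_mul_const_of_neg (by norm_num)
    have h2 := (Real.tendsto_exp_atBot.comp h1).const_mul 2 |>.const_mul ((5 : ℝ) ^ (d * 11))
    simpa using h2
  have hlim2 : Tendsto (fun n : ℕ => 2 * (3 * K * √((d : ℝ) / n))) atTop (𝓝 0) := by
    have h1 : Tendsto (fun n : ℕ => (d : ℝ) / n) atTop (𝓝 0) :=
      tendsto_const_div_atTop_nhds_zero_nat _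
    have h2 := ((Real.continuous_sqrt.tendsto 0).comp h1).const_mul (3 * K) |>.const_mul 2
    simpa using h2
  obtain ⟨n₂, hn₂⟩ := eventually_atTop.1
    ((hlim.eventually (gt_mem_nhds (by positivity : 0 < δ / 4))).and
      ((hlim2.eventually (gt_mem_nhds (by positivity : 0 < h * R))).and
        (eventually_ge_atTop d)))
  refine ⟨A, √d * (1 + 6 * K / h), max n₁ n₂, hA, by positivity, ?_⟩
  intro n hn inv hinv ν ς hς hν hτ wStar w₀ hw hw₀ τ₀ β η had
  have := hν.isProb
  obtain ⟨hWC, hDR, hdn⟩ := hn₂ n ((le_max_right _ _).trans hn)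
  have hNF := hn₁ n ((le_max_left _ _).trans hn) ν ς hς hν
  have hςle := noise_width_le hς hτ
  have hhς : h * ς ≤ h / 4 := by nlinarith
  set v := (1 / √(d : ℝ)) • wStar with hv
  have hv1 : ‖v‖ ≤ 1 := (norm_gold_le hw).trans (one_div_sqrt_le_one hd)
  have hE := sampleLaw_norm_vavg_noise_le (n := n) hd hdn hς hν v hK0
  have hae : (sampleLaw d n ν).real {S | ¬ ∀ i, |(S i).2| ≤ ς} = 0 := by
    rw [measureReal_def, ae_iff.1 hν.ae_sample]; rfl
  have hWC' := sampleLaw_not_wellConditioned_le d n ν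
  set E₁ : Set (Sample d n) := {S | ¬ ∀ i, |(S i).2| ≤ ς} with hE₁
  set E₂ : Set (Sample d n) := {S | ¬ WellConditioned fun i => (S i).1} with hE₂
  set E₃ : Set (Sample d n) := {S | 3 * K * ς * √(d / n)
    < ‖vavg (fun i => (S i).2 * sigmoidDeriv (inner ℝ (S i).1 v)) fun i => (S i).1‖} with hE₃
  set E₄ : Set (Sample d n) := {S | ¬ ∀ v, ‖v‖ ≤ 1 + R → ∀ u,
        |avg fun i => (S i).2 * sigmoidDeriv₂ (inner ℝ (S i).1 v) * inner ℝ (S i).1 u ^ 2|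
          ≤ h * ς * ‖u‖ ^ 2} with hE₄
  have hsub : {S : Sample d n | ¬ ∀ ε : ℝ, 0 < ε → ∀ T : ℕ,
            A * max 1 (Real.log (1 / ε)) ≤ T →
            recoveryError inv wStar w₀ τ₀ β η S T
              ≤ √d * (1 + 6 * K / h) * (ς * √(d / n) + ε)} ⊆ (E₁ ∪ E₂) ∪ (E₃ ∪ E₄) := by
    intro S hS
    by_contra hcon
    simp only [Set.mem_union, not_or] at hcon
    obtain ⟨⟨c1, c2⟩, c3, c4⟩ := hcon
    have he : ∀ i, |(S i).2| ≤ ς := not_not.1 c1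
    have hx : WellConditioned fun i => (S i).1 := not_not.1 c2
    have hD : ‖vavg (fun i => (S i).2 * sigmoidDeriv (inner ℝ (S i).1 v)) fun i => (S i).1‖
        ≤ 3 * K * ς * √(d / n) := not_lt.1 c3
    have hQ := not_not.1 c4
    refine hS fun ε hε T hT => ?_
    obtain ⟨hT0, -, hq⟩ := hAT ε hε T hT
    have hu0 := norm_scaledError_le_linear (inv := inv) hd hx
      (fun i => (he i).trans (by linarith)) ht hb hκ had hw hw₀ T₀
    -- Since `h ς ≤ h/4`, taking `θ = h/4` leaves exactly the rate `r = 3/2 h - 2θ = h`.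
    have hmain := scaledError_le_of_temperature_eq_one (inv := inv) (w₀ := w₀) hd hx
      (hT₀ d κ τ₀ β η had)
      hκ0 (fun t => ⟨(min_le_left _ _).trans (had.rate_bounds ht hb hd t).1,
        (had.rate_bounds ht hb hd t).2⟩) (B := 12) (R := R) (h := h) (θ := h / 4) (r := h)
      (by norm_num) (by
        rw [hh]
        gcongr
        have : (‖v‖ / 12) ^ 2 ≤ (1 / 12) ^ 2 := by gcongr
        linarith) (by linarith) hh0 (by linarith) (by linarith) hD (by
          refine le_trans ?_ hDR.le
          have : 3 * K * ς * √(d / n) ≤ 3 * K * 1 * √(d / n) := by gcongr; linarith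
          linarith) (fun u hu => by
          refine (norm_vavg_noise_sub_le hQ (by linarith)).trans ?_
          gcongr) hu0 hT0
    rw [recoveryError_eq hd, mul_assoc]
    gcongr
    refine hmain.trans ?_
    have hp : 0 ≤ (1 - κ' * h) ^ (T - T₀) := pow_nonneg (sub_nonneg.2 hκh) _
    have h1 : (1 - κ' * h) ^ (T - T₀) * ‖scaledError inv wStar w₀ τ₀ β η S T₀‖ ≤ ε :=
      (mul_le_mul_of_nonneg_left hu0 hp).trans (by rw [mul_comm]; exact hq)
    have e : 2 * (3 * K * ς * √(d / n)) / h = 6 * K / h * (ς * √(d / n)) := by ring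
    have h2 : 0 ≤ 6 * K / h * ε := by positivity
    have h3 : 0 ≤ ς * √(d / n) := by positivity
    rw [e]
    linarith
  refine (measureReal_mono hsub (measure_ne_top _ _)).trans ((measureReal_union_le _ _).trans ?_)
  linarith [measureReal_union_le (μ := sampleLaw d n ν) E₁ E₂,
    measureReal_union_le (μ := sampleLaw d n ν) E₃ E₄]

/-- Consistency of AGGLIO in fixed dimension. -/
theorem tendsto_recoveryError (d : ℕ) (hd : 1 ≤ d) (t₀ b κ : ℝ) (ht : 0 < t₀) (hb : 1 < b)
    (hκ : 0 < κ) (inv : ℝ → ℝ) (hinv : Function.LeftInverse inv Real.sigmoid) (ν : Measure ℝ)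
    (ς : ℝ) (hς : 0 < ς) (hν : IsBoundedNoise ν ς) (hτ : 1 ≤ tauMax d ς)
    (wStar w₀ : EuclideanSpace ℝ (Fin d)) (hw : ‖wStar‖ ≤ 1) (hw₀ : ‖w₀‖ ≤ 1) (τ₀ : ℝ)
    (β η : ℕ → ℝ) (had : Admissible d t₀ b κ τ₀ β η) (T : ℕ → ℕ) (hT : Tendsto T atTop atTop)
    (δ : ℝ) (hδ : 0 < δ) :
    Tendsto (fun n : ℕ => (sampleLaw d n ν).real
      {S | δ ≤ recoveryError inv wStar w₀ τ₀ β η S (T n)}) atTop (𝓝 0) := by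
  have := hν.isProb
  rw [tendsto_order]
  refine ⟨fun a ha => Eventually.of_forall fun n => ha.trans_le measureReal_nonneg,
    fun p hp => ?_⟩
  obtain ⟨A, C, n₀, hA, hC, H⟩ :=
    exists_recovery_fixed_dimension d hd (p / 2) t₀ b κ (half_pos hp) ht hb hκ
  -- The noise term is eventually below `δ/2` and `C ε = δ/4`, so together they stay below `δ`.
  set ε := δ / (4 * C) with hε
  have hε0 : 0 < ε := by positivity
  have hlim : Tendsto (fun n : ℕ => C * (ς * √((d : ℝ) / n))) atTop (𝓝 0) := by
    have h1 : Tendsto (fun n : ℕ => (d : ℝ) / n) atTop (𝓝 0) :=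
      tendsto_const_div_atTop_nhds_zero_nat _
    have h2 := ((Real.continuous_sqrt.tendsto 0).comp h1).const_mul ς |>.const_mul C
    simpa using h2
  filter_upwards [eventually_ge_atTop n₀, hlim.eventually (gt_mem_nhds (half_pos hδ)),
    (tendsto_natCast_atTop_atTop.comp hT).eventually_ge_atTop
      (A * max 1 (Real.log (1 / ε)))] with n hn h1 h2
  refine lt_of_le_of_lt (measureReal_mono (fun S hS => ?_) (measure_ne_top _ _)) (lt_of_le_of_lt
    (H n hn inv hinv ν ς hς hν hτ wStar w₀ hw hw₀ τ₀ β η had) (half_lt_self hp))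
  intro hall
  have h3 := hall ε hε0 (T n) h2
  have h4 : δ ≤ recoveryError inv wStar w₀ τ₀ β η S (T n) := hS
  have h5 : C * ε = δ / 4 := by rw [hε]; field_simp
  linarith

end FixedDimension

/-! ### Logits of the noisy labels. -/

section Labels

variable {d n : ℕ} {inv : ℝ → ℝ} {wStar : EuclideanSpace ℝ (Fin d)} {S : Sample d n} {ς : ℝ}

theorem sqrt_two_le : √2 ≤ (1415 / 1000 : ℝ) := by
  rw [Real.sqrt_le_left (by norm_num)]; norm_num

/-- For moderate pre-activations the label is a value of the sigmoid, at a point close to the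
pre-activation. -/
theorem exists_label_logit {a e : ℝ} (ha : |a| ≤ √2) (he : |e| ≤ 4 / 130) :
    ∃ l, Real.sigmoid l = Real.sigmoid a + e ∧ |l - a| ≤ 32 / 100 ∧
      (|a| ≤ 1 / 10 → |l - a| ≤ 1 / 8) ∧ |l - halfLogit e| ≤ 3 * |a| := by
  have h1 := abs_sigmoid_sub_half_le a
  have h2 : |Real.sigmoid a - 1 / 2| ≤ 354 / 1000 := by linarith [sqrt_two_le]
  obtain ⟨h3, h4⟩ := abs_le.1 h2
  obtain ⟨h5, h6⟩ := abs_le.1 he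
  obtain ⟨l, hl⟩ := exists_sigmoid_eq (y := Real.sigmoid a + e) (by linarith) (by linarith)
  have h7 : |Real.sigmoid l - 1 / 2| ≤ 39 / 100 := by
    rw [hl, abs_le]; constructor <;> linarith
  have h8 : Real.sigmoid l - Real.sigmoid a = e := by rw [hl]; ring
  have h9 := sigmoid_halfLogit (e := e) (by linarith)
  refine ⟨l, hl, ?_, fun ha' => ?_, ?_⟩
  · have := abs_sub_le_of_sigmoid_near_half h7 (h2.trans (by norm_num))
    rw [h8] at this
    norm_num at this ⊢
    linarith
  · have h10 : |Real.sigmoid a - 1 / 2| ≤ 25 / 1000 := by linarith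
    have h11 : |Real.sigmoid l - 1 / 2| ≤ 56 / 1000 := by
      rw [hl, abs_le]
      obtain ⟨h12, h13⟩ := abs_le.1 h10
      constructor <;> linarith
    have := abs_sub_le_of_sigmoid_near_half h11 (h10.trans (by norm_num))
    rw [h8] at this
    norm_num at this ⊢
    linarith
  · have h10 : |Real.sigmoid (halfLogit e) - 1 / 2| ≤ 39 / 100 := by
      rw [h9, add_sub_cancel_left]; linarith
    have := abs_sub_le_of_sigmoid_near_half h7 h10
    rw [hl, h9, show Real.sigmoid a + e - (1 / 2 + e) = Real.sigmoid a - 1 / 2 by ring] at this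
    norm_num at this h1 ⊢
    linarith [abs_nonneg a]

theorem abs_graduated_halfLogit_le {τ e ς : ℝ} (hτ : 0 < τ) (hς : ς ≤ 4 / 130) (he : |e| ≤ ς) :
    |1 / τ * (gradSigmoid τ (halfLogit e) - 1 / 2)| ≤ 5 / 4 * ς := by
  have half : gradSigmoid τ 0 = 1 / 2 := by
    unfold gradSigmoid; rw [mul_zero, Real.sigmoid_zero]; norm_num
  have h1 := abs_halfLogit_le (he.trans hς)
  rw [← half, abs_mul, abs_of_pos (by positivity)]
  calc _ ≤ 1 / τ * (τ * |halfLogit e - 0| / 4) := by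
        gcongr; exact abs_gradSigmoid_sub_le hτ.le _ _
    _ = |halfLogit e| / 4 := by rw [sub_zero]; field_simp
    _ ≤ _ := by linarith

theorem measurable_graduated_halfLogit (τ : ℝ) :
    Measurable fun e => 1 / τ * (gradSigmoid τ (halfLogit e) - 1 / 2) := by
  have h1 := measurable_halfLogit
  have h2 := continuous_sigmoid.measurable
  unfold gradSigmoid
  fun_prop

/-- Logit errors above `1/8` occur only where `|⟨x, v⟩| > 1/10`, and Markov's inequality charges
these points to the second moment in direction `v`. -/
theorem avg_label_shift_sq_le {E : Type*} [NormedAddCommGroup E] [InnerProductSpace ℝ E]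
    {x : Fin n → E} (hx : WellConditioned x) {v : E} {δ : Fin n → ℝ}
    (h1 : ∀ i, |δ i| ≤ 32 / 100) (h2 : ∀ i, |inner ℝ (x i) v| ≤ 1 / 10 → |δ i| ≤ 1 / 8) :
    (avg fun i => δ i ^ 2) ≤ 1 / 64 + 13 * ‖v‖ ^ 2 := by
  have key : ∀ i, δ i ^ 2 ≤ 1 / 64 + 1024 / 100 * inner ℝ (x i) v ^ 2 := by
    intro i
    rw [← sq_abs (δ i), ← sq_abs (inner ℝ (x i) v)]
    by_cases h : |inner ℝ (x i) v| ≤ 1 / 10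
    · nlinarith [h2 i h, abs_nonneg (δ i), sq_nonneg |inner ℝ (x i) v|]
    · nlinarith [h1 i, abs_nonneg (δ i), not_le.1 h]
  refine (avg_mono key).trans ?_
  rw [avg_add, avg_const_mul]
  have h3 := avg_const_le (n := n) (a := 1 / 64) (by norm_num)
  nlinarith [hx.upper v, sq_nonneg ‖v‖]

end Labels

/-! ### Recovery with universal constants in high dimension. -/

section Dimension

variable {d n : ℕ} {inv : ℝ → ℝ} {wStar w₀ : EuclideanSpace ℝ (Fin d)} {τ₀ : ℝ} {β η : ℕ → ℝ}
  {S : Sample d n} {t₀ b κ ς : ℝ}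

/-- The curvature on the ball of radius `3/10`: there the truncated pre-activations are at most
`1/10 + 1 = 1.1`, where `σ' ≥ 0.174`. -/
theorem weight_lower_bound {v : EuclideanSpace ℝ (Fin d)} (hv : ‖v‖ ≤ 1 / 1000) :
    18 / 1000 ≤ sigmoidDeriv (1 / 10 + 10 / 3 * (3 / 10)) ^ 2
      * (61 / 100 - 125 / 9 * (‖v‖ / (1 / 10)) ^ 2) := by
  have h1 : 174 / 1000 ≤ sigmoidDeriv (1 / 10 + 10 / 3 * (3 / 10)) :=
    le_trans (by norm_num) (le_sigmoidDeriv _)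
  have h2 : (174 / 1000 : ℝ) ^ 2 ≤ sigmoidDeriv (1 / 10 + 10 / 3 * (3 / 10)) ^ 2 := by gcongr
  have h3 : (‖v‖ / (1 / 10)) ^ 2 ≤ (1 / 1000 / (1 / 10)) ^ 2 := by gcongr
  calc (18 / 1000 : ℝ) ≤ (174 / 1000) ^ 2 * (61 / 100 - 125 / 9 * (1 / 1000 / (1 / 10)) ^ 2) := by
        norm_num
    _ ≤ _ := mul_le_mul h2 (by linarith) (by norm_num) (by positivity)

/-- The burn-in phase in high dimension: the iterates stay in a ball of fixed scaled radius, and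
their distance grows at most geometrically from the noise level. -/
theorem scaledError_burn_in (hd : 1 ≤ d) (hd2 : 1 / √(d : ℝ) ≤ 1 / 1000)
    (hx : WellConditioned fun i => (S i).1) (hinv : Function.LeftInverse inv Real.sigmoid)
    (hς : ς ≤ 4 / 130) (he : ∀ i, |(S i).2| ≤ ς)
    (ha : ∀ i, |inner ℝ (S i).1 ((1 / √(d : ℝ)) • wStar)| ≤ √2)
    (ht : 0 < t₀) (hb : 1 < b) (hκ : 0 < κ) (had : Admissible d t₀ b κ τ₀ β η)
    (hw : ‖wStar‖ ≤ 1) (hw₀ : ‖w₀‖ ≤ 1) {T₀ : ℕ} {D : ℝ} (hD0 : 0 ≤ D)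
    (hD : ∀ t < T₀, ‖vavg (fun i => 1 / temperature τ₀ β t
      * (gradSigmoid (temperature τ₀ β t) (halfLogit (S i).2) - 1 / 2))
        fun i => (S i).1‖ ≤ D) (t : ℕ) (htT : t ≤ T₀) :
    ‖scaledError inv wStar w₀ τ₀ β η S t‖ ≤ 3 / 10 ∧
      ‖scaledError inv wStar w₀ τ₀ β η S t‖ ≤ 2 ^ t * (6 * (1 / √(d : ℝ)) + D) := by
  set v := (1 / √(d : ℝ)) • wStar with hv
  have hvd : ‖v‖ ≤ 1 / √(d : ℝ) := norm_gold_le hw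
  have hv1 : ‖v‖ ≤ 1 / 1000 := hvd.trans hd2
  have hsq : 0 ≤ 1 / √(d : ℝ) := by positivity
  choose l hl hl1 hl2 hl3 using fun i => exists_label_logit (ha i) ((he i).trans hς)
  have hlab : ∀ τ i, gradLabel inv τ (postLabel wStar S i) = gradSigmoid τ (l i) := by
    intro τ i
    rw [postLabel_eq, ← hv, ← hl, gradLabel_sigmoid hinv]
  -- The recursion `X ↦ 2X + 4/√d + D` doubles the quantity `X + (4/√d + D)`.
  suffices h : ‖scaledError inv wStar w₀ τ₀ β η S t‖ ≤ 3 / 10 ∧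
      ‖scaledError inv wStar w₀ τ₀ β η S t‖ + (4 * (1 / √(d : ℝ)) + D)
        ≤ 2 ^ t * (6 * (1 / √(d : ℝ)) + D) from ⟨h.1, by linarith [h.2]⟩
  induction t with
  | zero =>
    have := norm_scaledError_zero_le (inv := inv) (τ₀ := τ₀) (β := β) (η := η) (S := S) hd hw hw₀
    constructor
    · linarith
    · rw [pow_zero]; linarith
  | succ t ih =>
    obtain ⟨ih1, ih2⟩ := ih (Nat.le_of_succ_le htT)
    have hτ0 := ht.trans_le (had.temperature_ge ht hb t)
    have hτ1 := (had.temperature_bounds ht hb t).2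
    have hρ := had.rate_bounds ht hb hd t
    have hρ0 := hκ.le.trans hρ.1
    rw [scaledError_succ hd hτ0]
    simp_rw [hlab, ← hv]
    constructor
    · refine hx.norm_step_le_of_shift _ v (B := 1 / 10) (h := 18 / 1000)
        (δ := fun i => l i - inner ℝ (S i).1 v) hτ0 hτ1 hρ0 hρ.2 (by norm_num) ih1
        (fun i => by simp) (fun i hi => (hl1 i).trans (by norm_num)) (weight_lower_bound hv1)
        (by norm_num) ?_
      -- The bias is about `1/16 · 1/64 < 0.001`, below `h R² = 0.018 · 0.09`, so the ball is
      -- invariant.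
      have := avg_label_shift_sq_le hx hl1 hl2
      have h2 : ‖v‖ ^ 2 ≤ (1 / 1000) ^ 2 := by gcongr
      norm_num at h2 ⊢
      linarith
    · have h1 := hx.norm_step_le_growth (scaledError inv wStar w₀ τ₀ β η S t) v (L := l)
        (L₀ := fun i => halfLogit (S i).2) (C := 3) hτ0 hτ1 hρ0 hρ.2 (by norm_num) hl3
        (fun i => (abs_halfLogit_le ((he i).trans hς)).trans (by linarith [he i]))
        (hD t htT)
      rw [pow_succ 2 t]
      linarith

theorem five_pow_mul_exp_le (d : ℕ) : 5 ^ d * Real.exp (-(3 * d)) ≤ Real.exp (-d) := by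
  have h1 : (5 : ℝ) ≤ Real.exp 2 := by
    refine le_trans ?_ (Real.quadratic_le_exp_of_nonneg (by norm_num))
    norm_num
  calc _ ≤ Real.exp 2 ^ d * Real.exp (-(3 * d)) := by gcongr
    _ = _ := by rw [← Real.exp_nat_mul, ← Real.exp_add]; congr 1; ring

/-- The net costs at most `e^{22d}` and the deviation gains at least `e^{36d}`. -/
theorem wellConditioned_probability_le {x : ℝ} (h : 2000000 * (d : ℝ) ≤ x) :
    5 ^ (d * 11) * (2 * Real.exp (x * -(18 / 1000000))) ≤ 2 * Real.exp (-d) := by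
  have h1 : (5 : ℝ) ≤ Real.exp 2 := by
    refine le_trans ?_ (Real.quadratic_le_exp_of_nonneg (by norm_num))
    norm_num
  calc _ ≤ Real.exp 2 ^ (d * 11) * (2 * Real.exp (x * -(18 / 1000000))) := by gcongr
    _ = 2 * Real.exp (22 * d + x * -(18 / 1000000)) := by
        rw [← Real.exp_nat_mul, Real.exp_add]; push_cast; ring_nf
    _ ≤ _ := by
        gcongr
        have : (0 : ℝ) ≤ d := by positivity
        linarith

set_option maxHeartbeats 800000 in
/-- Recovery with explicit dependence on the dimension, in high dimension. -/
theorem exists_recovery_high_dimension (t₀ b κ : ℝ) (ht : 0 < t₀) (hb : 1 < b) (hκ : 0 < κ) :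
    ∃ A : ℝ, 0 < A ∧ ∀ (d n : ℕ), 1000000 ≤ d → 2000000 * (d : ℝ) ≤ n →
      ∀ inv : ℝ → ℝ, Function.LeftInverse inv Real.sigmoid →
      ∀ (ν : Measure ℝ) (ς : ℝ), 0 < ς → IsBoundedNoise ν ς → 1 ≤ tauMax d ς →
      ∀ (wStar w₀ : EuclideanSpace ℝ (Fin d)), ‖wStar‖ ≤ 1 → ‖w₀‖ ≤ 1 →
      ∀ (τ₀ : ℝ) (β η : ℕ → ℝ), Admissible d t₀ b κ τ₀ β η →
        (sampleLaw d n ν).real {S | ¬ ∀ ε : ℝ, 0 < ε → ∀ T : ℕ,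
            A * max 1 (Real.log (1 / ε)) ≤ T →
            recoveryError inv wStar w₀ τ₀ β η S T ≤ 6000 * (√d * (ς * √(d / n)) + ε)}
          ≤ 4 * Real.exp (-d) + 2 * n * Real.exp (-d) := by
  obtain ⟨T₀, hT₀⟩ := exists_temperature_eq_one ht hb
  -- The extra `2 T₀` gives each burn-in temperature failure probability at most `e^{-T₀} e^{-d}`,
  -- so the union over `T₀` of them still costs only `e^{-d}`.
  set K : ℝ := 7 + 2 * T₀ with hK
  have hK0 : 0 ≤ K := by positivity
  set M : ℝ := 2 ^ T₀ * (6 + 4 * K) with hM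
  set κ' := min κ 2 with hκ'
  have hκ0 : 0 < κ' := lt_min hκ two_pos
  have hκ2 : κ' ≤ 2 := min_le_right _ _
  obtain ⟨A, hA, hAT⟩ := exists_steps_geometric (a := κ' * (76 / 10000)) (by positivity)
    (by linarith) M T₀
  refine ⟨A, hA, ?_⟩
  intro d n hd6 hdn inv hinv ν ς hς hν hτ wStar w₀ hw hw₀ τ₀ β η had
  have := hν.isProb
  have hd : 1 ≤ d := le_trans (by norm_num) hd6
  have hd' : (0 : ℝ) < d := by exact_mod_cast hd
  have hn' : (0 : ℝ) < n := by linarith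
  have hdn1 : d ≤ n := by
    have : (d : ℝ) ≤ n := by linarith
    exact_mod_cast this
  have hd2 : 1 / √(d : ℝ) ≤ 1 / 1000 := by
    refine one_div_le_one_div_of_le (by norm_num) (Real.le_sqrt_of_sq_le ?_)
    have : (1000000 : ℝ) ≤ d := by exact_mod_cast hd6
    linarith
  have hςle := noise_width_le hς hτ
  set s := √((d : ℝ) / n) with hs
  have hs0 : 0 ≤ s := Real.sqrt_nonneg _
  have hs1 : s ≤ 1 / 1000 := by
    rw [hs, Real.sqrt_le_left (by norm_num), div_le_iff₀ hn']
    linarith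
  set v := (1 / √(d : ℝ)) • wStar with hv
  have hvd : ‖v‖ ≤ 1 / √(d : ℝ) := norm_gold_le hw
  set E₁ : Set (Sample d n) := {S | ¬ ∀ i, |(S i).2| ≤ ς} with hE₁
  set E₂ : Set (Sample d n) := {S | ¬ WellConditioned fun i => (S i).1} with hE₂
  set E₃ : Set (Sample d n) := {S | 3 * 7 * ς * √(d / n)
    < ‖vavg (fun i => (S i).2 * sigmoidDeriv (inner ℝ (S i).1 v)) fun i => (S i).1‖} with hE₃
  set E₄ : Set (Sample d n) := {S | ∃ i, √2 < |inner ℝ (S i).1 v|} with hE₄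
  set F : ℕ → Set (Sample d n) := fun t => {S | 3 * K * (5 / 4 * ς) * √(d / n)
    < ‖vavg (fun i => 1 / temperature τ₀ β t
      * (gradSigmoid (temperature τ₀ β t) (halfLogit (S i).2) - 1 / 2)) fun i => (S i).1‖}
    with hF
  have p₁ : (sampleLaw d n ν).real E₁ = 0 := by
    rw [measureReal_def, ae_iff.1 hν.ae_sample]; rfl
  have p₂ : (sampleLaw d n ν).real E₂ ≤ 2 * Real.exp (-d) :=
    (sampleLaw_not_wellConditioned_le d n ν).trans (wellConditioned_probability_le hdn)
  have p₃ : (sampleLaw d n ν).real E₃ ≤ Real.exp (-d) := by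
    refine (sampleLaw_norm_vavg_noise_le (K := 7) hd hdn1 hς hν v (by norm_num)).trans ?_
    refine le_trans (le_of_eq ?_) (five_pow_mul_exp_le d)
    congr 2; ring
  have p₄ : (sampleLaw d n ν).real E₄ ≤ 2 * n * Real.exp (-d) :=
    sampleLaw_exists_abs_inner_gt_le hd n hvd
  have pF : (sampleLaw d n ν).real (⋃ t ∈ Finset.range T₀, F t) ≤ Real.exp (-d) := by
    have h1 : ∀ t, (sampleLaw d n ν).real (F t) ≤ Real.exp (-T₀) * Real.exp (-d) := by
      intro t
      have hτ0 := ht.trans_le (had.temperature_ge ht hb t)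
      refine (sampleLaw_norm_vavg_indep_le hd hdn1 hν
        (measurable_graduated_halfLogit (temperature τ₀ β t)) (a := 5 / 4 * ς) (by positivity)
        (fun e he => abs_graduated_halfLogit_le hτ0 hςle he) hK0).trans ?_
      have hd1 : (1 : ℝ) ≤ d := by exact_mod_cast hd
      have hT : (0 : ℝ) ≤ T₀ := by positivity
      calc _ ≤ 5 ^ d * (Real.exp (-(3 * d)) * Real.exp (-T₀)) := by
            rw [← Real.exp_add]
            gcongr
            rw [hK]
            nlinarith
        _ = 5 ^ d * Real.exp (-(3 * d)) * Real.exp (-T₀) := by ring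
        _ ≤ Real.exp (-d) * Real.exp (-T₀) := by gcongr; exact five_pow_mul_exp_le d
        _ = _ := mul_comm _ _
    refine (measureReal_biUnion_finset_le _ _).trans
      ((Finset.sum_le_sum fun t _ => h1 t).trans ?_)
    rw [Finset.sum_const, Finset.card_range, nsmul_eq_mul, ← mul_assoc]
    refine mul_le_of_le_one_left (Real.exp_pos _).le ?_
    rw [Real.exp_neg, ← div_eq_mul_inv, div_le_one (Real.exp_pos _)]
    linarith [Real.add_one_le_exp (T₀ : ℝ)]
  have hsub : {S : Sample d n | ¬ ∀ ε : ℝ, 0 < ε → ∀ T : ℕ,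
            A * max 1 (Real.log (1 / ε)) ≤ T →
            recoveryError inv wStar w₀ τ₀ β η S T ≤ 6000 * (√d * (ς * s) + ε)}
      ⊆ ((E₁ ∪ E₂) ∪ (E₃ ∪ E₄)) ∪ ⋃ t ∈ Finset.range T₀, F t := by
    intro S hS
    by_contra hcon
    simp only [Set.mem_union, not_or] at hcon
    obtain ⟨⟨⟨c1, c2⟩, c3, c4⟩, c5⟩ := hcon
    have he : ∀ i, |(S i).2| ≤ ς := not_not.1 c1
    have hx : WellConditioned fun i => (S i).1 := not_not.1 c2
    have hD : ‖vavg (fun i => (S i).2 * sigmoidDeriv (inner ℝ (S i).1 v)) fun i => (S i).1‖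
        ≤ 3 * 7 * ς * s := not_lt.1 c3
    have ha : ∀ i, |inner ℝ (S i).1 v| ≤ √2 := fun i => not_lt.1 fun h => c4 ⟨i, h⟩
    have hF' : ∀ t < T₀, ‖vavg (fun i => 1 / temperature τ₀ β t
        * (gradSigmoid (temperature τ₀ β t) (halfLogit (S i).2) - 1 / 2)) fun i => (S i).1‖
        ≤ 3 * K * (5 / 4 * ς) * s := fun t htT =>
      not_lt.1 fun h => c5 (Set.mem_biUnion (Finset.mem_range.2 htT) h)
    refine hS fun ε hε T hT => ?_
    obtain ⟨hT0, hq1, hqε⟩ := hAT ε hε T hT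
    obtain ⟨hu0, hu1⟩ := scaledError_burn_in (w₀ := w₀) hd hd2 hx hinv hςle he ha ht hb hκ had hw
      hw₀ (by positivity) hF' T₀ le_rfl
    have hςs : ς * s ≤ 4 / 130 * (1 / 1000) := by gcongr
    -- The drift satisfies `θ ≥ 5/4 · ς/4` for `ς ≤ 4/130`, and `3/2 · 0.018 - 2 · 0.0097 = 0.0076`.
    have hmain := scaledError_le_of_temperature_eq_one (inv := inv) (w₀ := w₀) hd hx
      (hT₀ d κ τ₀ β η had)
      hκ0 (fun t => ⟨(min_le_left _ _).trans (had.rate_bounds ht hb hd t).1,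
        (had.rate_bounds ht hb hd t).2⟩) (B := 1 / 10) (R := 3 / 10) (h := 18 / 1000)
      (θ := 97 / 10000) (r := 76 / 10000)
      (by norm_num) (weight_lower_bound (hvd.trans hd2)) (by norm_num) (by norm_num)
      (by norm_num) (by norm_num) hD (by linarith) (fun u hu => by
          have h1 : ‖vavg (fun i => (S i).2 * (sigmoidDeriv (inner ℝ (S i).1 (v + u))
              - sigmoidDeriv (inner ℝ (S i).1 v))) fun i => (S i).1‖
              ≤ 5 / 4 * (ς / 4 * ‖u‖) := by
            refine hx.norm_vavg_le_of_abs_le_inner (by positivity) u fun i => ?_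
            have h2 := abs_sigmoidDeriv_sub_le (inner ℝ (S i).1 (v + u)) (inner ℝ (S i).1 v)
            rw [inner_add_right, add_sub_cancel_left] at h2
            rw [abs_mul, inner_add_right]
            calc _ ≤ ς * (|inner ℝ (S i).1 u| / 4) := by gcongr; exact he i
              _ = _ := by ring
          nlinarith [norm_nonneg u]) hu0 hT0
    set q := (1 - κ' * (76 / 10000)) ^ (T - T₀) with hq
    have hp : 0 ≤ q := pow_nonneg (by linarith) _
    have hsd : 0 < √(d : ℝ) := Real.sqrt_pos.2 hd'
    -- After undoing the scaling, the burn-in error is at most a constant depending on `T₀` times `1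
    -- + √d ς s`, with no bare `√d`. The factor `M` is then removed by `M q ≤ 1` and `M q ≤ ε`.
    have hu2 : √(d : ℝ) * ‖scaledError inv wStar w₀ τ₀ β η S T₀‖ ≤ M * (1 + √d * (ς * s)) := by
      calc _ ≤ √(d : ℝ) * (2 ^ T₀ * (6 * (1 / √(d : ℝ)) + 3 * K * (5 / 4 * ς) * s)) := by gcongr
        _ = 2 ^ T₀ * (6 + 15 / 4 * K * (√d * (ς * s))) := by
            field_simp
            ring
        _ ≤ 2 ^ T₀ * ((6 + 4 * K) * (1 + √d * (ς * s))) := by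
            have h1 : 0 ≤ √d * (ς * s) := by positivity
            have h2 := mul_nonneg hK0 h1
            refine mul_le_mul_of_nonneg_left ?_ (by positivity)
            linarith
        _ = _ := by rw [hM]; ring
    have h3 : 0 ≤ √d * (ς * s) := by positivity
    have h4 : √(d : ℝ) * (q * ‖scaledError inv wStar w₀ τ₀ β η S T₀‖) ≤ ε + √d * (ς * s) := by
      calc _ = q * (√(d : ℝ) * ‖scaledError inv wStar w₀ τ₀ β η S T₀‖) := by ring
        _ ≤ q * (M * (1 + √d * (ς * s))) := by gcongr
        _ = M * q + M * q * (√d * (ς * s)) := by ring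
        _ ≤ _ := add_le_add hqε (mul_le_of_le_one_left h3 hq1)
    rw [recoveryError_eq hd]
    calc _ ≤ √(d : ℝ) * (q * ‖scaledError inv wStar w₀ τ₀ β η S T₀‖
          + 2 * (3 * 7 * ς * s) / (76 / 10000)) := by gcongr
      _ ≤ _ := by
          have e : √(d : ℝ) * (2 * (3 * 7 * ς * s) / (76 / 10000))
              = 420000 / 76 * (√d * (ς * s)) := by ring
          rw [mul_add, e]
          linarith
  refine (measureReal_mono hsub (measure_ne_top _ _)).trans ((measureReal_union_le _ _).trans ?_)
  linarith [measureReal_union_le (μ := sampleLaw d n ν) E₁ E₂,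
    measureReal_union_le (μ := sampleLaw d n ν) E₃ E₄,
    measureReal_union_le (μ := sampleLaw d n ν) (E₁ ∪ E₂) (E₃ ∪ E₄)]

end Dimension

/-! ### Assembly of the three parts. -/

theorem mainTheorem4 :
    -- explicit dependence on the dimension, with universal constants `c` and `C`
    (∃ c C : ℝ, 0 < c ∧ 0 < C ∧
      ∀ t₀ b κ : ℝ, 0 < t₀ → 1 < b → 0 < κ → ∃ A : ℝ, 0 < A ∧
        ∀ (d n : ℕ), 1 ≤ d → C * (d * Real.log (d + 1)) ≤ n →
        ∀ inv : ℝ → ℝ, Function.LeftInverse inv Real.sigmoid →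
        ∀ (ν : Measure ℝ) (ς : ℝ), 0 < ς → IsBoundedNoise ν ς → 1 ≤ tauMax d ς →
        ∀ (wStar w₀ : EuclideanSpace ℝ (Fin d)), ‖wStar‖ ≤ 1 → ‖w₀‖ ≤ 1 →
        ∀ (τ₀ : ℝ) (β η : ℕ → ℝ), Admissible d t₀ b κ τ₀ β η →
          (sampleLaw d n ν).real {S | ¬ ∀ ε : ℝ, 0 < ε → ∀ T : ℕ,
              A * max 1 (Real.log (1 / ε)) ≤ T →
              recoveryError inv wStar w₀ τ₀ β η S T ≤ C * (√d * (ς * √(d / n)) + ε)}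
            ≤ C * Real.exp (-c * d) + 2 * n * Real.exp (-d)) ∧
    -- fixed dimension and confidence, all large sample sizes
    (∀ d : ℕ, 1 ≤ d → ∀ δ t₀ b κ : ℝ, 0 < δ → 0 < t₀ → 1 < b → 0 < κ →
      ∃ A C : ℝ, ∃ n₀ : ℕ, 0 < A ∧ 0 < C ∧
        ∀ n : ℕ, n₀ ≤ n →
        ∀ inv : ℝ → ℝ, Function.LeftInverse inv Real.sigmoid →
        ∀ (ν : Measure ℝ) (ς : ℝ), 0 < ς → IsBoundedNoise ν ς → 1 ≤ tauMax d ς →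
        ∀ (wStar w₀ : EuclideanSpace ℝ (Fin d)), ‖wStar‖ ≤ 1 → ‖w₀‖ ≤ 1 →
        ∀ (τ₀ : ℝ) (β η : ℕ → ℝ), Admissible d t₀ b κ τ₀ β η →
          (sampleLaw d n ν).real {S | ¬ ∀ ε : ℝ, 0 < ε → ∀ T : ℕ,
              A * max 1 (Real.log (1 / ε)) ≤ T →
              recoveryError inv wStar w₀ τ₀ β η S T ≤ C * (ς * √(d / n) + ε)} ≤ δ) ∧
    -- consistency: convergence in probability to the gold model as `n → ∞`
    (∀ d : ℕ, 1 ≤ d → ∀ t₀ b κ : ℝ, 0 < t₀ → 1 < b → 0 < κ →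
        ∀ inv : ℝ → ℝ, Function.LeftInverse inv Real.sigmoid →
        ∀ (ν : Measure ℝ) (ς : ℝ), 0 < ς → IsBoundedNoise ν ς → 1 ≤ tauMax d ς →
        ∀ (wStar w₀ : EuclideanSpace ℝ (Fin d)), ‖wStar‖ ≤ 1 → ‖w₀‖ ≤ 1 →
        ∀ (τ₀ : ℝ) (β η : ℕ → ℝ), Admissible d t₀ b κ τ₀ β η →
        ∀ T : ℕ → ℕ, Tendsto T atTop atTop → ∀ δ : ℝ, 0 < δ →
          Tendsto (fun n : ℕ => (sampleLaw d n ν).real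
            {S | δ ≤ recoveryError inv wStar w₀ τ₀ β η S (T n)}) atTop (𝓝 0)) := by
  refine ⟨⟨1, 4000000 + Real.exp 1000000, one_pos, by positivity, ?_⟩,
    exists_recovery_fixed_dimension, tendsto_recoveryError⟩
  intro t₀ b κ ht hb hκ
  obtain ⟨A, hA, H⟩ := exists_recovery_high_dimension t₀ b κ ht hb hκ
  refine ⟨A, hA, ?_⟩
  intro d n hd hdn inv hinv ν ς hς hν hτ wStar w₀ hw hw₀ τ₀ β η had
  have := hν.isProb
  have he : 0 < Real.exp 1000000 := Real.exp_pos _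
  have hed : 0 < Real.exp (-1 * (d : ℝ)) := Real.exp_pos _
  rcases lt_or_ge d 1000000 with h | h
  -- Here `C e^{-d} ≥ 1`, and there is nothing to prove.
  · have hd6 : (d : ℝ) ≤ 1000000 := by exact_mod_cast h.le
    have h1 : 1 ≤ Real.exp 1000000 * Real.exp (-1 * (d : ℝ)) := by
      rw [← Real.exp_add]
      exact Real.one_le_exp (by linarith)
    have h2 : 0 ≤ 2 * (n : ℝ) * Real.exp (-d) := by positivity
    refine measureReal_le_one.trans ?_
    rw [add_mul]
    linarith
  · have hd1 : (1 : ℝ) ≤ d := by exact_mod_cast hd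
    -- The logarithm in the sample size condition enters only through this lower bound; `n` of order
    -- `d` suffices for the argument.
    have hlog : 1 / 2 ≤ Real.log ((d : ℝ) + 1) := by
      have h1 : Real.log 2 ≤ Real.log ((d : ℝ) + 1) := Real.log_le_log two_pos (by linarith)
      linarith [Real.log_two_gt_d9]
    have hn : 2000000 * (d : ℝ) ≤ n := by
      refine le_trans ?_ hdn
      calc 2000000 * (d : ℝ) = 4000000 * (d * (1 / 2)) := by ring
        _ ≤ _ := by gcongr; linarith
    refine (measureReal_mono (fun S hS => ?_) (measure_ne_top _ _)).trans
      ((H d n h hn inv hinv ν ς hς hν hτ wStar w₀ hw hw₀ τ₀ β η had).trans ?_)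
    · refine fun h' => hS fun ε hε T hT => (h' ε hε T hT).trans ?_
      gcongr
      linarith
    · rw [neg_one_mul]
      gcongr
      linarith
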